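/- Let $T>1$, and for $n\ge 0$ let $G_n$ be the space of functions $\frac{\alpha_0}{2}+\sum_{k=1}^n\left(\alpha_k\cos\frac{\pi k x}{T}+\beta_k\sin\frac{\pi k x}{T}\right)$ with complex coefficients. For $\omega\in\mathbb{R}$ let $f_\omega(x)=\exp(i\pi\omega x)$. The continuous Fourier extension of $f_\omega$ is the function $g_{\omega,n}\in G_n$ minimizing $\|f_\omega-g\|$ over $g\in G_n$, where $\|\cdot\|$ is the norm of $L^2[-1,1]$. Put $$r(T)=2T\sin\tfrac{\pi}{2T},\qquad E(T)=\cot^2\tfrac{\pi}{4T},\qquad \tau(T)=\frac{T}{\sqrt{1+\cos^2\frac{\pi}{2T}}},\qquad e_n(\omega)=\|f_\omega-g_{\omega,n}\|.$$ Then $g_{\omega,n}$ exists and is unique for all $\omega\in\mathbb{R}$ and $n\ge 0$, and the following hold, where all constants may depend on $T$. 1. The error is $\mathcal{O}(1)$ for $n<\frac12|\omega|r(T)$: there is $C$ such that $e_n(\omega)\le C$ for all $\omega$ and $n$ with $n<\frac12|\omega|r(T)$. It is of order one there: for every $\mu<\frac12 r(T)$ there are $c>0$ and $\omega_0$ such that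 $e_n(\omega)\ge c$ whenever $|\omega|\ge\omega_0$ and $n\le\mu|\omega|$. 2. Once $n$ exceeds $\frac12|\omega|r(T)$, the error decays exponentially: for every $\mu>\frac12 r(T)$ there are $\rho>1$ and $C$, independent of $\omega$ and $n$, such that $e_n(\omega)\le C\rho^{-(n-\mu|\omega|)}$ for all $\omega$ and all $n\ge\mu|\omega|$. 3. For $n>\tau(T)|\omega|$ the error decays at rate $E(T)$: there is $C$, independent of $\omega$ and $n$, such that $e_n(\omega)\le C\,E(T)^{-(n-\tau(T)|\omega|)}$ for all $\omega$ and all $n>\tau(T)|\omega|$. If $\omega\ne m/T$ for every integer $m$, the rate of exponential convergence is precisely $E(T)$: $E(T)>1$, $e_n(\omega)=\mathcal{O}(E(T)^{-n})$ as $n\to\infty$, and $e_n(\omega)=\mathcal{O}(\sigma^{-n})$ fails for every $\sigma>E(T)$. 4. If $\omega=m/T$ for some integer $m$, the convergence is superexponential: $e_n(\omega)=\mathcal{O}(\sigma^{-n})$ as $n\to\infty$ for every $\sigma>1$. -/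

import Mathlib

open Filter Asymptotics

noncomputable section

/-- The oscillatory function `f(x) = exp(i π ω x)`. -/
def complexOscillation (ω : ℝ) (x : ℝ) : ℂ :=
  Complex.exp (Complex.I * (Real.pi : ℂ) * (ω : ℂ) * (x : ℂ))

/-- The space `G_n` of `2T`-periodic trigonometric polynomials of degree at most `n`,
`α₀ / 2 + ∑_{k=1}^n (α_k cos (π k x / T) + β_k sin (π k x / T))`, with complex coefficients. -/
def trigSpace (T : ℝ) (n : ℕ) : Set (ℝ → ℂ) :=
  {g | ∃ α β : ℕ → ℂ, ∀ x : ℝ,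
    g x = α 0 / 2 + ∑ k ∈ Finset.Icc 1 n,
      (α k * ((Real.cos (Real.pi / T * k * x) : ℝ) : ℂ) +
        β k * ((Real.sin (Real.pi / T * k * x) : ℝ) : ℂ))}

/-- The norm of `L²[-1,1]`, for functions that are square integrable on `[-1,1]`
(it is applied only to continuous functions). -/
def l2Norm (h : ℝ → ℂ) : ℝ :=
  Real.sqrt (∫ x in (-1 : ℝ)..1, ‖h x‖ ^ 2)

/-- `g` is a continuous Fourier extension of `f` to `[-T,T]` of degree `n`: it minimizes
`‖f - h‖` in `L²[-1,1]` over all `h ∈ G_n`. -/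
def IsContinuousFourierExtension (T : ℝ) (n : ℕ) (f g : ℝ → ℂ) : Prop :=
  g ∈ trigSpace T n ∧ ∀ h ∈ trigSpace T n, l2Norm (f - g) ≤ l2Norm (f - h)

/-- `r(T) = 2 T sin (π / (2T))`. -/
def resolutionConstant (T : ℝ) : ℝ :=
  2 * T * Real.sin (Real.pi / (2 * T))

/-- `E(T) = cot² (π / (4T))`. -/
def extensionRate (T : ℝ) : ℝ :=
  Real.cot (Real.pi / (4 * T)) ^ 2

/-- `T / √(1 + cos² (π / (2T)))`. -/
def rateThreshold (T : ℝ) : ℝ :=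
  T / Real.sqrt (1 + Real.cos (Real.pi / (2 * T)) ^ 2)

/-- The errors `e n` tend to zero exponentially fast, and the best possible rate is precisely `ρ`:
`e n = O(ρ⁻ⁿ)` with `ρ > 1`, and `e n = O(σ⁻ⁿ)` fails for every `σ > ρ`. -/
def ExponentialRateIsPrecisely (e : ℕ → ℝ) (ρ : ℝ) : Prop :=
  1 < ρ ∧ (e =O[atTop] fun n : ℕ => (ρ ^ n)⁻¹) ∧
    ∀ σ : ℝ, ρ < σ → ¬ (e =O[atTop] fun n : ℕ => (σ ^ n)⁻¹)

/-- The errors `e n` tend to zero superexponentially fast: `e n = O(σ⁻ⁿ)` for every `σ > 1`. -/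
def ConvergesSuperexponentially (e : ℕ → ℝ) : Prop :=
  ∀ σ : ℝ, 1 < σ → e =O[atTop] fun n : ℕ => (σ ^ n)⁻¹

end

/-!
In the variable `θ = π x / T` the space `G_n` consists of the trigonometric polynomials of degree
`n`, `f_ω` becomes `exp (i Ω θ)` with `Ω = ω T`, and `[-1, 1]` becomes the arc `|θ| ≤ π / T`. Put
`s = sin (π / (2T))` and substitute `sin (θ / 2) = s sin t` on the arc. Then `cos θ` is an affine
function of `cos (2 t)`, so that `cos (2 k t)` and `cos (θ / 2) sin ((2 k + 1) t)` are trigonometric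
polynomials of degree `k` and `k + 1` in `θ` (`exists_cos_nat_mul_eq`,
`exists_cos_mul_sin_odd_eq`). The Fourier extension is an orthogonal projection onto a
finite-dimensional space; it exists and is unique
(`existsUnique_isContinuousFourierExtension`).

*Upper bounds.* As a function of `ζ = exp (i t)`, `exp (i Ω θ)` is analytic in the annulus
`exp (-κ₀) < |ζ| < exp κ₀` with `s cosh κ₀ = 1`, where `E(T) = exp (2 κ₀)`. On `|ζ| = exp κ` it is
bounded by `exp (2 |Ω| arsinh (s sinh κ))` (`abs_im_complexArcsin_scaledSine_le`), which gives the
decay of its Fourier coefficients in `t`. The part that is odd in `θ` has to be divided by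
`cos (θ / 2)` before it is expanded. This quotient is unbounded at the boundary of the annulus, but
`1 / cos (θ / 2)` has argument at most `π / 4`, so that its mean modulus over a circle is at most
`√2` times the mean of its real part, which does not depend on the radius
(`integral_norm_inv_cosArcsin_le`). Truncating the expansion after `2 n` terms gives
`e_n(ω) ≤ C exp (2 |Ω| arsinh (s sinh κ) - 2 n κ)` (`exists_trigPoly_norm_sub_le`,
`l2Norm_sub_le_errorBound`). Small `κ` yield the threshold `T s = r(T) / 2`, since
`arsinh (s sinh κ) ≤ s sinh κ`. The choice `κ = κ₀` yields the rate `E(T)`, from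
`n = (T arsinh c / κ₀) |ω|` on, where `c = s sinh κ₀ = cos (π / (2T))` and `κ₀ = artanh c`; the
inequality `√(1 + c²) arsinh c ≤ artanh c` (`sqrt_mul_arsinh_le`) turns this into the threshold
`τ(T)`.

*Lower bound.* Write `t = φ / 2`. Restricted to even functions and multiplied by `1 + cos φ`, the
substitution is bounded from `L²[-1, 1]` to `L²[-π, π]` (`exists_integral_sq_arcPullback_le`) and
maps `G_n` into the trigonometric polynomials of degree `n + 1` in `φ`
(`arcPullback_evenPart_mem`). The even part `cos (Ω θ)` of `f_ω` has local frequency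
`|Ω| θ'(0) = |ω| T s` at `φ = 0`. If `n ≤ μ |ω|` with `μ < T s`, then on a small interval around
`0` the integral of `exp (i k φ)` against `exp (-i Ω θ)` is `O(1 / Ω)` for all `|k| ≤ n + 1` by
integration by parts (`exists_norm_integral_exp_le`). By Bessel's inequality the pullback of the
extension contributes `O(Ω ^ (-1/2))` to this pairing, whereas `cos (Ω θ)` contributes a positive
constant (`exists_le_l2Norm_sub`).

*Precision of the rate.* If `e_n(ω) = O(σ⁻ⁿ)` with `σ > E(T)`, then the Fourier coefficients in `φ`
of the pullback of `cos (Ω θ)` are `O(σ^(-|k|))` (`exists_norm_fourierCoef_le_of_isBigO`). Its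
Chebyshev series in the affine function `cos φ` of `cos θ` therefore converges locally uniformly for
all complex `θ` close to the real line (`exists_strip`), and by the identity theorem its sum is the
entire function `(1 + cos φ) cos (Ω θ)`. A function of `cos θ` is symmetric about `θ = π`, and
`cos (Ω θ)` has this symmetry only if `Ω` is an integer (`exists_int_of_isBigO`). If `Ω = m` is an
integer, then `f_ω` lies in `G_n` for `n ≥ |m|` and the error vanishes.
-/

/-! ### Trigonometric polynomials -/

/-- The exponential `x ↦ exp (i k x)`. -/
noncomputable def expi (k : ℤ) (x : ℝ) : ℂ := Complex.exp ((k : ℂ) * x * Complex.I)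

/-- The `2π`-periodic trigonometric polynomials of degree at most `N`, as the linear span of the
exponentials `exp (i k x)` with `|k| ≤ N`. -/
noncomputable def trigPoly (N : ℕ) : Submodule ℂ (ℝ → ℂ) :=
  Submodule.span ℂ (expi '' Set.Icc (-(N : ℤ)) N)

lemma expi_mem_trigPoly {N : ℕ} {k : ℤ} (hk : |k| ≤ N) : expi k ∈ trigPoly N :=
  Submodule.subset_span ⟨k, by rw [Set.mem_Icc, ← abs_le]; exact hk, rfl⟩

lemma trigPoly_mono {M N : ℕ} (h : M ≤ N) : trigPoly M ≤ trigPoly N :=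
  Submodule.span_mono (Set.image_mono (Set.Icc_subset_Icc (by omega) (by omega)))

instance (N : ℕ) : FiniteDimensional ℂ (trigPoly N) :=
  FiniteDimensional.span_of_finite ℂ ((Set.finite_Icc _ _).image _)

lemma expi_add (k l : ℤ) (x : ℝ) : expi (k + l) x = expi k x * expi l x := by
  simp only [expi, ← Complex.exp_add]; congr 1; push_cast; ring

@[fun_prop]
lemma continuous_expi (k : ℤ) : Continuous (expi k) := by
  unfold expi; fun_prop

lemma expi_eq_cos_add_sin (k : ℤ) (x : ℝ) :
    expi k x = (Real.cos (k * x) : ℂ) + (Real.sin (k * x) : ℂ) * Complex.I := by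
  rw [expi, Complex.exp_mul_I]; push_cast; ring

lemma cos_eq_expi (k : ℤ) (x : ℝ) :
    (Real.cos (k * x) : ℂ) = (expi k x + expi (-k) x) / 2 := by
  rw [expi_eq_cos_add_sin, expi_eq_cos_add_sin]; push_cast
  rw [neg_mul, Complex.cos_neg, Complex.sin_neg]; ring

lemma sin_eq_expi (k : ℤ) (x : ℝ) :
    (Real.sin (k * x) : ℂ) = (expi k x - expi (-k) x) / (2 * Complex.I) := by
  rw [expi_eq_cos_add_sin, expi_eq_cos_add_sin]; push_cast
  rw [neg_mul, Complex.cos_neg, Complex.sin_neg]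
  field_simp
  ring

lemma cos_mem_trigPoly {N : ℕ} {k : ℤ} (hk : |k| ≤ N) :
    (fun x : ℝ => (Real.cos (k * x) : ℂ)) ∈ trigPoly N := by
  have : (fun x : ℝ => (Real.cos (k * x) : ℂ)) = (1 / 2 : ℂ) • (expi k + expi (-k)) := by
    ext x; rw [cos_eq_expi]; simp; ring
  rw [this]
  exact Submodule.smul_mem _ _ (add_mem (expi_mem_trigPoly hk)
    (expi_mem_trigPoly (by rwa [abs_neg])))

lemma sin_mem_trigPoly {N : ℕ} {k : ℤ} (hk : |k| ≤ N) :
    (fun x : ℝ => (Real.sin (k * x) : ℂ)) ∈ trigPoly N := by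
  have : (fun x : ℝ => (Real.sin (k * x) : ℂ)) =
      (1 / (2 * Complex.I) : ℂ) • (expi k - expi (-k)) := by
    ext x; rw [sin_eq_expi]; simp only [Pi.smul_apply, Pi.sub_apply, smul_eq_mul]; ring
  rw [this]
  exact Submodule.smul_mem _ _ (sub_mem (expi_mem_trigPoly hk)
    (expi_mem_trigPoly (by rwa [abs_neg])))

lemma const_mem_trigPoly (N : ℕ) (a : ℂ) : (fun _ : ℝ => a) ∈ trigPoly N := by
  have : (fun _ : ℝ => a) = a • expi 0 := by ext x; simp [expi]
  rw [this]
  exact Submodule.smul_mem _ _ (expi_mem_trigPoly (by simp))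

lemma exists_coeff_of_mem_trigPoly {N : ℕ} {u : ℝ → ℂ} (hu : u ∈ trigPoly N) :
    ∃ c : ℤ → ℂ, ∀ x, u x = ∑ k ∈ Finset.Icc (-(N : ℤ)) N, c k * expi k x := by
  induction hu using Submodule.span_induction with
  | mem v hv =>
    obtain ⟨k, hk, rfl⟩ := hv
    refine ⟨fun l => if l = k then 1 else 0, fun x => ?_⟩
    rw [Set.mem_Icc] at hk
    simp [hk]
  | zero => exact ⟨0, by simp⟩
  | add v w _ _ hv hw =>
    obtain ⟨c, hc⟩ := hv
    obtain ⟨d, hd⟩ := hw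
    exact ⟨c + d, fun x => by simp [hc, hd, add_mul, Finset.sum_add_distrib]⟩
  | smul a v _ hv =>
    obtain ⟨c, hc⟩ := hv
    exact ⟨a • c, fun x => by simp [hc, Finset.mul_sum, mul_assoc]⟩

lemma cos_mul_mem_trigPoly {N : ℕ} {u : ℝ → ℂ} (hu : u ∈ trigPoly N) :
    (fun x : ℝ => (Real.cos x : ℂ) * u x) ∈ trigPoly (N + 1) := by
  induction hu using Submodule.span_induction with
  | mem v hv =>
    obtain ⟨k, hk, rfl⟩ := hv
    rw [Set.mem_Icc] at hk
    have : (fun x : ℝ => (Real.cos x : ℂ) * expi k x) =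
        (1 / 2 : ℂ) • (expi (1 + k) + expi (-1 + k)) := by
      ext x
      have := cos_eq_expi 1 x
      rw [Int.cast_one, one_mul] at this
      rw [this]
      simp only [Pi.smul_apply, Pi.add_apply, expi_add, smul_eq_mul]; ring
    rw [this]
    refine Submodule.smul_mem _ _ (add_mem (expi_mem_trigPoly ?_) (expi_mem_trigPoly ?_)) <;>
    · rw [abs_le]; push_cast; constructor <;> omega
  | zero => simp only [Pi.zero_apply, mul_zero]; exact zero_mem _
  | add v w _ _ hv hw => simp only [Pi.add_apply, mul_add]; exact add_mem hv hw
  | smul a v _ hv =>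
    convert Submodule.smul_mem _ a hv using 1
    ext x; simp; ring

lemma continuous_of_mem_trigPoly {N : ℕ} {u : ℝ → ℂ} (hu : u ∈ trigPoly N) : Continuous u := by
  obtain ⟨c, hc⟩ := exists_coeff_of_mem_trigPoly hu
  rw [funext hc]
  fun_prop

lemma analyticOnNhd_of_mem_trigPoly {N : ℕ} {u : ℝ → ℂ} (hu : u ∈ trigPoly N) :
    AnalyticOnNhd ℝ u Set.univ := by
  obtain ⟨c, hc⟩ := exists_coeff_of_mem_trigPoly hu
  rw [funext hc]
  refine Finset.analyticOnNhd_fun_sum _ fun k _ => analyticOnNhd_const.mul fun x _ => ?_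
  have h1 : AnalyticAt ℝ (fun x : ℝ => (k : ℂ) * (x : ℂ) * Complex.I) x :=
    (analyticAt_const.mul (Complex.ofRealCLM.analyticAt x)).mul analyticAt_const
  exact (analyticAt_cexp.restrictScalars (𝕜 := ℝ)).comp h1

/-- One step of a three-term recurrence of Chebyshev type, with an affine function of the cosine as
multiplier, raises the degree of a trigonometric polynomial by one. -/
lemma recurrence_mem_trigPoly {N k : ℕ} (hk : k + 1 ≤ N) {u v : ℝ → ℂ} (p q : ℝ)
    (hu : u ∈ trigPoly k) (hv : v ∈ trigPoly N) :
    (fun x : ℝ => 2 * ((p + q * Real.cos x : ℝ) : ℂ) * v x - u x) ∈ trigPoly (N + 1) := by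
  have h1 : (2 * p : ℂ) • v ∈ trigPoly (N + 1) :=
    Submodule.smul_mem _ _ (trigPoly_mono (by omega) hv)
  have h2 := Submodule.smul_mem _ (2 * q : ℂ) (cos_mul_mem_trigPoly hv)
  convert sub_mem (add_mem h1 h2) (trigPoly_mono (by omega : k ≤ N + 1) hu) using 1
  ext x
  simp; ring

/-- If `cos θ` is an affine function of `cos φ`, then `cos (k θ)` is a trigonometric polynomial
of degree `k` in `φ`. -/
lemma exists_cos_nat_mul_eq (p q : ℝ) (k : ℕ) :
    ∃ v ∈ trigPoly k, ∀ θ φ : ℝ, Real.cos θ = p + q * Real.cos φ →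
      (Real.cos (k * θ) : ℂ) = v φ := by
  induction k using Nat.twoStepInduction with
  | zero => exact ⟨fun _ => 1, const_mem_trigPoly _ _, by simp⟩
  | one =>
    refine ⟨fun φ => (p : ℂ) + q * Real.cos φ, ?_, ?_⟩
    · refine add_mem (const_mem_trigPoly _ _) (Submodule.smul_mem _ (q : ℂ) ?_)
      simpa using cos_mem_trigPoly (N := 1) (k := 1) (by simp)
    · intro θ φ h
      rw [Nat.cast_one, one_mul, h]; push_cast; rfl
  | more k ih1 ih2 =>
    obtain ⟨u, hu, hu'⟩ := ih1
    obtain ⟨v, hv, hv'⟩ := ih2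
    refine ⟨_, recurrence_mem_trigPoly le_rfl p q hu hv, fun θ φ h => ?_⟩
    rw [← hu' θ φ h, ← hv' θ φ h, ← h]
    have h1 : ((k + 2 : ℕ) : ℝ) * θ = (k + 1 : ℕ) * θ + θ := by push_cast; ring
    have h2 : (k : ℝ) * θ = (k + 1 : ℕ) * θ - θ := by push_cast; ring
    rw [h1, h2, Real.cos_add, Real.cos_sub]
    push_cast; ring

lemma cos_two_mul_eq {s : ℝ} (hs : 0 < s) {θ t : ℝ} (h : Real.sin (θ / 2) = s * Real.sin t) :
    Real.cos (2 * t) = (1 - 1 / s ^ 2) + 1 / s ^ 2 * Real.cos θ := by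
  have h1 : Real.sin t = Real.sin (θ / 2) / s := by rw [h]; field_simp
  have h2 : Real.cos θ = 1 - 2 * Real.sin (θ / 2) ^ 2 := by
    have := Real.cos_two_mul (θ / 2)
    rw [mul_div_cancel₀ _ two_ne_zero] at this
    rw [this, Real.cos_sq']; ring
  have h3 : Real.cos (2 * t) = 1 - 2 * Real.sin t ^ 2 := by
    rw [Real.cos_two_mul, Real.cos_sq']; ring
  rw [h3, h1, h2]; field_simp; ring

/-- Under the substitution `sin (θ / 2) = s sin t`, the function `cos (θ / 2) sin ((2 k + 1) t)` is
an odd trigonometric polynomial of degree `k + 1` in `θ`. -/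
lemma exists_cos_mul_sin_odd_eq {s : ℝ} (hs : 0 < s) (k : ℕ) :
    ∃ v ∈ trigPoly (k + 1), ∀ θ t : ℝ, Real.sin (θ / 2) = s * Real.sin t →
      ((Real.cos (θ / 2) * Real.sin ((2 * k + 1 : ℕ) * t) : ℝ) : ℂ) = v θ := by
  have hbase : ∀ θ t : ℝ, Real.sin (θ / 2) = s * Real.sin t →
      Real.cos (θ / 2) * Real.sin t = 1 / (2 * s) * Real.sin θ := by
    intro θ t h
    have h1 : Real.sin t = Real.sin (θ / 2) / s := by rw [h]; field_simp
    have h2 : Real.sin θ = 2 * Real.sin (θ / 2) * Real.cos (θ / 2) := by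
      rw [← Real.sin_two_mul, mul_div_cancel₀ _ two_ne_zero]
    rw [h1, h2]; field_simp
  have hsin : (fun θ : ℝ => ((1 / (2 * s) : ℝ) : ℂ) * (Real.sin θ : ℂ)) ∈ trigPoly 1 := by
    refine Submodule.smul_mem _ ((1 / (2 * s) : ℝ) : ℂ) ?_
    simpa using sin_mem_trigPoly (N := 1) (k := 1) (by simp)
  induction k using Nat.twoStepInduction with
  | zero =>
    refine ⟨_, hsin, fun θ t h => ?_⟩
    rw [mul_zero, zero_add, Nat.cast_one, one_mul, hbase θ t h]; push_cast; rfl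
  | one =>
    -- `sin (3 t) = (1 + 2 cos (2 t)) sin t` is the recurrence with `sin (-t) = -sin t` as first term
    have h0 : (fun θ : ℝ => -(((1 / (2 * s) : ℝ) : ℂ) * (Real.sin θ : ℂ))) ∈ trigPoly 1 :=
      neg_mem hsin
    have h1 := Submodule.smul_mem (trigPoly 2) (2 * ((1 - 1 / s ^ 2 : ℝ) : ℂ))
      (trigPoly_mono one_le_two hsin)
    have h2 := Submodule.smul_mem _ (2 * ((1 / s ^ 2 : ℝ) : ℂ)) (cos_mul_mem_trigPoly hsin)
    refine ⟨_, sub_mem (add_mem h1 h2) (trigPoly_mono one_le_two h0), fun θ t h => ?_⟩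
    have h3 : ((2 * 1 + 1 : ℕ) : ℝ) * t = 2 * t + t := by push_cast; ring
    have h4 : Real.cos (θ / 2) * Real.sin ((2 * 1 + 1 : ℕ) * t) =
        (2 * Real.cos (2 * t) + 1) * (Real.cos (θ / 2) * Real.sin t) := by
      rw [h3, Real.sin_add, Real.sin_two_mul, Real.cos_two_mul]; ring
    rw [h4, hbase θ t h, cos_two_mul_eq hs h]
    simp only [Pi.add_apply, Pi.smul_apply, Pi.sub_apply, smul_eq_mul]
    push_cast; ring
  | more k ih1 ih2 =>
    obtain ⟨u, hu, hu'⟩ := ih1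
    obtain ⟨v, hv, hv'⟩ := ih2
    refine ⟨_, recurrence_mem_trigPoly le_rfl (1 - 1 / s ^ 2) (1 / s ^ 2) hu hv,
      fun θ t h => ?_⟩
    rw [← hu' θ t h, ← hv' θ t h, ← cos_two_mul_eq hs h]
    have h1 : ((2 * (k + 2) + 1 : ℕ) : ℝ) * t = (2 * (k + 1) + 1 : ℕ) * t + 2 * t := by
      push_cast; ring
    have h2 : ((2 * k + 1 : ℕ) : ℝ) * t = (2 * (k + 1) + 1 : ℕ) * t - 2 * t := by push_cast; ring
    rw [h1, h2, Real.sin_add, Real.sin_sub]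
    push_cast; ring

/-- The space `G_n` consists of the trigonometric polynomials of degree at most `n` in
`θ = π x / T`. -/
lemma mem_trigSpace_iff {T : ℝ} {n : ℕ} {g : ℝ → ℂ} :
    g ∈ trigSpace T n ↔ ∃ u ∈ trigPoly n, ∀ x, g x = u (Real.pi / T * x) := by
  constructor
  · rintro ⟨α, β, h⟩
    refine ⟨fun θ => α 0 / 2 + ∑ k ∈ Finset.Icc 1 n,
      (α k * (Real.cos (((k : ℕ) : ℤ) * θ) : ℂ) + β k * (Real.sin (((k : ℕ) : ℤ) * θ) : ℂ)),
      ?_, fun x => ?_⟩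
    · refine add_mem (const_mem_trigPoly _ _) ?_
      have : (fun θ : ℝ => ∑ k ∈ Finset.Icc 1 n,
          (α k * (Real.cos (((k : ℕ) : ℤ) * θ) : ℂ) + β k * (Real.sin (((k : ℕ) : ℤ) * θ) : ℂ))) =
          ∑ k ∈ Finset.Icc 1 n, (α k • (fun θ : ℝ => (Real.cos (((k : ℕ) : ℤ) * θ) : ℂ)) +
            β k • (fun θ : ℝ => (Real.sin (((k : ℕ) : ℤ) * θ) : ℂ))) := by
        ext θ; simp
      rw [this]
      refine sum_mem fun k hk => ?_
      have hk' : |((k : ℕ) : ℤ)| ≤ n := by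
        rw [Finset.mem_Icc] at hk; simpa using hk.2
      exact add_mem (Submodule.smul_mem _ _ (cos_mem_trigPoly hk'))
        (Submodule.smul_mem _ _ (sin_mem_trigPoly hk'))
    · rw [h]
      simp only [Int.cast_natCast]
      refine congrArg _ (Finset.sum_congr rfl fun k _ => ?_)
      rw [show Real.pi / T * k * x = k * (Real.pi / T * x) by ring]
  · rintro ⟨u, hu, hg⟩
    suffices ∃ α β : ℕ → ℂ, ∀ θ : ℝ, u θ = α 0 / 2 + ∑ k ∈ Finset.Icc 1 n,
        (α k * ((Real.cos (k * θ) : ℝ) : ℂ) + β k * ((Real.sin (k * θ) : ℝ) : ℂ)) by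
      obtain ⟨α, β, h⟩ := this
      refine ⟨α, β, fun x => ?_⟩
      rw [hg, h]
      refine congrArg _ (Finset.sum_congr rfl fun k _ => ?_)
      rw [show Real.pi / T * k * x = k * (Real.pi / T * x) by ring]
    clear hg
    induction hu using Submodule.span_induction with
    | mem v hv =>
      obtain ⟨k, hk, rfl⟩ := hv
      rw [Set.mem_Icc] at hk
      rcases eq_or_ne k 0 with rfl | hk0
      · refine ⟨fun j => if j = 0 then 2 else 0, 0, fun θ => ?_⟩
        rw [Finset.sum_eq_zero]
        · simp [expi]
        · intro j hj
          rw [Finset.mem_Icc] at hj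
          simp [show j ≠ 0 by omega]
      · refine ⟨fun j => if j = k.natAbs then 1 else 0,
          fun j => if j = k.natAbs then (k.sign : ℂ) * Complex.I else 0, fun θ => ?_⟩
        have hmem : k.natAbs ∈ Finset.Icc 1 n := by rw [Finset.mem_Icc]; omega
        rw [Finset.sum_eq_single_of_mem _ hmem]
        · have h0 : (0 : ℕ) ≠ k.natAbs := by omega
          simp only [if_true, if_neg h0]
          rw [expi_eq_cos_add_sin]
          rcases lt_or_gt_of_ne hk0 with h | h
          · have h1 : ((k.natAbs : ℕ) : ℝ) = -(k : ℝ) := by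
              rw [Nat.cast_natAbs, abs_of_neg h]; push_cast; rfl
            rw [h1, Int.sign_eq_neg_one_of_neg h, neg_mul, Real.cos_neg, Real.sin_neg]
            push_cast; ring
          · have h1 : ((k.natAbs : ℕ) : ℝ) = (k : ℝ) := by
              rw [Nat.cast_natAbs, abs_of_pos h]
            rw [h1, Int.sign_eq_one_of_pos h]
            push_cast; ring
        · intro j _ hj
          simp [hj]
    | zero => exact ⟨0, 0, by simp⟩
    | add v w _ _ hv hw =>
      obtain ⟨α, β, h⟩ := hv
      obtain ⟨α', β', h'⟩ := hw
      refine ⟨α + α', β + β', fun θ => ?_⟩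
      simp only [Pi.add_apply, h, h', add_mul, add_div, Finset.sum_add_distrib]
      ring
    | smul a v _ hv =>
      obtain ⟨α, β, h⟩ := hv
      refine ⟨a • α, a • β, fun θ => ?_⟩
      simp only [Pi.smul_apply, h, smul_eq_mul, mul_add, Finset.mul_sum, mul_assoc, mul_div_assoc]


/-! ### The norm of `L²[-1,1]` -/

lemma memLp_of_continuous {h : ℝ → ℂ} (hh : Continuous h) :
    MeasureTheory.MemLp h 2 (MeasureTheory.volume.restrict (Set.Ioc (-1 : ℝ) 1)) := by
  obtain ⟨C, hC⟩ := isCompact_Icc.exists_bound_of_continuousOn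
    (hh.continuousOn (s := Set.Icc (-1 : ℝ) 1))
  refine MeasureTheory.MemLp.of_bound hh.aestronglyMeasurable C ?_
  filter_upwards [MeasureTheory.ae_restrict_mem measurableSet_Ioc] with x hx
  exact hC x (Set.Ioc_subset_Icc_self hx)

lemma norm_toLp_eq_l2Norm {h : ℝ → ℂ} (hh : Continuous h) :
    ‖(memLp_of_continuous hh).toLp h‖ = l2Norm h := by
  rw [MeasureTheory.Lp.norm_toLp,
    (memLp_of_continuous hh).eLpNorm_eq_integral_rpow_norm two_ne_zero ENNReal.ofNat_ne_top,
    ENNReal.toReal_ofReal (by positivity), l2Norm, Real.sqrt_eq_rpow,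
    intervalIntegral.integral_of_le (by norm_num)]
  simp

lemma l2Norm_nonneg (h : ℝ → ℂ) : 0 ≤ l2Norm h := Real.sqrt_nonneg _

lemma sq_l2Norm (h : ℝ → ℂ) : l2Norm h ^ 2 = ∫ x in (-1 : ℝ)..1, ‖h x‖ ^ 2 :=
  Real.sq_sqrt (intervalIntegral.integral_nonneg (by norm_num) fun _ _ => by positivity)

lemma l2Norm_add_le {f g : ℝ → ℂ} (hf : Continuous f) (hg : Continuous g) :
    l2Norm (f + g) ≤ l2Norm f + l2Norm g := by
  rw [← norm_toLp_eq_l2Norm hf, ← norm_toLp_eq_l2Norm hg, ← norm_toLp_eq_l2Norm (hf.add hg),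
    MeasureTheory.MemLp.toLp_add (memLp_of_continuous hf) (memLp_of_continuous hg)]
  exact norm_add_le _ _

lemma l2Norm_smul (a : ℂ) (f : ℝ → ℂ) : l2Norm (a • f) = ‖a‖ * l2Norm f := by
  simp only [l2Norm, Pi.smul_apply, norm_smul, mul_pow, intervalIntegral.integral_const_mul]
  rw [Real.sqrt_mul (by positivity), Real.sqrt_sq (norm_nonneg _)]

lemma l2Norm_sub_le {f g : ℝ → ℂ} (hf : Continuous f) (hg : Continuous g) :
    l2Norm (f - g) ≤ l2Norm f + l2Norm g := by
  have h := l2Norm_add_le hf (hg.const_smul (-1 : ℂ))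
  rw [l2Norm_smul, norm_neg, norm_one, one_mul] at h
  rwa [sub_eq_add_neg, ← neg_one_smul ℂ g]

lemma l2Norm_le_of_norm_le {h : ℝ → ℂ} {M : ℝ} (hh : Continuous h) (hM : 0 ≤ M)
    (hb : ∀ x ∈ Set.Icc (-1 : ℝ) 1, ‖h x‖ ≤ M) : l2Norm h ≤ Real.sqrt 2 * M := by
  have h1 : ∫ x in (-1 : ℝ)..1, ‖h x‖ ^ 2 ≤ ∫ x in (-1 : ℝ)..1, M ^ 2 := by
    refine intervalIntegral.integral_mono_on (by norm_num)
      ((hh.norm.pow 2).intervalIntegrable _ _) (by simp) fun x hx => ?_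
    exact pow_le_pow_left₀ (norm_nonneg _) (hb x hx) 2
  rw [intervalIntegral.integral_const, smul_eq_mul] at h1
  calc l2Norm h ≤ Real.sqrt (2 * M ^ 2) := Real.sqrt_le_sqrt (by linarith)
    _ = _ := by rw [Real.sqrt_mul (by norm_num), Real.sqrt_sq hM]

lemma l2Norm_comp_neg (h : ℝ → ℂ) : l2Norm (fun x => h (-x)) = l2Norm h := by
  simp only [l2Norm]
  rw [intervalIntegral.integral_comp_neg (fun x => ‖h x‖ ^ 2)]
  simp

/-- The even part of a function. -/
noncomputable def evenPart (h : ℝ → ℂ) (x : ℝ) : ℂ := (h x + h (-x)) / 2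

lemma continuous_evenPart {h : ℝ → ℂ} (hh : Continuous h) : Continuous (evenPart h) := by
  unfold evenPart; fun_prop

lemma evenPart_sub (f g : ℝ → ℂ) : evenPart (f - g) = evenPart f - evenPart g := by
  ext x; simp [evenPart]; ring

lemma l2Norm_evenPart_le {h : ℝ → ℂ} (hh : Continuous h) : l2Norm (evenPart h) ≤ l2Norm h := by
  have h1 : evenPart h = (1 / 2 : ℂ) • (h + fun x => h (-x)) := by
    ext x; simp [evenPart]; ring
  have h2 := l2Norm_add_le hh (hh.comp continuous_neg)
  rw [show (h ∘ fun x => -x) = fun x => h (-x) from rfl, l2Norm_comp_neg] at h2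
  rw [h1, l2Norm_smul]
  norm_num
  linarith

@[fun_prop]
lemma continuous_complexOscillation (ω : ℝ) : Continuous (complexOscillation ω) := by
  unfold complexOscillation; fun_prop

lemma complexOscillation_eq (ω x : ℝ) :
    complexOscillation ω x = Complex.exp (((Real.pi * ω * x : ℝ) : ℂ) * Complex.I) := by
  rw [complexOscillation]; congr 1; push_cast; ring

lemma norm_complexOscillation (ω x : ℝ) : ‖complexOscillation ω x‖ = 1 := by
  rw [complexOscillation_eq, Complex.norm_exp_ofReal_mul_I]

lemma l2Norm_complexOscillation_le (ω : ℝ) :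
    l2Norm (complexOscillation ω) ≤ Real.sqrt 2 := by
  have := l2Norm_le_of_norm_le (continuous_complexOscillation ω) zero_le_one
    fun x _ => (norm_complexOscillation ω x).le
  rwa [mul_one] at this

/-! ### Existence and uniqueness of the continuous Fourier extension -/

lemma continuous_of_mem_trigSpace {T : ℝ} {n : ℕ} {g : ℝ → ℂ} (hg : g ∈ trigSpace T n) :
    Continuous g := by
  obtain ⟨u, hu, h⟩ := mem_trigSpace_iff.1 hg
  have := continuous_of_mem_trigPoly hu
  rw [funext h]
  fun_prop

lemma zero_mem_trigSpace (T : ℝ) (n : ℕ) : (0 : ℝ → ℂ) ∈ trigSpace T n :=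
  mem_trigSpace_iff.2 ⟨0, zero_mem _, fun _ => rfl⟩

lemma analyticOnNhd_of_mem_trigSpace {T : ℝ} {n : ℕ} {g : ℝ → ℂ} (hg : g ∈ trigSpace T n) :
    AnalyticOnNhd ℝ g Set.univ := by
  obtain ⟨u, hu, h⟩ := mem_trigSpace_iff.1 hg
  rw [funext h]
  exact fun x _ => ((analyticOnNhd_of_mem_trigPoly hu) _ trivial).comp
    (analyticAt_const.mul analyticAt_id)

/-- A trigonometric polynomial is determined by its class in `L²[-1,1]`. -/
lemma eq_of_toLp_eq {T : ℝ} {n : ℕ} {g h : ℝ → ℂ} (hg : g ∈ trigSpace T n)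
    (hh : h ∈ trigSpace T n)
    (he : (memLp_of_continuous (continuous_of_mem_trigSpace hg)).toLp g =
      (memLp_of_continuous (continuous_of_mem_trigSpace hh)).toLp h) : g = h := by
  rw [MeasureTheory.MemLp.toLp_eq_toLp_iff] at he
  have h1 : g =ᵐ[MeasureTheory.volume.restrict (Set.Ioo (-1 : ℝ) 1)] h :=
    MeasureTheory.ae_restrict_of_ae_restrict_of_subset Set.Ioo_subset_Ioc_self he
  have h2 : Set.EqOn g h (Set.Ioo (-1 : ℝ) 1) :=
    MeasureTheory.Measure.eqOn_open_of_ae_eq h1 isOpen_Ioo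
      (continuous_of_mem_trigSpace hg).continuousOn (continuous_of_mem_trigSpace hh).continuousOn
  refine (analyticOnNhd_of_mem_trigSpace hg).eq_of_eventuallyEq
    (analyticOnNhd_of_mem_trigSpace hh) (z₀ := 0) ?_
  filter_upwards [Ioo_mem_nhds (show (-1 : ℝ) < 0 by norm_num) one_pos] with x hx using h2 hx

/-- The image of `G_n` in `L²[-1,1]`. -/
noncomputable def trigSpaceL2 (T : ℝ) (n : ℕ) : Submodule ℂ
    (MeasureTheory.Lp ℂ 2 (MeasureTheory.volume.restrict (Set.Ioc (-1 : ℝ) 1))) :=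
  LinearMap.range
    ({ toFun := fun u => (memLp_of_continuous
        ((continuous_of_mem_trigPoly u.2).comp (continuous_const_mul (Real.pi / T)))).toLp
          ((u : ℝ → ℂ) ∘ fun x => Real.pi / T * x)
       map_add' := fun _ _ => rfl
       map_smul' := fun _ _ => rfl } : trigPoly n →ₗ[ℂ]
        MeasureTheory.Lp ℂ 2 (MeasureTheory.volume.restrict (Set.Ioc (-1 : ℝ) 1)))

lemma mem_trigSpaceL2_iff {T : ℝ} {n : ℕ}
    {v : MeasureTheory.Lp ℂ 2 (MeasureTheory.volume.restrict (Set.Ioc (-1 : ℝ) 1))} :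
    v ∈ trigSpaceL2 T n ↔ ∃ g, ∃ hg : g ∈ trigSpace T n,
      v = (memLp_of_continuous (continuous_of_mem_trigSpace hg)).toLp g := by
  constructor
  · rintro ⟨u, rfl⟩
    exact ⟨_, mem_trigSpace_iff.2 ⟨u, u.2, fun _ => rfl⟩, rfl⟩
  · rintro ⟨g, hg, rfl⟩
    obtain ⟨u, hu, h⟩ := mem_trigSpace_iff.1 hg
    obtain rfl : g = u ∘ fun x => Real.pi / T * x := funext h
    exact ⟨⟨u, hu⟩, rfl⟩

/-- The Fourier extension is the orthogonal projection onto a finite-dimensional subspace of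
`L²[-1,1]`. -/
theorem existsUnique_isContinuousFourierExtension (T : ℝ) (n : ℕ) {f : ℝ → ℂ}
    (hf : Continuous f) : ∃! g : ℝ → ℂ, IsContinuousFourierExtension T n f g := by
  set K := trigSpaceL2 T n with hK
  have : FiniteDimensional ℂ K := by rw [hK, trigSpaceL2]; infer_instance
  set F := (memLp_of_continuous hf).toLp f with hF
  have hnorm : ∀ (g : ℝ → ℂ) (hg : g ∈ trigSpace T n), l2Norm (f - g) =
      ‖F - (memLp_of_continuous (continuous_of_mem_trigSpace hg)).toLp g‖ := by
    intro g hg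
    rw [← norm_toLp_eq_l2Norm (hf.sub (continuous_of_mem_trigSpace hg)),
      MeasureTheory.MemLp.toLp_sub (memLp_of_continuous hf)
        (memLp_of_continuous (continuous_of_mem_trigSpace hg))]
  have hbdd : BddBelow (Set.range fun w : K => ‖F - w‖) :=
    ⟨0, by rintro _ ⟨w, rfl⟩; exact norm_nonneg _⟩
  obtain ⟨v, hvK, hv⟩ := K.exists_norm_eq_iInf_of_complete_subspace
    (K.complete_of_finiteDimensional) F
  obtain ⟨g, hg, rfl⟩ := mem_trigSpaceL2_iff.1 hvK
  have hmin : ∀ h ∈ trigSpace T n, l2Norm (f - g) ≤ l2Norm (f - h) := by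
    intro h hh
    rw [hnorm g hg, hnorm h hh, hv]
    exact ciInf_le hbdd ⟨_, mem_trigSpaceL2_iff.2 ⟨h, hh, rfl⟩⟩
  refine ⟨g, ⟨hg, hmin⟩, fun h hh => ?_⟩
  have hh' : l2Norm (f - h) = l2Norm (f - g) := le_antisymm (hh.2 g hg) (hmin h hh.1)
  refine eq_of_toLp_eq hh.1 hg ?_
  have hhK := mem_trigSpaceL2_iff.2 ⟨h, hh.1, rfl⟩
  have hw : ‖F - (memLp_of_continuous (continuous_of_mem_trigSpace hh.1)).toLp h‖ =
      ⨅ w : K, ‖F - w‖ := by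
    rw [← hnorm h hh.1, hh', hnorm g hg]
    exact hv
  -- both residuals are orthogonal to `G_n`, hence so is the difference of the two minimizers
  have hd := sub_mem hvK hhK
  rw [← sub_eq_zero, ← inner_self_eq_zero (𝕜 := ℂ)]
  have h1 := (K.norm_eq_iInf_iff_inner_eq_zero hvK).1 hv _ hd
  have h2 := (K.norm_eq_iInf_iff_inner_eq_zero hhK).1 hw _ hd
  rw [← neg_sub, inner_neg_neg]
  nth_rewrite 1 [← sub_sub_sub_cancel_left _ _ F]
  rw [inner_sub_left, h1, h2, sub_zero]


/-! ### The complex arcsine on the unit disc -/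

/-- The branch of `√(1 - S²)` on the unit disc that has positive real part: the cosine of the
arcsine of `S`. -/
noncomputable def cosArcsin (S : ℂ) : ℂ := (1 - S ^ 2) ^ (1 / 2 : ℂ)

/-- The principal branch of the complex arcsine, `-i log (√(1 - S²) + i S)`; it is used in the unit
disc only. -/
noncomputable def complexArcsin (S : ℂ) : ℂ :=
  -Complex.I * Complex.log (cosArcsin S + Complex.I * S)

section
variable {S : ℂ}

lemma re_one_sub_sq_pos (hS : ‖S‖ < 1) : 0 < (1 - S ^ 2).re := by
  have h1 : (S ^ 2).re ≤ ‖S ^ 2‖ := Complex.re_le_norm _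
  have h2 : ‖S ^ 2‖ < 1 := by rw [norm_pow]; exact pow_lt_one₀ (norm_nonneg _) hS two_ne_zero
  simp only [Complex.sub_re, Complex.one_re]; linarith

lemma cosArcsin_sq (S : ℂ) : cosArcsin S ^ 2 = 1 - S ^ 2 := by
  simp [cosArcsin]

lemma re_cosArcsin_pos (hS : ‖S‖ < 1) : 0 < (cosArcsin S).re := by
  have h := re_one_sub_sq_pos hS
  have h0 : 1 - S ^ 2 ≠ 0 := fun h0 => by rw [h0] at h; simp at h
  have h1 := Complex.abs_arg_lt_pi_div_two_iff.2 (Or.inl h)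
  rw [cosArcsin, Complex.cpow_def_of_ne_zero h0, Complex.exp_re]
  refine mul_pos (Real.exp_pos _) (Real.cos_pos_of_mem_Ioo ?_)
  have h2 : (Complex.log (1 - S ^ 2) * (1 / 2)).im = (1 - S ^ 2).arg / 2 := by
    rw [show (1 / 2 : ℂ) = ((1 / 2 : ℝ) : ℂ) by push_cast; rfl, Complex.im_mul_ofReal,
      Complex.log_im]
    ring
  rw [h2]
  rw [abs_lt] at h1
  constructor <;> linarith [h1.1, h1.2, Real.pi_pos]

lemma cosArcsin_ne_zero (hS : ‖S‖ < 1) : cosArcsin S ≠ 0 := fun h => by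
  have := re_cosArcsin_pos hS
  rw [h] at this
  simp at this

/-- The square of `√(1 - S²)` has positive real part, so that its argument is at most `π / 4`. -/
lemma norm_inv_cosArcsin_le (hS : ‖S‖ < 1) :
    ‖(cosArcsin S)⁻¹‖ ≤ Real.sqrt 2 * ((cosArcsin S)⁻¹).re := by
  set D := cosArcsin S with hD
  have h0 : 0 < D.re := re_cosArcsin_pos hS
  have h1 : 0 < (D ^ 2).re := by rw [hD, cosArcsin_sq]; exact re_one_sub_sq_pos hS
  have h2 : (D ^ 2).re = D.re ^ 2 - D.im ^ 2 := by rw [sq, Complex.mul_re]; ring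
  have hn : 0 < ‖D‖ := norm_pos_iff.2 (cosArcsin_ne_zero hS)
  have h3 : ‖D‖ ≤ Real.sqrt 2 * D.re := by
    rw [← Real.sqrt_sq h0.le, ← Real.sqrt_mul (by norm_num)]
    rw [Complex.norm_def]
    refine Real.sqrt_le_sqrt ?_
    rw [Complex.normSq_apply]; nlinarith
  rw [norm_inv, Complex.inv_re, Complex.normSq_eq_norm_sq]
  field_simp
  exact h3

lemma re_cosArcsin_add_pos (hS : ‖S‖ < 1) : 0 < (cosArcsin S + Complex.I * S).re := by
  set D := cosArcsin S with hD
  have h1 : (D + Complex.I * S) * (D - Complex.I * S) = 1 := by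
    have : (D + Complex.I * S) * (D - Complex.I * S) = D ^ 2 - Complex.I ^ 2 * S ^ 2 := by ring
    rw [this, hD, cosArcsin_sq, Complex.I_sq]; ring
  set V := D + Complex.I * S with hV
  have h0 : V ≠ 0 := left_ne_zero_of_mul_eq_one h1
  have h2 : V⁻¹ = D - Complex.I * S := inv_eq_of_mul_eq_one_right h1
  have h3 : V.re + (V⁻¹).re = 2 * D.re := by
    rw [← Complex.add_re, h2, hV]; simp; ring
  rw [Complex.inv_re] at h3
  have h4 : 0 < Complex.normSq V := Complex.normSq_pos.2 h0
  have h5 := re_cosArcsin_pos hS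
  rw [← hD] at h5
  have h6 : V.re + V.re / Complex.normSq V = V.re * (1 + (Complex.normSq V)⁻¹) := by
    rw [div_eq_mul_inv]; ring
  rw [h6] at h3
  exact pos_of_mul_pos_left (by rw [h3]; linarith) (by positivity)

lemma cosArcsin_add_ne_zero (hS : ‖S‖ < 1) : cosArcsin S + Complex.I * S ≠ 0 := fun h => by
  have := re_cosArcsin_add_pos hS
  rw [h] at this
  simp at this

lemma sin_complexArcsin (hS : ‖S‖ < 1) : Complex.sin (complexArcsin S) = S := by
  have h0 := cosArcsin_add_ne_zero hS
  have h1 : (cosArcsin S + Complex.I * S) * (cosArcsin S - Complex.I * S) = 1 := by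
    have : (cosArcsin S + Complex.I * S) * (cosArcsin S - Complex.I * S) =
      cosArcsin S ^ 2 - Complex.I ^ 2 * S ^ 2 := by ring
    rw [this, cosArcsin_sq, Complex.I_sq]; ring
  have h2 : complexArcsin S * Complex.I = Complex.log (cosArcsin S + Complex.I * S) := by
    rw [complexArcsin]; ring_nf; rw [Complex.I_sq]; ring
  rw [Complex.sin, neg_mul, h2, Complex.exp_neg, Complex.exp_log h0,
    inv_eq_of_mul_eq_one_right h1]
  ring_nf
  rw [Complex.I_sq]; ring

lemma differentiableAt_cosArcsin (hS : ‖S‖ < 1) : DifferentiableAt ℂ cosArcsin S := by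
  have h : 1 - S ^ 2 ∈ Complex.slitPlane := Or.inl (re_one_sub_sq_pos hS)
  unfold cosArcsin
  exact DifferentiableAt.cpow (by fun_prop) (by fun_prop) h

lemma differentiableAt_complexArcsin (hS : ‖S‖ < 1) : DifferentiableAt ℂ complexArcsin S := by
  unfold complexArcsin
  have h : DifferentiableAt ℂ (fun S => cosArcsin S + Complex.I * S) S :=
    (differentiableAt_cosArcsin hS).add (by fun_prop)
  exact (h.clog (Or.inl (re_cosArcsin_add_pos hS))).const_mul _

end

lemma norm_ofReal_sin_lt_one {θ : ℝ} (hθ : θ ∈ Set.Ioo (-(Real.pi / 2)) (Real.pi / 2)) :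
    ‖((Real.sin θ : ℝ) : ℂ)‖ < 1 := by
  have h := Real.cos_pos_of_mem_Ioo hθ
  rw [Complex.norm_real, Real.norm_eq_abs, ← sq_lt_one_iff_abs_lt_one]
  nlinarith [Real.sin_sq_add_cos_sq θ]

lemma cosArcsin_sin {θ : ℝ} (hθ : θ ∈ Set.Ioo (-(Real.pi / 2)) (Real.pi / 2)) :
    cosArcsin (Real.sin θ : ℝ) = (Real.cos θ : ℝ) := by
  have h := Real.cos_pos_of_mem_Ioo hθ
  have h1 : cosArcsin (Real.sin θ : ℝ) ^ 2 = ((Real.cos θ : ℝ) : ℂ) ^ 2 := by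
    rw [cosArcsin_sq]; norm_cast; rw [Real.cos_sq']
  rcases sq_eq_sq_iff_eq_or_eq_neg.1 h1 with h2 | h2
  · exact h2
  · have h3 := re_cosArcsin_pos (norm_ofReal_sin_lt_one hθ)
    rw [h2, Complex.neg_re, Complex.ofReal_re] at h3
    linarith

lemma complexArcsin_sin {θ : ℝ} (hθ : θ ∈ Set.Ioo (-(Real.pi / 2)) (Real.pi / 2)) :
    complexArcsin (Real.sin θ : ℝ) = θ := by
  have h1 : ((Real.cos θ : ℝ) : ℂ) + Complex.I * ((Real.sin θ : ℝ) : ℂ) =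
      Complex.exp (θ * Complex.I) := by
    rw [Complex.exp_mul_I]; push_cast; ring
  rw [complexArcsin, cosArcsin_sin hθ, h1, Complex.log_exp]
  · ring_nf; rw [Complex.I_sq]; ring
  · simp; linarith [hθ.1, Real.pi_pos]
  · simp; linarith [hθ.2, Real.pi_pos]

/-! ### The substitution `sin (θ / 2) = s sin t` in the complex plane -/

/-- If `sin (a + i b) = s sin (u + i v)` with `0 < s < 1`, then `|sinh b| ≤ s |sinh v|`: the
confocal ellipse with foci `±1` through a point of an ellipse with foci `±s` is largest at the
end of the minor axis. -/
lemma abs_sinh_le_of_sin_eq {s a b u v : ℝ} (hs0 : 0 < s) (hs1 : s < 1)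
    (h1 : Real.sin a * Real.cosh b = s * (Real.sin u * Real.cosh v))
    (h2 : Real.cos a * Real.sinh b = s * (Real.cos u * Real.sinh v)) :
    |Real.sinh b| ≤ s * |Real.sinh v| := by
  by_contra! hlt
  have hs : |s| * |Real.sinh v| = s * |Real.sinh v| := by rw [abs_of_pos hs0]
  set B := Real.sinh b ^ 2 with hB
  set q := s ^ 2 * Real.sinh v ^ 2 with hq
  have hq0 : 0 ≤ q := by positivity
  have hqB : q < B := by
    have : (s * |Real.sinh v|) ^ 2 < |Real.sinh b| ^ 2 :=
      pow_lt_pow_left₀ hlt (by positivity) two_ne_zero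
    rwa [mul_pow, sq_abs, sq_abs] at this
  have hcb : Real.cosh b ^ 2 = 1 + B := by rw [Real.cosh_sq]; ring
  have hcv : s ^ 2 * Real.cosh v ^ 2 = s ^ 2 + q := by rw [Real.cosh_sq]; ring
  have e1 : Real.sin a ^ 2 * (1 + B) = (s ^ 2 + q) * Real.sin u ^ 2 := by
    rw [← hcb, ← hcv, ← mul_pow, h1]; ring
  have e2 : Real.cos a ^ 2 * B = q * Real.cos u ^ 2 := by
    rw [hB, ← mul_pow, h2, hq]; ring
  have hs2 : s ^ 2 < 1 := pow_lt_one₀ hs0.le hs1 two_ne_zero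
  have f1 : Real.sin a ^ 2 ≤ Real.sin u ^ 2 := by nlinarith [sq_nonneg (Real.sin u)]
  have f2 : Real.cos a ^ 2 ≤ Real.cos u ^ 2 := by nlinarith [sq_nonneg (Real.cos u)]
  have ga := Real.sin_sq_add_cos_sq a
  have gu := Real.sin_sq_add_cos_sq u
  have f3 : Real.sin a ^ 2 = Real.sin u ^ 2 := by linarith
  have f4 : Real.cos a ^ 2 = Real.cos u ^ 2 := by linarith
  rw [f3] at e1
  rw [f4] at e2
  have z1 : Real.sin u ^ 2 = 0 := by nlinarith [sq_nonneg (Real.sin u)]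
  have z2 : Real.cos u ^ 2 = 0 := by nlinarith [sq_nonneg (Real.cos u)]
  linarith

/-- The function `s sin t` as a function of `ζ = exp (i t)`. -/
noncomputable def scaledSine (s : ℝ) (ζ : ℂ) : ℂ := s * ((ζ - ζ⁻¹) / (2 * Complex.I))

lemma scaledSine_exp (s : ℝ) (t : ℂ) :
    scaledSine s (Complex.exp (t * Complex.I)) = s * Complex.sin t := by
  rw [scaledSine, ← Complex.exp_neg, Complex.sin]
  congr 1
  field_simp
  rw [Complex.I_sq]; ring_nf

lemma norm_scaledSine_le {s κ : ℝ} (hs : 0 < s) {ζ : ℂ} (hζ : ‖ζ‖ = Real.exp κ) :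
    ‖scaledSine s ζ‖ ≤ s * Real.cosh κ := by
  rw [scaledSine, norm_mul, Complex.norm_real, Real.norm_of_nonneg hs.le, norm_div, norm_mul,
    Complex.norm_I, Complex.norm_ofNat, mul_one]
  refine mul_le_mul_of_nonneg_left ?_ hs.le
  rw [Real.cosh_eq]
  refine div_le_div_of_nonneg_right ((norm_sub_le _ _).trans ?_) zero_le_two
  rw [norm_inv, hζ, Real.exp_neg]

/-- The annulus `exp (-κ) < |ζ| < exp κ`. -/
def expAnnulus (κ : ℝ) : Set ℂ := {ζ | Real.exp (-κ) < ‖ζ‖ ∧ ‖ζ‖ < Real.exp κ}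

lemma ne_zero_of_mem_expAnnulus {κ : ℝ} {ζ : ℂ} (h : ζ ∈ expAnnulus κ) : ζ ≠ 0 :=
  norm_pos_iff.1 ((Real.exp_pos _).trans h.1)

lemma norm_scaledSine_lt_one {s κ₀ : ℝ} (hs : 0 < s) (hκ₀ : s * Real.cosh κ₀ ≤ 1) {ζ : ℂ}
    (hζ : ζ ∈ expAnnulus κ₀) : ‖scaledSine s ζ‖ < 1 := by
  have h0 := norm_pos_iff.2 (ne_zero_of_mem_expAnnulus hζ)
  refine (norm_scaledSine_le (κ := Real.log ‖ζ‖) hs (Real.exp_log h0).symm).trans_lt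
    (lt_of_lt_of_le ?_ hκ₀)
  refine mul_lt_mul_of_pos_left (Real.cosh_lt_cosh.2 ?_) hs
  have h1 := (Real.lt_log_iff_exp_lt h0).2 hζ.1
  have h2 := (Real.log_lt_iff_lt_exp h0).2 hζ.2
  have h3 : 0 < κ₀ := by linarith
  rw [abs_of_pos h3, abs_lt]
  exact ⟨h1, h2⟩

/-- A bound for `|Im (θ / 2)|` on the circle `|ζ| = exp κ` under `sin (θ / 2) = s sin t`,
`ζ = exp (i t)`; it is attained at `ζ = exp κ`. -/
lemma abs_im_complexArcsin_scaledSine_le {s κ u : ℝ} (hs0 : 0 < s) (hs1 : s < 1)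
    (hκ : s * Real.cosh κ < 1) :
    |(complexArcsin (scaledSine s (Complex.exp (κ + u * Complex.I)))).im| ≤
      Real.arsinh (s * Real.sinh |κ|) := by
  set S := scaledSine s (Complex.exp (κ + u * Complex.I)) with hSdef
  have hS : ‖S‖ < 1 := by
    refine (norm_scaledSine_le hs0 (κ := κ) ?_).trans_lt hκ
    rw [Complex.norm_exp]; simp
  have hS' : S = s * Complex.sin ((u : ℝ) + ((-κ : ℝ) : ℂ) * Complex.I) := by
    rw [hSdef, ← scaledSine_exp]
    congr 2; push_cast; ring_nf; rw [Complex.I_sq]; ring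
  have h := sin_complexArcsin hS
  set z := complexArcsin S
  rw [hS', Complex.sin_add_mul_I, Complex.sin_eq] at h
  norm_cast at h
  have h1 := congrArg Complex.re h
  have h2 := congrArg Complex.im h
  simp only [Complex.mul_re, Complex.mul_im, Complex.add_re, Complex.add_im, Complex.ofReal_re,
    Complex.ofReal_im, Complex.I_re, Complex.I_im, mul_zero, mul_one, zero_mul, add_zero, zero_add,
    sub_zero] at h1 h2
  have h3 := abs_sinh_le_of_sin_eq (v := -κ) (u := u) hs0 hs1 h1 h2
  rw [Real.sinh_neg, abs_neg, Real.abs_sinh, Real.abs_sinh] at h3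
  rw [← Real.arsinh_sinh |z.im|]
  exact Real.arsinh_le_arsinh.2 h3


/-! ### Fourier coefficients of functions analytic in an annulus -/

/-- The `k`-th Fourier coefficient of a function on the line, over the period `[-π, π]`. -/
noncomputable def fourierCoef (F : ℝ → ℂ) (k : ℤ) : ℂ :=
  (1 / (2 * Real.pi) : ℝ) * ∫ u in (-Real.pi)..Real.pi, expi (-k) u * F u

lemma fourierCoef_eq_fourierCoeffOn (F : ℝ → ℂ) (k : ℤ) :
    fourierCoef F k = fourierCoeffOn (neg_lt_self Real.pi_pos) F k := by
  rw [fourierCoeffOn_eq_integral, fourierCoef]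
  have h2 : Real.pi - -Real.pi = 2 * Real.pi := by ring
  rw [h2, Complex.real_smul]
  congr 2
  ext u
  rw [fourier_coe_apply, smul_eq_mul, expi]
  congr 2
  have : (Real.pi : ℂ) ≠ 0 := Complex.ofReal_ne_zero.2 Real.pi_ne_zero
  push_cast
  field_simp

/-- The Fourier series of a continuous `2π`-periodic function with summable coefficients converges
pointwise to the function. -/
lemma hasSum_fourierCoef {F : ℝ → ℂ} (hF : Continuous F)
    (hp : ∀ u, F (u + 2 * Real.pi) = F u) (hs : Summable (fourierCoef F)) (u : ℝ) :
    HasSum (fun k : ℤ => fourierCoef F k * expi k u) (F u) := by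
  have hfact : Fact (0 < 2 * Real.pi) := ⟨Real.two_pi_pos⟩
  have hper : Function.Periodic F (2 * Real.pi) := hp
  let f : C(AddCircle (2 * Real.pi), ℂ) :=
    ⟨hper.lift, continuous_coinduced_dom.2 (by exact hF)⟩
  have hf : ∀ v : ℝ, f (v : AddCircle (2 * Real.pi)) = F v := fun v => hper.lift_coe v
  have hexp : ∀ (k : ℤ) (v : ℝ), fourier k (v : AddCircle (2 * Real.pi)) = expi k v := by
    intro k v
    rw [fourier_coe_apply, expi]
    congr 1
    have : (Real.pi : ℂ) ≠ 0 := Complex.ofReal_ne_zero.2 Real.pi_ne_zero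
    push_cast
    field_simp
  have hc : ∀ k, fourierCoeff f k = fourierCoef F k := by
    intro k
    rw [fourierCoeff_eq_intervalIntegral f k (-Real.pi), fourierCoef, Complex.real_smul,
      show -Real.pi + 2 * Real.pi = Real.pi by ring]
    congr 2
    ext v
    rw [hf, hexp, smul_eq_mul]
  have := has_pointwise_sum_fourier_series_of_summable (f := f) (by rwa [funext hc]) u
  simpa only [hc, hexp, hf, smul_eq_mul] using this

lemma exp_add_mem_expAnnulus {κ κ₀ : ℝ} (h : |κ| < κ₀) (u : ℝ) :
    Complex.exp (κ + u * Complex.I) ∈ expAnnulus κ₀ := by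
  have h1 : ‖Complex.exp (κ + u * Complex.I)‖ = Real.exp κ := by rw [Complex.norm_exp]; simp
  rw [abs_lt] at h
  exact ⟨by rw [h1]; exact Real.exp_lt_exp.2 h.1, by rw [h1]; exact Real.exp_lt_exp.2 h.2⟩

/-- The mean of a function analytic in an annulus over a concentric circle does not depend on the
radius. -/
lemma integral_circle_eq {κ₀ κ κ' : ℝ} (h' : |κ'| < κ₀) (h : |κ| < κ₀) {G : ℂ → ℂ}
    (hG : ∀ ζ ∈ expAnnulus κ₀, DifferentiableAt ℂ G ζ) :
    ∫ u in (-Real.pi)..Real.pi, G (Complex.exp (κ + u * Complex.I)) =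
      ∫ u in (-Real.pi)..Real.pi, G (Complex.exp (κ' + u * Complex.I)) := by
  wlog hle : κ ≤ κ' generalizing κ κ'
  · exact (this h h' (le_of_not_ge hle)).symm
  rw [abs_lt] at h h'
  have key := Complex.circleIntegral_sub_center_inv_smul_eq_of_differentiable_on_annulus_off_countable
    (c := 0) (Real.exp_pos κ) (Real.exp_le_exp.2 hle) (f := G) (s := ∅) Set.countable_empty ?_ ?_
  · have conv : ∀ r : ℝ, (∮ z in C(0, Real.exp r), (z - 0)⁻¹ • G z) =
        Complex.I * ∫ u in (-Real.pi)..Real.pi, G (Complex.exp (r + u * Complex.I)) := by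
      intro r
      have hpt : ∀ u : ℝ, circleMap 0 (Real.exp r) u = Complex.exp (r + u * Complex.I) := by
        intro u; rw [circleMap, zero_add, Complex.exp_add]; push_cast; rfl
      have h0 : ∀ u : ℝ, deriv (circleMap 0 (Real.exp r)) u •
          ((circleMap 0 (Real.exp r) u - 0)⁻¹ • G (circleMap 0 (Real.exp r) u)) =
          Complex.I * G (Complex.exp (r + u * Complex.I)) := by
        intro u
        rw [deriv_circleMap, sub_zero, smul_eq_mul, smul_eq_mul, hpt]
        field_simp [Complex.exp_ne_zero]
      rw [circleIntegral]
      simp only [h0]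
      rw [intervalIntegral.integral_const_mul]
      congr 1
      have hper : Function.Periodic (fun u : ℝ => G (Complex.exp (r + u * Complex.I)))
          (2 * Real.pi) := by
        intro u
        simp only
        congr 1
        rw [Complex.exp_eq_exp_iff_exists_int]
        exact ⟨1, by push_cast; ring⟩
      have := hper.intervalIntegral_add_eq 0 (-Real.pi)
      rwa [zero_add, show -Real.pi + 2 * Real.pi = Real.pi by ring] at this
    rw [conv, conv] at key
    exact (mul_left_cancel₀ Complex.I_ne_zero key).symm
  · intro z hz
    refine (hG z ?_).continuousAt.continuousWithinAt
    rw [Set.mem_sdiff, mem_closedBall_zero_iff, mem_ball_zero_iff, not_lt] at hz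
    exact ⟨(Real.exp_lt_exp.2 h.1).trans_le hz.2, hz.1.trans_lt (Real.exp_lt_exp.2 h'.2)⟩
  · intro z hz
    refine hG z ?_
    rw [Set.sdiff_empty, Set.mem_sdiff, mem_closedBall_zero_iff, mem_ball_zero_iff, not_le] at hz
    exact ⟨(Real.exp_lt_exp.2 h.1).trans hz.2, hz.1.trans (Real.exp_lt_exp.2 h'.2)⟩

/-- The Fourier coefficients of a function analytic in an annulus decay exponentially, at a rate
given by the width of the annulus and with a constant given by means over concentric circles. -/
lemma norm_fourierCoef_le {κ₀ κ M : ℝ} (hκ0 : 0 < κ) (hκ : κ < κ₀) {G : ℂ → ℂ}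
    (hG : ∀ ζ ∈ expAnnulus κ₀, DifferentiableAt ℂ G ζ)
    (hM : ∀ r : ℝ, |r| = κ → ∫ u in (-Real.pi)..Real.pi, ‖G (Complex.exp (r + u * Complex.I))‖ ≤
      2 * Real.pi * M) (k : ℤ) :
    ‖fourierCoef (fun u => G (Complex.exp (u * Complex.I))) k‖ ≤
      M * Real.exp (-κ) ^ k.natAbs := by
  -- the circle of radius `exp κ` is used for `k ≥ 0`, that of radius `exp (-κ)` for `k < 0`
  obtain ⟨r, hr, hrk⟩ : ∃ r : ℝ, |r| = κ ∧ r * k = κ * k.natAbs := by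
    rcases le_total 0 k with h | h
    · refine ⟨κ, abs_of_pos hκ0, ?_⟩
      rw [Nat.cast_natAbs, abs_of_nonneg h]
    · refine ⟨-κ, by rw [abs_neg, abs_of_pos hκ0], ?_⟩
      rw [Nat.cast_natAbs, abs_of_nonpos h]; push_cast; ring
  have hG' : ∀ ζ ∈ expAnnulus κ₀, DifferentiableAt ℂ (fun ζ => ζ ^ (-k) * G ζ) ζ := fun ζ hζ =>
    (differentiableAt_zpow.2 (Or.inl (ne_zero_of_mem_expAnnulus hζ))).mul (hG ζ hζ)
  have h1 := integral_circle_eq (κ := 0) (κ' := r) (κ₀ := κ₀) (by rw [hr]; exact hκ)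
    (by rw [abs_zero]; exact hκ0.trans hκ) hG'
  have h2 : ∀ u : ℝ, Complex.exp (((0 : ℝ) : ℂ) + u * Complex.I) ^ (-k) *
      G (Complex.exp (((0 : ℝ) : ℂ) + u * Complex.I)) =
      expi (-k) u * G (Complex.exp (u * Complex.I)) := by
    intro u
    rw [Complex.ofReal_zero, zero_add, ← Complex.exp_int_mul, expi]
    congr 2; ring
  simp only [h2] at h1
  rw [fourierCoef, h1, norm_mul, Complex.norm_real, Real.norm_of_nonneg (by positivity)]
  have h3 : ∀ u : ℝ, ‖Complex.exp (r + u * Complex.I) ^ (-k) *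
      G (Complex.exp (r + u * Complex.I))‖ =
      Real.exp (-κ) ^ k.natAbs * ‖G (Complex.exp (r + u * Complex.I))‖ := by
    intro u
    rw [norm_mul, norm_zpow, Complex.norm_exp]
    congr 1
    have : (r + u * Complex.I : ℂ).re = r := by simp
    rw [this, ← Real.rpow_intCast, ← Real.exp_mul, ← Real.exp_nat_mul]
    congr 1
    push_cast at hrk ⊢
    linarith
  have h4 : ‖∫ u in (-Real.pi)..Real.pi, Complex.exp (r + u * Complex.I) ^ (-k) *
      G (Complex.exp (r + u * Complex.I))‖ ≤ Real.exp (-κ) ^ k.natAbs * (2 * Real.pi * M) := by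
    refine (intervalIntegral.norm_integral_le_integral_norm (by linarith [Real.pi_pos])).trans ?_
    simp only [h3]
    rw [intervalIntegral.integral_const_mul]
    exact mul_le_mul_of_nonneg_left (hM r hr) (by positivity)
  refine (mul_le_mul_of_nonneg_left h4 (by positivity)).trans_eq ?_
  have := Real.pi_pos.ne'
  field_simp


/-! ### Uniform approximation of oscillations -/

/-- The function `exp (i Ω θ)` with `sin (θ / 2) = s sin t`, as an analytic function of
`ζ = exp (i t)` in an annulus. -/
noncomputable def oscillationFun (s Ω : ℝ) (ζ : ℂ) : ℂ :=
  Complex.exp (((2 * Ω : ℝ) : ℂ) * complexArcsin (scaledSine s ζ) * Complex.I)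

/-- The function `exp (i Ω θ) / cos (θ / 2)` with `sin (θ / 2) = s sin t`, as an analytic function
of `ζ = exp (i t)` in an annulus. -/
noncomputable def weightedOscillationFun (s Ω : ℝ) (ζ : ℂ) : ℂ :=
  oscillationFun s Ω ζ * (cosArcsin (scaledSine s ζ))⁻¹

lemma differentiableAt_scaledSine (s : ℝ) {ζ : ℂ} (h : ζ ≠ 0) :
    DifferentiableAt ℂ (scaledSine s) ζ := by
  unfold scaledSine
  exact (((differentiableAt_id.sub (differentiableAt_inv h)).div_const _).const_mul _)

section
variable {s κ₀ κ : ℝ}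

lemma differentiableAt_oscillationFun (hs : 0 < s) (hκ₀ : s * Real.cosh κ₀ ≤ 1) (Ω : ℝ) {ζ : ℂ}
    (hζ : ζ ∈ expAnnulus κ₀) : DifferentiableAt ℂ (oscillationFun s Ω) ζ := by
  have h1 := differentiableAt_complexArcsin (norm_scaledSine_lt_one hs hκ₀ hζ)
  have h2 := h1.comp ζ (differentiableAt_scaledSine s (ne_zero_of_mem_expAnnulus hζ))
  exact ((h2.const_mul _).mul_const _).cexp

lemma differentiableAt_inv_cosArcsin (hs : 0 < s) (hκ₀ : s * Real.cosh κ₀ ≤ 1) {ζ : ℂ}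
    (hζ : ζ ∈ expAnnulus κ₀) :
    DifferentiableAt ℂ (fun ζ => (cosArcsin (scaledSine s ζ))⁻¹) ζ := by
  have h0 := norm_scaledSine_lt_one hs hκ₀ hζ
  have h1 := differentiableAt_cosArcsin h0
  exact (h1.comp ζ (differentiableAt_scaledSine s (ne_zero_of_mem_expAnnulus hζ))).inv
    (cosArcsin_ne_zero h0)

lemma norm_oscillationFun_le (hs0 : 0 < s) (hs1 : s < 1) (hκ : s * Real.cosh κ < 1) (Ω u : ℝ) :
    ‖oscillationFun s Ω (Complex.exp (κ + u * Complex.I))‖ ≤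
      Real.exp (2 * |Ω| * Real.arsinh (s * Real.sinh |κ|)) := by
  rw [oscillationFun, Complex.norm_exp, Real.exp_le_exp, mul_assoc, Complex.re_ofReal_mul,
    Complex.mul_I_re]
  have h := abs_im_complexArcsin_scaledSine_le (u := u) hs0 hs1 hκ
  set y := (complexArcsin (scaledSine s (Complex.exp (κ + u * Complex.I)))).im
  calc 2 * Ω * -y ≤ |2 * Ω * -y| := le_abs_self _
    _ = 2 * |Ω| * |y| := by rw [abs_mul, abs_mul, abs_neg, abs_two]
    _ ≤ _ := mul_le_mul_of_nonneg_left h (by positivity)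

lemma continuous_circle {G : ℂ → ℂ} {r : ℝ} (hr : |r| < κ₀)
    (hG : ∀ ζ ∈ expAnnulus κ₀, DifferentiableAt ℂ G ζ) :
    Continuous fun u : ℝ => G (Complex.exp (r + u * Complex.I)) := by
  refine continuous_iff_continuousAt.2 fun u => ?_
  exact ContinuousAt.comp (f := fun u : ℝ => Complex.exp (r + u * Complex.I))
    (hG _ (exp_add_mem_expAnnulus hr u)).continuousAt (by fun_prop)

/-- The mean of `1 / |√(1 - S²)|` over a circle is bounded independently of the radius: it is at
most `√2` times the mean of the real part, which can be moved to the unit circle. -/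
lemma integral_norm_inv_cosArcsin_le (hs0 : 0 < s) (hs1 : s < 1) (hκ₀ : s * Real.cosh κ₀ ≤ 1)
    (hκ : |κ| < κ₀) :
    ∫ u in (-Real.pi)..Real.pi,
      ‖(cosArcsin (scaledSine s (Complex.exp (κ + u * Complex.I))))⁻¹‖ ≤
      2 * Real.pi * (Real.sqrt 2 / Real.sqrt (1 - s ^ 2)) := by
  have hd : ∀ ζ ∈ expAnnulus κ₀,
      DifferentiableAt ℂ (fun ζ => (cosArcsin (scaledSine s ζ))⁻¹) ζ :=
    fun ζ hζ => differentiableAt_inv_cosArcsin hs0 hκ₀ hζ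
  have h0 : |(0 : ℝ)| < κ₀ := by rw [abs_zero]; exact (abs_nonneg κ).trans_lt hκ
  have hc := continuous_circle hκ hd
  have hc0 := continuous_circle h0 hd
  have hπ : -Real.pi ≤ Real.pi := by linarith [Real.pi_pos]
  have hs2 : 0 < 1 - s ^ 2 := by nlinarith
  calc ∫ u in (-Real.pi)..Real.pi,
        ‖(cosArcsin (scaledSine s (Complex.exp (κ + u * Complex.I))))⁻¹‖
      ≤ ∫ u in (-Real.pi)..Real.pi, Real.sqrt 2 *
        ((cosArcsin (scaledSine s (Complex.exp (κ + u * Complex.I))))⁻¹).re := by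
        refine intervalIntegral.integral_mono_on hπ (hc.norm.intervalIntegrable _ _)
          (((Complex.continuous_re.comp hc).const_mul _).intervalIntegrable _ _) fun u _ => ?_
        exact norm_inv_cosArcsin_le
          (norm_scaledSine_lt_one hs0 hκ₀ (exp_add_mem_expAnnulus hκ u))
    _ = Real.sqrt 2 * (∫ u in (-Real.pi)..Real.pi,
        (cosArcsin (scaledSine s (Complex.exp (κ + u * Complex.I))))⁻¹).re := by
        rw [intervalIntegral.integral_const_mul]
        congr 1
        exact intervalIntegral.intervalIntegral_re (hc.intervalIntegrable _ _)
    _ = Real.sqrt 2 * (∫ u in (-Real.pi)..Real.pi,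
        (cosArcsin (scaledSine s (Complex.exp ((0 : ℝ) + u * Complex.I))))⁻¹).re := by
        rw [integral_circle_eq h0 hκ hd]
    _ ≤ Real.sqrt 2 * ((Real.sqrt (1 - s ^ 2))⁻¹ * |Real.pi - -Real.pi|) := by
        refine mul_le_mul_of_nonneg_left ((Complex.re_le_norm _).trans ?_) (Real.sqrt_nonneg _)
        refine intervalIntegral.norm_integral_le_of_norm_le_const fun u _ => ?_
        rw [norm_inv]
        refine inv_anti₀ (Real.sqrt_pos.2 hs2) ?_
        rw [Real.sqrt_le_left (norm_nonneg _), ← norm_pow, cosArcsin_sq]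
        have h1 : ‖scaledSine s (Complex.exp ((0 : ℝ) + u * Complex.I))‖ ≤ s := by
          have := norm_scaledSine_le (κ := 0) hs0
            (ζ := Complex.exp ((0 : ℝ) + u * Complex.I)) (by rw [Complex.norm_exp]; simp)
          rwa [Real.cosh_zero, mul_one] at this
        have h2 := norm_sub_norm_le (1 : ℂ)
          (scaledSine s (Complex.exp ((0 : ℝ) + u * Complex.I)) ^ 2)
        rw [norm_one, norm_pow] at h2
        have h3 := pow_le_pow_left₀ (norm_nonneg _) h1 2
        linarith
    _ = _ := by
        rw [show Real.pi - -Real.pi = 2 * Real.pi by ring, abs_of_pos Real.two_pi_pos]; ring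

lemma mul_cosh_lt_one (hs0 : 0 < s) (hκ₀ : s * Real.cosh κ₀ ≤ 1) (hκ : |κ| < κ₀) :
    s * Real.cosh κ < 1 := by
  refine lt_of_lt_of_le (mul_lt_mul_of_pos_left (Real.cosh_lt_cosh.2 ?_) hs0) hκ₀
  rwa [abs_of_pos ((abs_nonneg κ).trans_lt hκ)]

lemma norm_fourierCoef_oscillationFun_le (hs0 : 0 < s) (hs1 : s < 1)
    (hκ₀ : s * Real.cosh κ₀ ≤ 1) (hκ0 : 0 < κ) (hκ : κ < κ₀) (Ω : ℝ) (k : ℤ) :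
    ‖fourierCoef (fun u => oscillationFun s Ω (Complex.exp (u * Complex.I))) k‖ ≤
      Real.exp (2 * |Ω| * Real.arsinh (s * Real.sinh κ)) * Real.exp (-κ) ^ k.natAbs := by
  refine norm_fourierCoef_le hκ0 hκ
    (fun ζ hζ => differentiableAt_oscillationFun hs0 hκ₀ Ω hζ) (fun r hr => ?_) k
  have h1 : |r| < κ₀ := by rwa [hr]
  refine (le_abs_self _).trans ?_
  rw [← Real.norm_eq_abs]
  have h2 := intervalIntegral.norm_integral_le_of_norm_le_const (a := -Real.pi) (b := Real.pi)
    (C := Real.exp (2 * |Ω| * Real.arsinh (s * Real.sinh κ)))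
    (f := fun u : ℝ => ‖oscillationFun s Ω (Complex.exp (r + u * Complex.I))‖) (fun u _ => by
      rw [norm_norm, ← hr]
      exact norm_oscillationFun_le hs0 hs1 (mul_cosh_lt_one hs0 hκ₀ h1) Ω u)
  rw [show Real.pi - -Real.pi = 2 * Real.pi by ring, abs_of_pos Real.two_pi_pos] at h2
  linarith

lemma norm_fourierCoef_weightedOscillationFun_le (hs0 : 0 < s) (hs1 : s < 1)
    (hκ₀ : s * Real.cosh κ₀ ≤ 1) (hκ0 : 0 < κ) (hκ : κ < κ₀) (Ω : ℝ) (k : ℤ) :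
    ‖fourierCoef (fun u => weightedOscillationFun s Ω (Complex.exp (u * Complex.I))) k‖ ≤
      Real.exp (2 * |Ω| * Real.arsinh (s * Real.sinh κ)) *
        (Real.sqrt 2 / Real.sqrt (1 - s ^ 2)) * Real.exp (-κ) ^ k.natAbs := by
  have hd1 : ∀ ζ ∈ expAnnulus κ₀, DifferentiableAt ℂ (weightedOscillationFun s Ω) ζ :=
    fun ζ hζ => (differentiableAt_oscillationFun hs0 hκ₀ Ω hζ).mul
      (differentiableAt_inv_cosArcsin hs0 hκ₀ hζ)
  refine norm_fourierCoef_le hκ0 hκ hd1 (fun r hr => ?_) k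
  have h1 : |r| < κ₀ := by rwa [hr]
  have hd2 := continuous_circle h1
    (fun ζ hζ => differentiableAt_inv_cosArcsin hs0 hκ₀ (ζ := ζ) hζ)
  set M := Real.exp (2 * |Ω| * Real.arsinh (s * Real.sinh κ)) with hM
  calc _ ≤ ∫ u in (-Real.pi)..Real.pi, M *
        ‖(cosArcsin (scaledSine s (Complex.exp (r + u * Complex.I))))⁻¹‖ := by
        refine intervalIntegral.integral_mono_on (by linarith [Real.pi_pos])
          ((continuous_circle h1 hd1).norm.intervalIntegrable _ _)
          ((hd2.norm.const_mul _).intervalIntegrable _ _) fun u _ => ?_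
        rw [weightedOscillationFun, norm_mul]
        refine mul_le_mul_of_nonneg_right ?_ (norm_nonneg _)
        rw [hM, ← hr]
        exact norm_oscillationFun_le hs0 hs1 (mul_cosh_lt_one hs0 hκ₀ h1) Ω u
    _ ≤ M * (2 * Real.pi * (Real.sqrt 2 / Real.sqrt (1 - s ^ 2))) := by
        rw [intervalIntegral.integral_const_mul]
        exact mul_le_mul_of_nonneg_left (integral_norm_inv_cosArcsin_le hs0 hs1 hκ₀ h1)
          (Real.exp_pos _).le
    _ = _ := by ring

lemma scaledSine_expi (s t : ℝ) :
    scaledSine s (Complex.exp (t * Complex.I)) = ((s * Real.sin t : ℝ) : ℂ) := by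
  rw [scaledSine_exp]; push_cast; rfl

lemma oscillationFun_expi {θ t : ℝ} (Ω : ℝ) (h : Real.sin (θ / 2) = s * Real.sin t)
    (hθ : θ / 2 ∈ Set.Ioo (-(Real.pi / 2)) (Real.pi / 2)) :
    oscillationFun s Ω (Complex.exp (t * Complex.I)) =
      Complex.exp (((Ω * θ : ℝ) : ℂ) * Complex.I) := by
  rw [oscillationFun, scaledSine_expi, ← h, complexArcsin_sin hθ]
  congr 2; push_cast; ring

lemma weightedOscillationFun_expi {θ t : ℝ} (Ω : ℝ) (h : Real.sin (θ / 2) = s * Real.sin t)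
    (hθ : θ / 2 ∈ Set.Ioo (-(Real.pi / 2)) (Real.pi / 2)) :
    weightedOscillationFun s Ω (Complex.exp (t * Complex.I)) =
      Complex.exp (((Ω * θ : ℝ) : ℂ) * Complex.I) * ((Real.cos (θ / 2) : ℝ) : ℂ)⁻¹ := by
  rw [weightedOscillationFun, oscillationFun_expi Ω h hθ, scaledSine_expi, ← h, cosArcsin_sin hθ]

lemma summable_pow_natAbs {r : ℝ} (h0 : 0 ≤ r) (h1 : r < 1) :
    Summable fun k : ℤ => r ^ k.natAbs := by
  refine Summable.of_nat_of_neg ?_ ?_ <;> simpa using summable_geometric_of_lt_one h0 h1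

/-- The terms of the expansion of `exp (i Ω θ)` in even and odd trigonometric polynomials, in the
variable `t` with `sin (θ / 2) = s sin t`: the even indices give the expansion of `cos (Ω θ)`, the
odd indices that of `i sin (Ω θ)`. -/
noncomputable def expansionTerm (s Ω : ℝ) (k : ℤ) (θ t : ℝ) : ℂ :=
  fourierCoef (fun u => oscillationFun s Ω (Complex.exp (u * Complex.I))) k *
      ((1 + (-1) ^ k) / 2) * (Real.cos (k * t) : ℂ) +
    fourierCoef (fun u => weightedOscillationFun s Ω (Complex.exp (u * Complex.I))) k *
      ((1 - (-1) ^ k) / 2) * Complex.I * (Real.cos (θ / 2) * Real.sin (k * t) : ℝ)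

lemma expi_add_pi (k : ℤ) (t : ℝ) : expi k (t + Real.pi) = (-1) ^ k * expi k t := by
  have h1 : expi k (t + Real.pi) = Complex.exp (k * (Real.pi * Complex.I)) * expi k t := by
    rw [expi, expi, ← Complex.exp_add]; congr 1; push_cast; ring
  rw [h1, Complex.exp_int_mul, Complex.exp_pi_mul_I]

lemma expi_neg_right (k : ℤ) (t : ℝ) : expi k (-t) = expi (-k) t := by
  simp [expi]

/-- The function `exp (i Ω θ)` is recovered from its average over the reflections of `t` that fix
`|sin t|`. The part that is odd in `θ` is taken from the Fourier series of the quotient by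
`cos (θ / 2)`, which supplies the factor that makes its terms trigonometric polynomials. -/
lemma hasSum_expansionTerm (hs0 : 0 < s) (hs1 : s < 1) (hκ₀ : s * Real.cosh κ₀ ≤ 1)
    (hκ₀0 : 0 < κ₀) (Ω : ℝ) {θ t : ℝ} (h : Real.sin (θ / 2) = s * Real.sin t)
    (hθ : θ / 2 ∈ Set.Ioo (-(Real.pi / 2)) (Real.pi / 2)) :
    HasSum (fun k : ℤ => expansionTerm s Ω k θ t)
      (Complex.exp (((Ω * θ : ℝ) : ℂ) * Complex.I)) := by
  have hκ : |(0 : ℝ)| < κ₀ := by rwa [abs_zero]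
  obtain ⟨κ, hκ1, hκ2⟩ := exists_between hκ₀0
  have hr : Real.exp (-κ) < 1 := Real.exp_lt_one_iff.mpr (by linarith)
  have hsum := summable_pow_natAbs (Real.exp_pos (-κ)).le hr
  have hper : ∀ (G : ℂ → ℂ) (u : ℝ), G (Complex.exp (((u + 2 * Real.pi : ℝ) : ℂ) * Complex.I)) =
      G (Complex.exp (u * Complex.I)) := by
    intro G u
    congr 1
    rw [Complex.exp_eq_exp_iff_exists_int]
    exact ⟨1, by push_cast; ring⟩
  have hA := fun v : ℝ => hasSum_fourierCoef
    (F := fun u => oscillationFun s Ω (Complex.exp (u * Complex.I)))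
    (by simpa using continuous_circle hκ
          fun ζ hζ => differentiableAt_oscillationFun hs0 hκ₀ Ω (ζ := ζ) hζ)
    (hper _) (Summable.of_norm_bounded (hsum.mul_left _)
      (norm_fourierCoef_oscillationFun_le hs0 hs1 hκ₀ hκ1 hκ2 Ω)) v
  have hB := fun v : ℝ => hasSum_fourierCoef
    (F := fun u => weightedOscillationFun s Ω (Complex.exp (u * Complex.I)))
    (by simpa [weightedOscillationFun] using continuous_circle hκ
          fun ζ hζ => (differentiableAt_oscillationFun hs0 hκ₀ Ω (ζ := ζ) hζ).mul
            (differentiableAt_inv_cosArcsin hs0 hκ₀ hζ))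
    (hper _) (Summable.of_norm_bounded (hsum.mul_left _)
      (norm_fourierCoef_weightedOscillationFun_le hs0 hs1 hκ₀ hκ1 hκ2 Ω)) v
  have hθ' : (-θ) / 2 ∈ Set.Ioo (-(Real.pi / 2)) (Real.pi / 2) := by
    constructor <;> linarith [hθ.1, hθ.2]
  have h2 : Real.sin (-θ / 2) = s * Real.sin (-t) := by
    rw [neg_div, Real.sin_neg, Real.sin_neg, h]; ring
  have h3 : Real.sin (-θ / 2) = s * Real.sin (t + Real.pi) := by
    rw [neg_div, Real.sin_neg, Real.sin_add_pi, h]; ring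
  have h4 : Real.sin (θ / 2) = s * Real.sin (-t + Real.pi) := by
    rw [Real.sin_add_pi, Real.sin_neg, h]; ring
  have hcos : ((Real.cos (θ / 2) : ℝ) : ℂ) ≠ 0 :=
    Complex.ofReal_ne_zero.2 (Real.cos_pos_of_mem_Ioo hθ).ne'
  -- averages over the reflections `t ↦ -t` and `t ↦ π - t`
  have key := ((((hA t).add (hA (-t))).add (hA (t + Real.pi))).add (hA (-t + Real.pi))).mul_left
    (1 / 4 : ℂ)
  have key2 := ((((hB t).sub (hB (-t))).sub (hB (t + Real.pi))).add (hB (-t + Real.pi))).mul_left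
    (((Real.cos (θ / 2) : ℝ) : ℂ) / 4)
  have key3 := key.add key2
  convert! key3 using 1
  · ext k
    rw [expansionTerm, Complex.ofReal_mul, cos_eq_expi, sin_eq_expi, expi_add_pi, expi_add_pi,
      expi_neg_right]
    generalize fourierCoef (fun u => oscillationFun s Ω (Complex.exp (u * Complex.I))) k = a
    generalize fourierCoef (fun u => weightedOscillationFun s Ω (Complex.exp (u * Complex.I))) k = b
    field_simp
    ring
  · rw [oscillationFun_expi Ω h hθ, oscillationFun_expi Ω h2 hθ', oscillationFun_expi Ω h3 hθ',
      oscillationFun_expi Ω h4 hθ, weightedOscillationFun_expi Ω h hθ,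
      weightedOscillationFun_expi Ω h2 hθ', weightedOscillationFun_expi Ω h3 hθ',
      weightedOscillationFun_expi Ω h4 hθ, neg_div, Real.cos_neg]
    field_simp
    ring

lemma norm_one_add_neg_one_zpow_div_two_le (k : ℤ) : ‖((1 + (-1) ^ k) / 2 : ℂ)‖ ≤ 1 := by
  rcases Int.even_or_odd k with h | h
  · rw [h.neg_one_zpow]; norm_num
  · rw [h.neg_one_zpow]; norm_num

lemma norm_one_sub_neg_one_zpow_div_two_le (k : ℤ) : ‖((1 - (-1) ^ k) / 2 : ℂ)‖ ≤ 1 := by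
  rcases Int.even_or_odd k with h | h
  · rw [h.neg_one_zpow]; norm_num
  · rw [h.neg_one_zpow]; norm_num

lemma norm_expansionTerm_le (hs0 : 0 < s) (hs1 : s < 1)
    (hκ₀ : s * Real.cosh κ₀ ≤ 1) (hκ0 : 0 < κ) (hκ : κ < κ₀) (Ω : ℝ) (k : ℤ) (θ t : ℝ) :
    ‖expansionTerm s Ω k θ t‖ ≤ Real.exp (2 * |Ω| * Real.arsinh (s * Real.sinh κ)) *
      (1 + Real.sqrt 2 / Real.sqrt (1 - s ^ 2)) * Real.exp (-κ) ^ k.natAbs := by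
  have hA := norm_fourierCoef_oscillationFun_le hs0 hs1 hκ₀ hκ0 hκ Ω k
  have hB := norm_fourierCoef_weightedOscillationFun_le hs0 hs1 hκ₀ hκ0 hκ Ω k
  refine (norm_add_le _ _).trans (le_trans (add_le_add ?_ ?_) (add_le_add hA hB) |>.trans_eq ?_)
  · rw [norm_mul, norm_mul, Complex.norm_real]
    refine mul_le_of_le_one_right (by positivity) (Real.abs_cos_le_one _) |>.trans ?_
    exact mul_le_of_le_one_right (norm_nonneg _) (norm_one_add_neg_one_zpow_div_two_le k)
  · rw [norm_mul, norm_mul, norm_mul, Complex.norm_I, mul_one, Complex.norm_real, norm_mul]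
    refine mul_le_of_le_one_right (by positivity) ?_ |>.trans ?_
    · exact mul_le_one₀ (Real.abs_cos_le_one _) (norm_nonneg _) (Real.abs_sin_le_one _)
    · exact mul_le_of_le_one_right (norm_nonneg _) (norm_one_sub_neg_one_zpow_div_two_le k)
  · ring

/-- The terms with index at most `2 n` are trigonometric polynomials of degree `n` in `θ`: `cos (2 t)`
is an affine function of `cos θ`, and the odd multiples of `t` come with the factor
`cos (θ / 2)`. -/
lemma exists_expansionTerm_eq (hs : 0 < s) (Ω : ℝ) {n : ℕ} {k : ℤ} (hk : k.natAbs ≤ 2 * n) :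
    ∃ v ∈ trigPoly n, ∀ θ t : ℝ, Real.sin (θ / 2) = s * Real.sin t →
      expansionTerm s Ω k θ t = v θ := by
  rcases Int.even_or_odd k with h | h
  · obtain ⟨v, hv, hv'⟩ := exists_cos_nat_mul_eq (1 - 1 / s ^ 2) (1 / s ^ 2) (k.natAbs / 2)
    refine ⟨_, Submodule.smul_mem _
      (fourierCoef (fun u => oscillationFun s Ω (Complex.exp (u * Complex.I))) k)
      (trigPoly_mono (by omega) hv), fun θ t ht => ?_⟩
    have h1 : Real.cos (k * t) = Real.cos ((k.natAbs / 2 : ℕ) * (2 * t)) := by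
      have h2 : ((k.natAbs / 2 : ℕ) : ℝ) * (2 * t) = |(k : ℝ)| * t := by
        have h3 : 2 * (k.natAbs / 2) = k.natAbs :=
          Nat.mul_div_cancel' (Int.natAbs_even.2 h).two_dvd
        have h4 : (2 : ℝ) * ((k.natAbs / 2 : ℕ) : ℝ) = |(k : ℝ)| := by
          rw [← Int.cast_abs, ← Nat.cast_natAbs, ← h3]; push_cast; simp [h3]
        rw [← h4]; ring
      rw [h2]
      rcases abs_choice (k : ℝ) with h5 | h5 <;> rw [h5]
      rw [neg_mul, Real.cos_neg]
    rw [expansionTerm, h.neg_one_zpow, h1, hv' _ _ (cos_two_mul_eq hs ht)]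
    simp
  · obtain ⟨v, hv, hv'⟩ := exists_cos_mul_sin_odd_eq hs (k.natAbs / 2)
    have hodd : 2 * (k.natAbs / 2) + 1 = k.natAbs :=
      Nat.two_mul_div_two_add_one_of_odd (Int.natAbs_odd.2 h)
    refine ⟨_, Submodule.smul_mem _
      (fourierCoef (fun u => weightedOscillationFun s Ω (Complex.exp (u * Complex.I))) k *
        Complex.I * (k.sign : ℂ)) (trigPoly_mono (by omega) hv), fun θ t ht => ?_⟩
    have h1 : Real.sin (k * t) = k.sign * Real.sin ((k.natAbs : ℕ) * t) := by
      rw [Nat.cast_natAbs]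
      rcases lt_trichotomy k 0 with h5 | h5 | h5
      · rw [abs_of_neg h5, Int.sign_eq_neg_one_of_neg h5]; push_cast
        rw [neg_mul (k : ℝ), Real.sin_neg]; ring
      · rw [h5] at h; simp at h
      · rw [abs_of_pos h5, Int.sign_eq_one_of_pos h5]; push_cast; ring
    have h2 := hv' θ t ht
    rw [hodd] at h2
    rw [expansionTerm, h.neg_one_zpow, h1, Pi.smul_apply, ← h2, smul_eq_mul]
    push_cast
    ring

/-- The truncated expansion of `exp (i Ω θ)` is a trigonometric polynomial of degree `n` whose error
is bounded uniformly on the arc. -/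
theorem exists_trigPoly_norm_sub_le (hs0 : 0 < s) (hs1 : s < 1)
    (hκ₀ : s * Real.cosh κ₀ ≤ 1) (hκ0 : 0 < κ) (hκ : κ < κ₀) (Ω : ℝ) (n : ℕ) :
    ∃ v ∈ trigPoly n, ∀ θ t : ℝ, Real.sin (θ / 2) = s * Real.sin t →
      θ / 2 ∈ Set.Ioo (-(Real.pi / 2)) (Real.pi / 2) →
      ‖Complex.exp (((Ω * θ : ℝ) : ℂ) * Complex.I) - v θ‖ ≤
        2 * (Real.exp (2 * |Ω| * Real.arsinh (s * Real.sinh κ)) *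
          (1 + Real.sqrt 2 / Real.sqrt (1 - s ^ 2))) * Real.exp (-κ) ^ (2 * n) /
            (1 - Real.exp (-κ)) := by
  have hex : ∀ k : ℤ, ∃ v : ℝ → ℂ, k.natAbs ≤ 2 * n → v ∈ trigPoly n ∧
      ∀ θ t : ℝ, Real.sin (θ / 2) = s * Real.sin t → expansionTerm s Ω k θ t = v θ := by
    intro k
    by_cases hk : k.natAbs ≤ 2 * n
    · obtain ⟨v, hv, hv'⟩ := exists_expansionTerm_eq hs0 Ω hk
      exact ⟨v, fun _ => ⟨hv, hv'⟩⟩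
    · exact ⟨0, fun h => absurd h hk⟩
  choose v hv using hex
  refine ⟨∑ m ∈ Finset.range (2 * n), (v m + v (-(m + 1 : ℤ))), ?_, fun θ t ht hθ => ?_⟩
  · refine sum_mem fun m hm => ?_
    rw [Finset.mem_range] at hm
    exact add_mem (hv _ (by omega)).1 (hv _ (by omega)).1
  have hr0 := Real.exp_pos (-κ)
  have hr1 : Real.exp (-κ) < 1 := Real.exp_lt_one_iff.mpr (by linarith)
  have hsum := (hasSum_expansionTerm hs0 hs1 hκ₀ (hκ0.trans hκ) Ω ht hθ).nat_add_neg_add_one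
  set K := Real.exp (2 * |Ω| * Real.arsinh (s * Real.sinh κ)) *
    (1 + Real.sqrt 2 / Real.sqrt (1 - s ^ 2)) with hK
  have hK0 : 0 ≤ K := by positivity
  have hb : ∀ m : ℕ, ‖expansionTerm s Ω m θ t + expansionTerm s Ω (-(m + 1 : ℤ)) θ t‖ ≤
      2 * K * Real.exp (-κ) ^ m := by
    intro m
    have h1 := norm_expansionTerm_le hs0 hs1 hκ₀ hκ0 hκ Ω m θ t
    have h2 := norm_expansionTerm_le hs0 hs1 hκ₀ hκ0 hκ Ω (-(m + 1 : ℤ)) θ t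
    rw [← hK] at h1 h2
    rw [Int.natAbs_natCast] at h1
    rw [show (-(m + 1 : ℤ)).natAbs = m + 1 by omega] at h2
    have h3 : Real.exp (-κ) ^ (m + 1) ≤ Real.exp (-κ) ^ m :=
      pow_le_pow_of_le_one hr0.le hr1.le (Nat.le_succ m)
    have h4 := mul_le_mul_of_nonneg_left h3 hK0
    refine (norm_add_le _ _).trans ?_
    linarith
  have h := norm_sub_le_of_geometric_bound_of_hasSum hr1 hb hsum (2 * n)
  rw [norm_sub_rev]
  convert! h using 3
  rw [Finset.sum_apply]
  refine Finset.sum_congr rfl fun m hm => ?_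
  rw [Finset.mem_range] at hm
  rw [Pi.add_apply, (hv _ (by omega)).2 θ t ht, (hv _ (by omega)).2 θ t ht]

end


/-! ### Upper bounds for the error -/

/-- The logarithm of the parameter of the largest annulus in which the substitution
`sin (θ / 2) = s sin t`, `s = sin (π / (2T))`, is analytic. -/
noncomputable def annulusWidth (T : ℝ) : ℝ :=
  Real.log ((1 + Real.cos (Real.pi / (2 * T))) / Real.sin (Real.pi / (2 * T)))

section
variable {T : ℝ}

lemma pi_div_two_mul_mem (hT : 1 < T) : Real.pi / (2 * T) ∈ Set.Ioo 0 (Real.pi / 2) := by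
  have hπ := Real.pi_pos
  constructor
  · positivity
  · exact div_lt_div_of_pos_left hπ two_pos (by linarith)

lemma sin_pi_div_pos (hT : 1 < T) : 0 < Real.sin (Real.pi / (2 * T)) := by
  have h := pi_div_two_mul_mem hT
  exact Real.sin_pos_of_pos_of_lt_pi h.1 (by linarith [h.2, Real.pi_pos])

lemma cos_pi_div_pos (hT : 1 < T) : 0 < Real.cos (Real.pi / (2 * T)) := by
  have h := pi_div_two_mul_mem hT
  exact Real.cos_pos_of_mem_Ioo ⟨by linarith [h.1, Real.pi_pos], h.2⟩

lemma sin_pi_div_lt_one (hT : 1 < T) : Real.sin (Real.pi / (2 * T)) < 1 := by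
  have h1 := cos_pi_div_pos hT
  have h2 := sin_pi_div_pos hT
  nlinarith [Real.sin_sq_add_cos_sq (Real.pi / (2 * T))]

lemma cos_pi_div_lt_one (hT : 1 < T) : Real.cos (Real.pi / (2 * T)) < 1 := by
  have h1 := cos_pi_div_pos hT
  have h2 := sin_pi_div_pos hT
  nlinarith [Real.sin_sq_add_cos_sq (Real.pi / (2 * T))]

lemma exp_annulusWidth (hT : 1 < T) : Real.exp (annulusWidth T) =
    (1 + Real.cos (Real.pi / (2 * T))) / Real.sin (Real.pi / (2 * T)) := by
  have h1 := cos_pi_div_pos hT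
  have h2 := sin_pi_div_pos hT
  rw [annulusWidth, Real.exp_log (by positivity)]

lemma annulusWidth_pos (hT : 1 < T) : 0 < annulusWidth T := by
  have h1 := cos_pi_div_pos hT
  have h2 := sin_pi_div_pos hT
  have h3 := sin_pi_div_lt_one hT
  refine Real.log_pos ?_
  rw [one_lt_div h2]; linarith

lemma extensionRate_eq (hT : 1 < T) : extensionRate T = Real.exp (2 * annulusWidth T) := by
  have h2 := sin_pi_div_pos hT
  have h4 : Real.pi / (2 * T) = 2 * (Real.pi / (4 * T)) := by
    have : T ≠ 0 := by linarith
    field_simp; ring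
  rw [two_mul, Real.exp_add, exp_annulusWidth hT, extensionRate, Real.cot_eq_cos_div_sin, sq]
  rw [h4, Real.sin_two_mul] at h2
  have hs : Real.sin (Real.pi / (4 * T)) ≠ 0 := fun h => by simp [h] at h2
  have hc : Real.cos (Real.pi / (4 * T)) ≠ 0 := fun h => by simp [h] at h2
  have key : (1 + Real.cos (Real.pi / (2 * T))) / Real.sin (Real.pi / (2 * T)) =
      Real.cos (Real.pi / (4 * T)) / Real.sin (Real.pi / (4 * T)) := by
    rw [h4, Real.sin_two_mul, Real.cos_two_mul]
    field_simp
    ring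
  rw [key]

lemma one_lt_extensionRate (hT : 1 < T) : 1 < extensionRate T := by
  rw [extensionRate_eq hT, Real.one_lt_exp_iff]
  linarith [annulusWidth_pos hT]

lemma sin_mul_cosh_annulusWidth (hT : 1 < T) :
    Real.sin (Real.pi / (2 * T)) * Real.cosh (annulusWidth T) = 1 := by
  have h1 := cos_pi_div_pos hT
  have h2 := sin_pi_div_pos hT
  rw [Real.cosh_eq, Real.exp_neg, exp_annulusWidth hT]
  have h3 := Real.sin_sq_add_cos_sq (Real.pi / (2 * T))
  field_simp
  linarith

lemma sin_mul_sinh_annulusWidth (hT : 1 < T) :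
    Real.sin (Real.pi / (2 * T)) * Real.sinh (annulusWidth T) = Real.cos (Real.pi / (2 * T)) := by
  have h1 := cos_pi_div_pos hT
  have h2 := sin_pi_div_pos hT
  rw [Real.sinh_eq, Real.exp_neg, exp_annulusWidth hT]
  have h3 := Real.sin_sq_add_cos_sq (Real.pi / (2 * T))
  field_simp
  linarith

/-- The upper bound for the error given by the circle of radius `exp κ` in the annulus of
analyticity. -/
noncomputable def errorBound (T ω : ℝ) (n : ℕ) (κ : ℝ) : ℝ :=
  Real.sqrt 2 * (2 * (Real.exp (2 * |ω * T| *
      Real.arsinh (Real.sin (Real.pi / (2 * T)) * Real.sinh κ)) *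
    (1 + Real.sqrt 2 / Real.sqrt (1 - Real.sin (Real.pi / (2 * T)) ^ 2))) *
      Real.exp (-κ) ^ (2 * n) / (1 - Real.exp (-κ)))

lemma abs_sin_le_of_mem_Icc (hT : 1 < T) {x : ℝ} (hx : x ∈ Set.Icc (-1 : ℝ) 1) :
    |Real.sin (Real.pi / T * x / 2)| ≤ Real.sin (Real.pi / (2 * T)) := by
  have h := pi_div_two_mul_mem hT
  have h1 : Real.pi / T * x / 2 = Real.pi / (2 * T) * x := by
    have : T ≠ 0 := by linarith
    field_simp
  have h2 : Real.pi / (2 * T) * x ≤ Real.pi / (2 * T) := by nlinarith [hx.2, h.1]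
  have h3 : -(Real.pi / (2 * T)) ≤ Real.pi / (2 * T) * x := by nlinarith [hx.1, h.1]
  rw [h1, abs_le, ← Real.sin_neg]
  exact ⟨Real.sin_le_sin_of_le_of_le_pi_div_two (by linarith [h.2]) (by linarith [h.2]) h3,
    Real.sin_le_sin_of_le_of_le_pi_div_two (by linarith [h.2]) (by linarith [h.2]) h2⟩

lemma half_mem_Ioo_of_mem_Icc (hT : 1 < T) {x : ℝ} (hx : x ∈ Set.Icc (-1 : ℝ) 1) :
    Real.pi / T * x / 2 ∈ Set.Ioo (-(Real.pi / 2)) (Real.pi / 2) := by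
  have h := pi_div_two_mul_mem hT
  have h1 : Real.pi / T * x / 2 = Real.pi / (2 * T) * x := by
    have : T ≠ 0 := by linarith
    field_simp
  rw [h1]
  constructor <;> nlinarith [hx.1, hx.2, h.1, h.2]

/-- The extension is at least as good as the truncated expansion. -/
theorem l2Norm_sub_le_errorBound (hT : 1 < T) {ω : ℝ} {n : ℕ} {g : ℝ → ℂ}
    (hg : IsContinuousFourierExtension T n (complexOscillation ω) g) {κ : ℝ} (hκ0 : 0 < κ)
    (hκ : κ < annulusWidth T) : l2Norm (complexOscillation ω - g) ≤ errorBound T ω n κ := by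
  obtain ⟨v, hv, hv'⟩ := exists_trigPoly_norm_sub_le (sin_pi_div_pos hT) (sin_pi_div_lt_one hT)
    (sin_mul_cosh_annulusWidth hT).le hκ0 hκ (ω * T) n
  have hr1 : Real.exp (-κ) < 1 := Real.exp_lt_one_iff.mpr (by linarith)
  have hmem : (fun x => v (Real.pi / T * x)) ∈ trigSpace T n :=
    mem_trigSpace_iff.2 ⟨v, hv, fun x => rfl⟩
  refine (hg.2 _ hmem).trans (l2Norm_le_of_norm_le
    ((continuous_complexOscillation ω).sub (continuous_of_mem_trigSpace hmem)) ?_ fun x hx => ?_)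
  · have : 0 < 1 - Real.exp (-κ) := by linarith
    positivity
  · have hs := sin_pi_div_pos hT
    have h1 := abs_le.1 (abs_sin_le_of_mem_Icc hT hx)
    have h2 : Real.sin (Real.pi / T * x / 2) = Real.sin (Real.pi / (2 * T)) *
        Real.sin (Real.arcsin (Real.sin (Real.pi / T * x / 2) / Real.sin (Real.pi / (2 * T)))) := by
      rw [Real.sin_arcsin, mul_div_cancel₀ _ hs.ne']
      · rw [le_div_iff₀ hs]; linarith
      · rw [div_le_iff₀ hs]; linarith
    have h3 := hv' _ _ h2 (half_mem_Ioo_of_mem_Icc hT hx)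
    have h4 : complexOscillation ω x =
        Complex.exp (((ω * T * (Real.pi / T * x) : ℝ) : ℂ) * Complex.I) := by
      rw [complexOscillation_eq]
      congr 3
      have : T ≠ 0 := by linarith
      field_simp
    rw [Pi.sub_apply, h4]
    exact h3

lemma continuousAt_errorBound (T ω : ℝ) (n : ℕ) {κ : ℝ} (hκ : 0 < κ) :
    ContinuousAt (errorBound T ω n) κ := by
  have hr1 : Real.exp (-κ) < 1 := Real.exp_lt_one_iff.mpr (by linarith)
  unfold errorBound
  refine continuousAt_const.mul (ContinuousAt.div ?_ (by fun_prop) (by linarith))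
  have h1 : Continuous fun κ => Real.arsinh (Real.sin (Real.pi / (2 * T)) * Real.sinh κ) :=
    Real.continuous_arsinh.comp (continuous_const.mul Real.continuous_sinh)
  have h2 : Continuous fun κ : ℝ => Real.exp (-κ) ^ (2 * n) := by fun_prop
  have h3 : Continuous fun κ => Real.exp (2 * |ω * T| *
      Real.arsinh (Real.sin (Real.pi / (2 * T)) * Real.sinh κ)) := by fun_prop
  exact ((continuous_const.mul (h3.mul continuous_const)).mul h2).continuousAt

/-- The bound persists for the boundary of the annulus of analyticity. -/
lemma l2Norm_sub_le_errorBound_annulusWidth (hT : 1 < T) {ω : ℝ} {n : ℕ} {g : ℝ → ℂ}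
    (hg : IsContinuousFourierExtension T n (complexOscillation ω) g) :
    l2Norm (complexOscillation ω - g) ≤ errorBound T ω n (annulusWidth T) := by
  have h0 := annulusWidth_pos hT
  refine ge_of_tendsto ((continuousAt_errorBound T ω n h0).tendsto.mono_left
    (nhdsWithin_le_nhds (s := Set.Iio (annulusWidth T)))) ?_
  filter_upwards [Ioo_mem_nhdsLT h0] with κ hκ
  exact l2Norm_sub_le_errorBound hT hg hκ.1 hκ.2

/-- A comparison of `arsinh` with `artanh`: the difference of the two sides is monotone in `c`. -/
lemma sqrt_mul_arsinh_le {c : ℝ} (h0 : 0 ≤ c) (h1 : c < 1) :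
    Real.sqrt (1 + c ^ 2) * Real.arsinh c ≤ (Real.log (1 + c) - Real.log (1 - c)) / 2 := by
  have hder : ∀ x ∈ Set.Ico (0 : ℝ) 1, HasDerivAt
      (fun x => (Real.log (1 + x) - Real.log (1 - x)) / 2 - Real.sqrt (1 + x ^ 2) * Real.arsinh x)
      (((1 / (1 + x)) - (-1 / (1 - x))) / 2 -
        (2 * x / (2 * Real.sqrt (1 + x ^ 2)) * Real.arsinh x +
          Real.sqrt (1 + x ^ 2) * (Real.sqrt (1 + x ^ 2))⁻¹)) x := by
    intro x hx
    have hx0 := hx.1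
    have hx1 := hx.2
    have d1 : HasDerivAt (fun x : ℝ => 1 + x) 1 x := (hasDerivAt_id x).const_add 1
    have d2 : HasDerivAt (fun x : ℝ => 1 - x) (-1) x := (hasDerivAt_id x).const_sub 1
    have d3 : HasDerivAt (fun x : ℝ => 1 + x ^ 2) (2 * x) x := by
      simpa using (hasDerivAt_pow 2 x).const_add 1
    have e3 := d3.sqrt (by positivity)
    exact (((d1.log (by linarith)).sub (d2.log (by linarith))).div_const 2).sub
      (e3.mul (Real.hasDerivAt_arsinh x))
  have hmono : MonotoneOn (fun x => (Real.log (1 + x) - Real.log (1 - x)) / 2 -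
      Real.sqrt (1 + x ^ 2) * Real.arsinh x) (Set.Ico (0 : ℝ) 1) := by
    refine monotoneOn_of_deriv_nonneg (convex_Ico 0 1)
      (fun x hx => (hder x hx).continuousAt.continuousWithinAt)
      (fun x hx => (hder x (interior_subset hx)).differentiableAt.differentiableWithinAt)
      fun x hx => ?_
    rw [(hder x (interior_subset hx)).deriv]
    rw [interior_Ico] at hx
    have hx0 := hx.1
    have hx1 := hx.2
    have hr : 1 ≤ Real.sqrt (1 + x ^ 2) := Real.one_le_sqrt.2 (by nlinarith)
    have ha : Real.arsinh x ≤ x := by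
      have := Real.arsinh_le_arsinh.2 (Real.self_le_sinh_iff.2 hx0.le)
      rwa [Real.arsinh_sinh] at this
    have ha0 : 0 ≤ Real.arsinh x := Real.arsinh_nonneg_iff.2 hx0.le
    rw [mul_inv_cancel₀ (by linarith)]
    have h2 : 2 * x / (2 * Real.sqrt (1 + x ^ 2)) * Real.arsinh x ≤ x * x := by
      refine mul_le_mul ?_ ha ha0 hx0.le
      rw [div_le_iff₀ (by linarith)]; nlinarith
    have h3 : ((1 / (1 + x)) - (-1 / (1 - x))) / 2 = 1 / (1 - x ^ 2) := by
      have : 1 - x ≠ 0 := by linarith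
      have : 1 + x ≠ 0 := by linarith
      have : 1 - x ^ 2 ≠ 0 := by nlinarith
      field_simp; ring
    have h4 : 1 + x * x ≤ 1 / (1 - x ^ 2) := by
      rw [le_div_iff₀ (by nlinarith)]; nlinarith [sq_nonneg (x * x)]
    rw [h3]; linarith
  have := hmono ⟨le_rfl, one_pos⟩ ⟨h0, h1⟩ h0
  simp at this
  linarith

/-- At the boundary of the annulus the growth rate of `exp (i Ω θ)` is at most the rate threshold. -/
lemma mul_arsinh_cos_le (hT : 1 < T) :
    T * Real.arsinh (Real.cos (Real.pi / (2 * T))) ≤ rateThreshold T * annulusWidth T := by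
  have h1 := cos_pi_div_pos hT
  have h2 := sin_pi_div_pos hT
  have h3 := cos_pi_div_lt_one hT
  have h := sqrt_mul_arsinh_le h1.le h3
  have hw : annulusWidth T = (Real.log (1 + Real.cos (Real.pi / (2 * T))) -
      Real.log (1 - Real.cos (Real.pi / (2 * T)))) / 2 := by
    rw [annulusWidth, Real.log_div (by linarith) h2.ne']
    have h4 : Real.log (Real.sin (Real.pi / (2 * T)) ^ 2) =
        Real.log (1 + Real.cos (Real.pi / (2 * T))) +
        Real.log (1 - Real.cos (Real.pi / (2 * T))) := by
      rw [← Real.log_mul (by linarith) (by linarith), Real.sin_sq]; congr 1; ring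
    rw [Real.log_pow] at h4
    push_cast at h4
    linarith
  rw [← hw] at h
  have hr : 0 < Real.sqrt (1 + Real.cos (Real.pi / (2 * T)) ^ 2) := Real.sqrt_pos.2 (by positivity)
  rw [rateThreshold, div_mul_eq_mul_div, le_div_iff₀ hr]
  have hT0 : 0 < T := by linarith
  nlinarith

/-- Decay at the rate `E(T) = exp (2 κ)`, from the circle that bounds the annulus of analyticity. -/
theorem exists_l2Norm_sub_le_extensionRate (hT : 1 < T) :
    ∃ C : ℝ, ∀ (ω : ℝ) (n : ℕ) (g : ℝ → ℂ),
      IsContinuousFourierExtension T n (complexOscillation ω) g →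
      l2Norm (complexOscillation ω - g) ≤
        C * extensionRate T ^ (-((n : ℝ) - rateThreshold T * |ω|)) := by
  have hT0 : 0 < T := by linarith
  have hκ := annulusWidth_pos hT
  have hr1 : Real.exp (-annulusWidth T) < 1 := Real.exp_lt_one_iff.mpr (by linarith)
  have hr2 : 0 < 1 - Real.exp (-annulusWidth T) := by linarith
  refine ⟨Real.sqrt 2 * (2 * (1 + Real.sqrt 2 / Real.sqrt (1 - Real.sin (Real.pi / (2 * T)) ^ 2)) /
    (1 - Real.exp (-annulusWidth T))), fun ω n g hg => ?_⟩
  refine (l2Norm_sub_le_errorBound_annulusWidth hT hg).trans ?_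
  have h1 : Real.exp (2 * |ω * T| * Real.arsinh (Real.cos (Real.pi / (2 * T)))) *
      Real.exp (-annulusWidth T) ^ (2 * n) ≤
      extensionRate T ^ (-((n : ℝ) - rateThreshold T * |ω|)) := by
    rw [extensionRate_eq hT, ← Real.exp_mul, ← Real.exp_nat_mul, ← Real.exp_add, Real.exp_le_exp,
      abs_mul, abs_of_pos hT0]
    have := mul_le_mul_of_nonneg_left (mul_arsinh_cos_le hT) (abs_nonneg ω)
    push_cast
    linarith
  rw [errorBound, sin_mul_sinh_annulusWidth hT]
  refine le_trans (le_of_eq ?_) (mul_le_mul_of_nonneg_left h1 (by positivity))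
  ring

/-- Exponential decay beyond the resolution threshold, from a circle close to the unit circle: the
growth rate `T arsinh (s sinh κ)` of `exp (i Ω θ)` is `T s κ` to first order, where `2 T s = r(T)`. -/
theorem exists_l2Norm_sub_le_of_lt (hT : 1 < T) {μ : ℝ}
    (hμ : 1 / 2 * resolutionConstant T < μ) :
    ∃ ρ : ℝ, 1 < ρ ∧ ∃ C : ℝ, ∀ (ω : ℝ) (n : ℕ) (g : ℝ → ℂ),
      IsContinuousFourierExtension T n (complexOscillation ω) g →
      l2Norm (complexOscillation ω - g) ≤ C * ρ ^ (-((n : ℝ) - μ * |ω|)) := by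
  have hT0 : 0 < T := by linarith
  have hs := sin_pi_div_pos hT
  -- `sinh κ` is close to `κ` for small `κ`
  obtain ⟨κ, ⟨hκ0, hκ1⟩, hκ⟩ : ∃ κ ∈ Set.Ioo 0 (annulusWidth T),
      T * Real.sin (Real.pi / (2 * T)) * Real.sinh κ ≤ μ * κ := by
    have h1 := (Real.hasDerivAt_sinh 0).tendsto_slope_zero_right
    have h2 : Real.cosh 0 < μ / (T * Real.sin (Real.pi / (2 * T))) := by
      rw [Real.cosh_zero, one_lt_div (by positivity)]
      rw [resolutionConstant] at hμ; linarith
    obtain ⟨κ, hκ, hκ'⟩ := ((h1.eventually (gt_mem_nhds h2)).and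
      (Ioo_mem_nhdsGT (annulusWidth_pos hT))).exists
    refine ⟨κ, hκ', ?_⟩
    rw [zero_add, Real.sinh_zero, sub_zero, smul_eq_mul, lt_div_iff₀ (by positivity)] at hκ
    have hκ0 := hκ'.1
    calc T * Real.sin (Real.pi / (2 * T)) * Real.sinh κ =
        κ⁻¹ * Real.sinh κ * (T * Real.sin (Real.pi / (2 * T))) * κ := by field_simp
      _ ≤ μ * κ := mul_le_mul_of_nonneg_right hκ.le hκ0.le
  have hr1 : Real.exp (-κ) < 1 := Real.exp_lt_one_iff.mpr (by linarith)
  have hr2 : 0 < 1 - Real.exp (-κ) := by linarith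
  refine ⟨Real.exp (2 * κ), by rw [Real.one_lt_exp_iff]; linarith,
    Real.sqrt 2 * (2 * (1 + Real.sqrt 2 / Real.sqrt (1 - Real.sin (Real.pi / (2 * T)) ^ 2)) /
    (1 - Real.exp (-κ))), fun ω n g hg => ?_⟩
  refine (l2Norm_sub_le_errorBound hT hg hκ0 hκ1).trans ?_
  have h1 : Real.exp (2 * |ω * T| * Real.arsinh (Real.sin (Real.pi / (2 * T)) * Real.sinh κ)) *
      Real.exp (-κ) ^ (2 * n) ≤ Real.exp (2 * κ) ^ (-((n : ℝ) - μ * |ω|)) := by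
    rw [← Real.exp_mul, ← Real.exp_nat_mul, ← Real.exp_add, Real.exp_le_exp,
      abs_mul, abs_of_pos hT0]
    have h2 : Real.arsinh (Real.sin (Real.pi / (2 * T)) * Real.sinh κ) ≤
        Real.sin (Real.pi / (2 * T)) * Real.sinh κ := by
      have h3 : 0 ≤ Real.sin (Real.pi / (2 * T)) * Real.sinh κ :=
        mul_nonneg hs.le (Real.sinh_nonneg_iff.2 hκ0.le)
      have := Real.arsinh_le_arsinh.2 (Real.self_le_sinh_iff.2 h3)
      rwa [Real.arsinh_sinh] at this
    have h4 := mul_le_mul_of_nonneg_left h2 (mul_nonneg (abs_nonneg ω) hT0.le)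
    have h5 := mul_le_mul_of_nonneg_left hκ (abs_nonneg ω)
    push_cast
    linarith
  rw [errorBound]
  refine le_trans (le_of_eq ?_) (mul_le_mul_of_nonneg_left h1 (by positivity))
  ring

end


/-! ### The substitution on the real line -/

/-- The angle `θ` with `sin (θ / 2) = s sin (φ / 2)` and `|θ| ≤ π`. It maps `[-π, π]` onto an arc,
and the polynomials in `cos θ` on this arc are the polynomials in `cos φ`. -/
noncomputable def arcAngle (s φ : ℝ) : ℝ := 2 * Real.arcsin (s * Real.sin (φ / 2))

section
variable {s : ℝ}

lemma abs_mul_sin_lt_one (hs0 : 0 < s) (hs1 : s < 1) (y : ℝ) : |s * Real.sin y| < 1 := by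
  rw [abs_mul, abs_of_pos hs0]
  nlinarith [Real.abs_sin_le_one y, abs_nonneg (Real.sin y)]

lemma contDiff_arcAngle (hs0 : 0 < s) (hs1 : s < 1) : ContDiff ℝ 2 (arcAngle s) := by
  refine contDiff_iff_contDiffAt.2 fun φ => ?_
  have h := abs_lt.1 (abs_mul_sin_lt_one hs0 hs1 (φ / 2))
  have h1 := Real.contDiffAt_arcsin (n := 2) h.1.ne' h.2.ne
  have h2 : ContDiffAt ℝ 2 (fun φ : ℝ => s * Real.sin (φ / 2)) φ := by fun_prop
  exact contDiffAt_const.mul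
    (ContDiffAt.comp (g := Real.arcsin) (f := fun φ : ℝ => s * Real.sin (φ / 2)) φ h1 h2)

lemma continuous_arcAngle (s : ℝ) : Continuous (arcAngle s) := by
  unfold arcAngle; fun_prop

lemma hasDerivAt_arcAngle (hs0 : 0 < s) (hs1 : s < 1) (φ : ℝ) :
    HasDerivAt (arcAngle s)
      (s * Real.cos (φ / 2) / Real.sqrt (1 - (s * Real.sin (φ / 2)) ^ 2)) φ := by
  have h := abs_lt.1 (abs_mul_sin_lt_one hs0 hs1 (φ / 2))
  have h1 := Real.hasDerivAt_arcsin h.1.ne' h.2.ne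
  have h2 : HasDerivAt (fun φ : ℝ => s * Real.sin (φ / 2)) (s * (Real.cos (φ / 2) * (1 / 2))) φ :=
    (((hasDerivAt_id φ).div_const 2).sin).const_mul s
  have h3 := (HasDerivAt.comp (h₂ := Real.arcsin) φ h1 h2).const_mul 2
  exact h3.congr_deriv (by ring)

lemma sin_half_arcAngle (hs0 : 0 < s) (hs1 : s < 1) (φ : ℝ) :
    Real.sin (arcAngle s φ / 2) = s * Real.sin (φ / 2) := by
  have h := abs_lt.1 (abs_mul_sin_lt_one hs0 hs1 (φ / 2))
  rw [arcAngle, mul_div_cancel_left₀ _ two_ne_zero, Real.sin_arcsin h.1.le h.2.le]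

lemma cos_eq_one_sub (x : ℝ) : Real.cos x = 1 - 2 * Real.sin (x / 2) ^ 2 := by
  have := Real.cos_two_mul (x / 2)
  rw [mul_div_cancel₀ _ two_ne_zero] at this
  rw [this, Real.cos_sq']; ring

lemma cos_arcAngle (hs0 : 0 < s) (hs1 : s < 1) (φ : ℝ) :
    Real.cos (arcAngle s φ) = (1 - s ^ 2) + s ^ 2 * Real.cos φ := by
  rw [cos_eq_one_sub, sin_half_arcAngle hs0 hs1, cos_eq_one_sub φ]; ring

lemma arcAngle_add_two_pi (s φ : ℝ) : arcAngle s (φ + 2 * Real.pi) = -arcAngle s φ := by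
  rw [arcAngle, arcAngle, show (φ + 2 * Real.pi) / 2 = φ / 2 + Real.pi by ring, Real.sin_add_pi,
    mul_neg, Real.arcsin_neg]; ring

lemma arcAngle_neg (s φ : ℝ) : arcAngle s (-φ) = -arcAngle s φ := by
  rw [arcAngle, arcAngle, neg_div, Real.sin_neg, mul_neg, Real.arcsin_neg]; ring

end

lemma arcAngle_pi {T : ℝ} (hT : 1 < T) :
    arcAngle (Real.sin (Real.pi / (2 * T))) Real.pi = Real.pi / T := by
  have h := pi_div_two_mul_mem hT
  rw [arcAngle, Real.sin_pi_div_two, mul_one, Real.arcsin_sin (by linarith [h.1, h.2]) h.2.le]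
  have : T ≠ 0 := by linarith
  field_simp

/-- The function on `[-π, π]` obtained from a function on `[-1, 1]` by the substitution
`π x / T = θ`, `sin (θ / 2) = sin (π / (2T)) sin (φ / 2)`, with the weight `1 + cos φ`. The weight
makes the substitution bounded in `L²`. -/
noncomputable def arcPullback (T : ℝ) (u : ℝ → ℂ) (φ : ℝ) : ℂ :=
  ((1 + Real.cos φ : ℝ) : ℂ) * u (T / Real.pi * arcAngle (Real.sin (Real.pi / (2 * T))) φ)

lemma continuous_arcPullback (T : ℝ) {u : ℝ → ℂ} (hu : Continuous u) :
    Continuous (arcPullback T u) := by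
  have := continuous_arcAngle (Real.sin (Real.pi / (2 * T)))
  unfold arcPullback
  fun_prop

lemma arcPullback_sub (T : ℝ) (u v : ℝ → ℂ) :
    arcPullback T (u - v) = arcPullback T u - arcPullback T v := by
  ext φ; simp [arcPullback, mul_sub]

/-- The pullback is bounded in `L²`: the Jacobian of the substitution vanishes to first order at
`φ = ±π`, the square of the weight to higher order. -/
theorem exists_integral_sq_arcPullback_le {T : ℝ} (hT : 1 < T) :
    ∃ K : ℝ, 0 < K ∧ ∀ u : ℝ → ℂ, Continuous u →
      ∫ φ in (-Real.pi)..Real.pi, ‖arcPullback T u φ‖ ^ 2 ≤ K * l2Norm u ^ 2 := by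
  set s := Real.sin (Real.pi / (2 * T)) with hsdef
  have hs0 : 0 < s := sin_pi_div_pos hT
  have hs1 : s < 1 := sin_pi_div_lt_one hT
  have hT0 : 0 < T := by linarith
  have hπ := Real.pi_pos
  have hθ := continuous_arcAngle s
  refine ⟨4 * Real.pi / (T * s), by positivity, fun u hu => ?_⟩
  set x' : ℝ → ℝ := fun φ => T / Real.pi *
    (s * Real.cos (φ / 2) / Real.sqrt (1 - (s * Real.sin (φ / 2)) ^ 2)) with hx'
  have hpos : ∀ φ, 0 < 1 - (s * Real.sin (φ / 2)) ^ 2 := fun φ => by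
    have := (sq_lt_one_iff_abs_lt_one _).2 (abs_mul_sin_lt_one hs0 hs1 (φ / 2))
    linarith
  have hx'c : Continuous x' := by
    refine continuous_const.mul (Continuous.div (by fun_prop) (by fun_prop) fun φ => ?_)
    exact (Real.sqrt_pos.2 (hpos φ)).ne'
  have hsub := intervalIntegral.integral_comp_mul_deriv (a := -Real.pi) (b := Real.pi)
    (f := fun φ => T / Real.pi * arcAngle s φ) (f' := x') (g := fun x => ‖u x‖ ^ 2)
    (fun φ _ => (hasDerivAt_arcAngle hs0 hs1 φ).const_mul _) hx'c.continuousOn (by fun_prop)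
  have hend : T / Real.pi * arcAngle s Real.pi = 1 := by
    rw [hsdef, arcAngle_pi hT]; field_simp
  rw [arcAngle_neg, mul_neg, hend, ← sq_l2Norm] at hsub
  rw [← hsub, ← intervalIntegral.integral_const_mul]
  have hc1 := continuous_arcPullback T hu
  refine intervalIntegral.integral_mono_on (by linarith)
    (Continuous.intervalIntegrable (by fun_prop) _ _)
    (Continuous.intervalIntegrable (by simp only [Function.comp_def]; fun_prop) _ _)
    fun φ hφ => ?_
  have hcos : 0 ≤ Real.cos (φ / 2) := by
    apply Real.cos_nonneg_of_neg_pi_div_two_le_of_le <;> linarith [hφ.1, hφ.2]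
  have hcos1 := Real.cos_le_one (φ / 2)
  -- the Jacobian is at least a constant multiple of `cos (φ / 2)`, which dominates `(1 + cos φ)²`
  have h1 : T / Real.pi * (s * Real.cos (φ / 2)) ≤ x' φ := by
    refine mul_le_mul_of_nonneg_left ?_ (by positivity)
    rw [le_div_iff₀ (Real.sqrt_pos.2 (hpos φ))]
    refine mul_le_of_le_one_right (by positivity) ?_
    rw [Real.sqrt_le_one]
    nlinarith [sq_nonneg (s * Real.sin (φ / 2))]
  have h2 : (1 + Real.cos φ) ^ 2 ≤ 4 * Real.cos (φ / 2) := by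
    have h3 : Real.cos φ = 2 * Real.cos (φ / 2) ^ 2 - 1 := by
      rw [← Real.cos_two_mul, mul_div_cancel₀ _ two_ne_zero]
    have h4 : Real.cos (φ / 2) ^ 4 ≤ Real.cos (φ / 2) ^ 1 :=
      pow_le_pow_of_le_one hcos hcos1 (by norm_num)
    rw [h3]
    nlinarith
  rw [arcPullback, norm_mul, Complex.norm_real, mul_pow, Real.norm_eq_abs, sq_abs]
  simp only [Function.comp_apply, ← hsdef]
  set G := ‖u (T / Real.pi * arcAngle s φ)‖ ^ 2
  have hG : 0 ≤ G := by positivity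
  calc (1 + Real.cos φ) ^ 2 * G ≤ 4 * Real.cos (φ / 2) * G := mul_le_mul_of_nonneg_right h2 hG
    _ = 4 * Real.pi / (T * s) * (G * (T / Real.pi * (s * Real.cos (φ / 2)))) := by field_simp
    _ ≤ _ := by
      refine mul_le_mul_of_nonneg_left (mul_le_mul_of_nonneg_left h1 hG) (by positivity)

/-- Even functions of the arc that are trigonometric polynomials in `θ` become trigonometric
polynomials in `φ`, of the same degree up to the contribution of the weight. -/
lemma arcPullback_evenPart_mem {T : ℝ} (hT : 1 < T) {n : ℕ} {h : ℝ → ℂ} (hh : h ∈ trigSpace T n) :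
    arcPullback T (evenPart h) ∈ trigPoly (n + 1) := by
  obtain ⟨u, hu, hhu⟩ := mem_trigSpace_iff.1 hh
  obtain ⟨c, hc⟩ := exists_coeff_of_mem_trigPoly hu
  set s := Real.sin (Real.pi / (2 * T)) with hsdef
  have hs0 : 0 < s := sin_pi_div_pos hT
  have hs1 : s < 1 := sin_pi_div_lt_one hT
  choose v hv hv' using exists_cos_nat_mul_eq (1 - s ^ 2) (s ^ 2)
  have hw : (∑ k ∈ Finset.Icc (-(n : ℤ)) n, c k • v k.natAbs) ∈ trigPoly n := by
    refine sum_mem fun k hk => Submodule.smul_mem _ _ (trigPoly_mono ?_ (hv _))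
    rw [Finset.mem_Icc] at hk; omega
  convert add_mem (trigPoly_mono (Nat.le_succ n) hw) (cos_mul_mem_trigPoly hw) using 1
  ext φ
  have h1 : evenPart h (T / Real.pi * arcAngle s φ) =
      (∑ k ∈ Finset.Icc (-(n : ℤ)) n, c k • v k.natAbs) φ := by
    have hT0 : T ≠ 0 := by linarith
    have h2 : Real.pi / T * (T / Real.pi * arcAngle s φ) = arcAngle s φ := by
      have := Real.pi_ne_zero
      field_simp
    rw [evenPart, hhu, hhu, mul_neg, h2, hc, hc, ← Finset.sum_add_distrib, Finset.sum_div,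
      Finset.sum_apply]
    refine Finset.sum_congr rfl fun k _ => ?_
    rw [Pi.smul_apply, ← hv' k.natAbs _ _ (cos_arcAngle hs0 hs1 φ), smul_eq_mul]
    have h3 : Real.cos ((k.natAbs : ℕ) * arcAngle s φ) = Real.cos (k * arcAngle s φ) := by
      rw [Nat.cast_natAbs, Int.cast_abs]
      rcases abs_choice (k : ℝ) with h5 | h5 <;> rw [h5]
      rw [neg_mul, Real.cos_neg]
    rw [h3, cos_eq_expi, expi_neg_right]; ring
  rw [arcPullback, ← hsdef, h1, Pi.add_apply]
  push_cast; ring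

/-! ### Fourier coefficients of trigonometric polynomials -/

lemma integral_expi (m : ℤ) :
    ∫ u in (-Real.pi)..Real.pi, expi m u = if m = 0 then ((2 * Real.pi : ℝ) : ℂ) else 0 := by
  split_ifs with h
  · have : ∀ u, expi 0 u = 1 := fun u => by simp [expi]
    simp only [h, this, intervalIntegral.integral_const]
    rw [Complex.real_smul]; push_cast; ring
  · have h1 : ∀ u : ℝ, expi m u = Complex.exp ((m * Complex.I) * u) := fun u => by
      rw [expi]; congr 1; ring
    have h2 : (m * Complex.I : ℂ) ≠ 0 := mul_ne_zero (Int.cast_ne_zero.2 h) Complex.I_ne_zero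
    simp only [h1]
    rw [integral_exp_mul_complex h2, div_eq_zero_iff, sub_eq_zero,
      Complex.exp_eq_exp_iff_exists_int]
    exact Or.inl ⟨m, by push_cast; ring⟩

lemma fourierCoef_sub {F G : ℝ → ℂ} (hF : Continuous F) (hG : Continuous G) (k : ℤ) :
    fourierCoef (F - G) k = fourierCoef F k - fourierCoef G k := by
  simp only [fourierCoef, Pi.sub_apply, mul_sub]
  rw [intervalIntegral.integral_sub (Continuous.intervalIntegrable (by fun_prop) _ _)
    (Continuous.intervalIntegrable (by fun_prop) _ _), mul_sub]

lemma fourierCoef_sum_expi (s : Finset ℤ) (c : ℤ → ℂ) (k : ℤ) :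
    fourierCoef (fun x => ∑ l ∈ s, c l * expi l x) k = if k ∈ s then c k else 0 := by
  have h1 : ∀ u, expi (-k) u * ∑ l ∈ s, c l * expi l u = ∑ l ∈ s, c l * expi (-k + l) u := by
    intro u
    rw [Finset.mul_sum]
    refine Finset.sum_congr rfl fun l _ => ?_
    rw [expi_add]; ring
  simp only [fourierCoef, h1]
  rw [intervalIntegral.integral_finsetSum
    fun l _ => Continuous.intervalIntegrable (by fun_prop) _ _]
  simp only [intervalIntegral.integral_const_mul, integral_expi, mul_ite, mul_zero]
  have h2 : ∀ l : ℤ, -k + l = 0 ↔ k = l := fun l => by constructor <;> intro h <;> omega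
  simp only [h2, Finset.sum_ite_eq]
  split_ifs
  · have := Real.pi_ne_zero
    push_cast
    field_simp
  · rw [mul_zero]

lemma fourierCoef_eq_zero_of_mem_trigPoly {N : ℕ} {v : ℝ → ℂ} (hv : v ∈ trigPoly N) {k : ℤ}
    (hk : N < k.natAbs) : fourierCoef v k = 0 := by
  obtain ⟨c, hc⟩ := exists_coeff_of_mem_trigPoly hv
  rw [funext hc, fourierCoef_sum_expi, if_neg]
  rw [Finset.mem_Icc]; omega

lemma eq_sum_fourierCoef_of_mem_trigPoly {N : ℕ} {v : ℝ → ℂ} (hv : v ∈ trigPoly N) (x : ℝ) :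
    v x = ∑ k ∈ Finset.Icc (-(N : ℤ)) N, fourierCoef v k * expi k x := by
  obtain ⟨c, hc⟩ := exists_coeff_of_mem_trigPoly hv
  rw [hc]
  refine Finset.sum_congr rfl fun k hk => ?_
  rw [funext hc, fourierCoef_sum_expi, if_pos hk]

/-- Bessel's inequality. -/
lemma sum_sq_fourierCoef_le {F : ℝ → ℂ} (hF : Continuous F) (s : Finset ℤ) :
    ∑ k ∈ s, ‖fourierCoef F k‖ ^ 2 ≤ (2 * Real.pi)⁻¹ * ∫ u in (-Real.pi)..Real.pi, ‖F u‖ ^ 2 := by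
  have hL2 : MeasureTheory.MemLp F 2
      (MeasureTheory.volume.restrict (Set.Ioc (-Real.pi) Real.pi)) := by
    obtain ⟨C, hC⟩ := isCompact_Icc.exists_bound_of_continuousOn
      (hF.continuousOn (s := Set.Icc (-Real.pi) Real.pi))
    refine MeasureTheory.MemLp.of_bound hF.aestronglyMeasurable C ?_
    filter_upwards [MeasureTheory.ae_restrict_mem measurableSet_Ioc] with x hx
    exact hC x (Set.Ioc_subset_Icc_self hx)
  have h := hasSum_sq_fourierCoeffOn (neg_lt_self Real.pi_pos) hL2
  simp only [← fourierCoef_eq_fourierCoeffOn] at h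
  rw [show Real.pi - -Real.pi = 2 * Real.pi by ring, smul_eq_mul] at h
  exact sum_le_hasSum s (fun _ _ => by positivity) h

/-- The Cauchy–Schwarz inequality on an interval. -/
lemma integral_norm_le_sqrt_mul_sqrt {w : ℝ → ℂ} (hw : Continuous w) {a b : ℝ} (hab : a < b) :
    ∫ x in a..b, ‖w x‖ ≤ Real.sqrt (b - a) * Real.sqrt (∫ x in a..b, ‖w x‖ ^ 2) := by
  set m := (∫ x in a..b, ‖w x‖) / (b - a) with hm
  have hba : 0 < b - a := by linarith
  have h1 : 0 ≤ ∫ x in a..b, (‖w x‖ - m) ^ 2 :=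
    intervalIntegral.integral_nonneg hab.le fun x _ => sq_nonneg _
  have h2 : ∀ x, (‖w x‖ - m) ^ 2 = ‖w x‖ ^ 2 - 2 * m * ‖w x‖ + m ^ 2 := fun x => by ring
  simp only [h2] at h1
  rw [intervalIntegral.integral_add (Continuous.intervalIntegrable (by fun_prop) _ _)
    (Continuous.intervalIntegrable (by fun_prop) _ _), intervalIntegral.integral_sub
    (Continuous.intervalIntegrable (by fun_prop) _ _)
    (Continuous.intervalIntegrable (by fun_prop) _ _), intervalIntegral.integral_const_mul,
    intervalIntegral.integral_const, smul_eq_mul] at h1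
  have h3 : ∫ x in a..b, ‖w x‖ = m * (b - a) := by rw [hm]; field_simp
  rw [← Real.sqrt_mul hba.le]
  refine Real.le_sqrt_of_sq_le ?_
  rw [h3] at h1 ⊢
  nlinarith


/-! ### Oscillatory integrals -/

/-- First derivative test for oscillatory integrals: where the local frequency `Ω θ'` exceeds `|l|`
by a multiple of `Ω`, the integral of `exp (i (l x - Ω θ))` is at most of order `1 / Ω`. -/
theorem exists_norm_integral_exp_le {θ : ℝ → ℝ} (hθ : ContDiff ℝ 2 θ) {ν : ℝ}
    (hν : ν < deriv θ 0) :
    ∃ δ : ℝ, 0 < δ ∧ δ ≤ 1 ∧ ∃ C : ℝ, 0 ≤ C ∧ ∀ Ω l : ℝ, 0 < Ω → |l| ≤ ν * Ω →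
      ‖∫ x in (-δ)..δ, Complex.exp (((l * x - Ω * θ x : ℝ) : ℂ) * Complex.I)‖ ≤ C / Ω := by
  have hdiff : Differentiable ℝ θ := hθ.differentiable two_ne_zero
  have hθ1 : ContDiff ℝ 1 (deriv θ) := by
    have : ContDiff ℝ (1 + 1) θ := by simpa [one_add_one_eq_two] using hθ
    exact (contDiff_succ_iff_deriv.1 this).2.2
  have hdiff1 : Differentiable ℝ (deriv θ) := hθ1.differentiable one_ne_zero
  have hc2 : Continuous (deriv (deriv θ)) := hθ1.continuous_deriv le_rfl
  have hc1 : Continuous (deriv θ) := hθ1.continuous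
  obtain ⟨ν', hν1, hν2⟩ := exists_between hν
  obtain ⟨ε, hε, hball⟩ := Metric.eventually_nhds_iff.1
    (hc1.continuousAt.eventually (lt_mem_nhds hν2))
  set δ := min (ε / 2) 1 with hδ
  have hδ0 : 0 < δ := by positivity
  have hlow : ∀ x ∈ Set.Icc (-δ) δ, ν' ≤ deriv θ x := by
    intro x hx
    refine (hball ?_).le
    rw [Real.dist_eq, sub_zero]
    calc |x| ≤ δ := abs_le.2 hx
      _ ≤ ε / 2 := min_le_left _ _
      _ < ε := by linarith
  obtain ⟨B, hB⟩ := (isCompact_Icc (a := -δ) (b := δ)).exists_bound_of_continuousOn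
    hc2.continuousOn
  have hB0 : 0 ≤ B := (norm_nonneg _).trans (hB 0 ⟨by linarith, hδ0.le⟩)
  set d := ν' - ν with hd
  have hd0 : 0 < d := by linarith
  refine ⟨δ, hδ0, min_le_right _ _, 2 / d + 2 * δ * (B / d ^ 2), by positivity,
    fun Ω l hΩ hl => ?_⟩
  have huIcc : Set.uIcc (-δ) δ = Set.Icc (-δ) δ := Set.uIcc_of_le (by linarith)
  -- the derivative of the phase
  set ψ' : ℝ → ℝ := fun x => l - Ω * deriv θ x with hψ'
  have hψlow : ∀ x ∈ Set.Icc (-δ) δ, d * Ω ≤ |ψ' x| := by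
    intro x hx
    have h1 := hlow x hx
    have h2 := (le_abs_self l).trans hl
    rw [abs_of_nonpos (by rw [hψ']; simp only; nlinarith), hψ', hd]
    simp only
    nlinarith
  have hψ0 : ∀ x ∈ Set.Icc (-δ) δ, ψ' x ≠ 0 := fun x hx => by
    have := hψlow x hx
    exact abs_pos.1 (lt_of_lt_of_le (by positivity) this)
  set v : ℝ → ℂ := fun x => Complex.exp (((l * x - Ω * θ x : ℝ) : ℂ) * Complex.I) with hv
  have hvn : ∀ x, ‖v x‖ = 1 := fun x => Complex.norm_exp_ofReal_mul_I _
  have hvd : ∀ x, HasDerivAt v (v x * ((ψ' x : ℂ) * Complex.I)) x := by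
    intro x
    have h1 : HasDerivAt (fun x => l * x - Ω * θ x) (ψ' x) x := by
      have := ((hasDerivAt_id x).const_mul l).sub ((hdiff x).hasDerivAt.const_mul Ω)
      rwa [mul_one] at this
    exact (h1.ofReal_comp.mul_const Complex.I).cexp
  set u : ℝ → ℂ := fun x => ((ψ' x)⁻¹ : ℝ) * (-Complex.I) with hu
  have hψd : ∀ x, HasDerivAt ψ' (-(Ω * deriv (deriv θ) x)) x := fun x =>
    ((hdiff1 x).hasDerivAt.const_mul Ω).const_sub l
  set u' : ℝ → ℂ := fun x =>
    ((-(-(Ω * deriv (deriv θ) x)) / ψ' x ^ 2 : ℝ) : ℂ) * (-Complex.I) with hu'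
  have hud : ∀ x ∈ Set.Icc (-δ) δ, HasDerivAt u (u' x) x := fun x hx =>
    (((hψd x).fun_inv (hψ0 x hx)).ofReal_comp).mul_const _
  have hψc : Continuous ψ' := by fun_prop
  have hvc : Continuous v := by
    have := hdiff.continuous
    fun_prop
  have hu'c : ContinuousOn u' (Set.Icc (-δ) δ) := by
    refine ContinuousOn.mul (Complex.continuous_ofReal.comp_continuousOn ?_) continuousOn_const
    exact ContinuousOn.div (by fun_prop) (by fun_prop) fun x hx => pow_ne_zero _ (hψ0 x hx)
  have key := intervalIntegral.integral_mul_deriv_eq_deriv_mul (a := -δ) (b := δ)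
    (u := u) (u' := u') (v := v) (v' := fun x => v x * ((ψ' x : ℂ) * Complex.I))
    (fun x hx => hud x (by rwa [huIcc] at hx)) (fun x _ => hvd x)
    (ContinuousOn.intervalIntegrable (by rwa [huIcc]))
    (Continuous.intervalIntegrable (by fun_prop) _ _)
  have heq : ∫ x in (-δ)..δ, u x * (v x * ((ψ' x : ℂ) * Complex.I)) = ∫ x in (-δ)..δ, v x := by
    refine intervalIntegral.integral_congr fun x hx => ?_
    rw [huIcc] at hx
    have : (ψ' x : ℂ) ≠ 0 := Complex.ofReal_ne_zero.2 (hψ0 x hx)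
    simp only [hu]
    push_cast
    field_simp
    rw [Complex.I_sq]; ring
  rw [heq] at key
  rw [key]
  have hun : ∀ x ∈ Set.Icc (-δ) δ, ‖u x * v x‖ ≤ 1 / (d * Ω) := by
    intro x hx
    rw [norm_mul, hvn, mul_one, hu]
    simp only [norm_mul, norm_neg, Complex.norm_I, mul_one, Complex.norm_real, norm_inv,
      Real.norm_eq_abs]
    rw [inv_eq_one_div]
    exact one_div_le_one_div_of_le (by positivity) (hψlow x hx)
  have hu'n : ∀ x ∈ Set.uIoc (-δ) δ, ‖u' x * v x‖ ≤ Ω * B / (d * Ω) ^ 2 := by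
    intro x hx
    have hx' : x ∈ Set.Icc (-δ) δ := by
      rw [Set.uIoc_of_le (by linarith)] at hx
      exact Set.Ioc_subset_Icc_self hx
    rw [norm_mul, hvn, mul_one, hu']
    simp only [norm_mul, norm_neg, Complex.norm_I, mul_one, Complex.norm_real, neg_neg, norm_div,
      norm_pow]
    have h1 := hB x hx'
    rw [Real.norm_of_nonneg hΩ.le]
    refine div_le_div₀ (by positivity) (mul_le_mul_of_nonneg_left h1 hΩ.le) (by positivity) ?_
    exact pow_le_pow_left₀ (by positivity) (hψlow x hx') 2
  have h3 := intervalIntegral.norm_integral_le_of_norm_le_const hu'n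
  rw [show δ - -δ = 2 * δ by ring, abs_of_pos (by linarith)] at h3
  have h1 := hun δ ⟨by linarith, le_rfl⟩
  have h2 := hun (-δ) ⟨le_rfl, by linarith⟩
  calc _ ≤ ‖u δ * v δ‖ + ‖u (-δ) * v (-δ)‖ + ‖∫ x in (-δ)..δ, u' x * v x‖ :=
        (norm_sub_le _ _).trans (add_le_add_left (norm_sub_le _ _) _)
    _ ≤ 1 / (d * Ω) + 1 / (d * Ω) + Ω * B / (d * Ω) ^ 2 * (2 * δ) := by gcongr
    _ = _ := by field_simp; ring

/-! ### Lower bound before the resolution threshold -/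

lemma deriv_arcAngle_zero {s : ℝ} (hs0 : 0 < s) (hs1 : s < 1) : deriv (arcAngle s) 0 = s := by
  rw [(hasDerivAt_arcAngle hs0 hs1 0).deriv]
  simp

lemma evenPart_complexOscillation {T : ℝ} (hT : 1 < T) (ω φ : ℝ) :
    evenPart (complexOscillation ω) (T / Real.pi * φ) = (Real.cos (|ω| * T * φ) : ℂ) := by
  have hT0 : T ≠ 0 := by linarith
  have hπ := Real.pi_ne_zero
  rw [evenPart, complexOscillation_eq, complexOscillation_eq,
    show Real.pi * ω * (T / Real.pi * φ) = ω * T * φ by field_simp,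
    show Real.pi * ω * -(T / Real.pi * φ) = -(ω * T * φ) by field_simp]
  have h1 : Real.cos (|ω| * T * φ) = Real.cos (ω * T * φ) := by
    rcases abs_choice ω with h | h <;> rw [h]
    rw [neg_mul, neg_mul, Real.cos_neg]
  rw [h1, Complex.ofReal_cos, Complex.cos]
  push_cast
  ring_nf

/-- Below the resolution threshold the local frequency `Ω θ'(0) = |ω| T s` of the pullback exceeds the
degree of the extension, so that the pullback of the extension is nearly orthogonal to
`exp (i Ω θ)` on a fixed interval around `0`, while the pullback of `f_ω` is not. -/
theorem exists_le_l2Norm_sub {T : ℝ} (hT : 1 < T) {μ : ℝ}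
    (hμ : μ < 1 / 2 * resolutionConstant T) :
    ∃ c : ℝ, 0 < c ∧ ∃ ω₀ : ℝ, ∀ (ω : ℝ) (n : ℕ) (g : ℝ → ℂ), ω₀ ≤ |ω| → (n : ℝ) ≤ μ * |ω| →
      IsContinuousFourierExtension T n (complexOscillation ω) g →
      c ≤ l2Norm (complexOscillation ω - g) := by
  set s := Real.sin (Real.pi / (2 * T)) with hsdef
  have hs0 : 0 < s := sin_pi_div_pos hT
  have hs1 : s < 1 := sin_pi_div_lt_one hT
  have hT0 : 0 < T := by linarith
  have hπ := Real.pi_pos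
  have hμ' : max μ 0 < T * s := by
    refine max_lt ?_ (by positivity)
    rw [resolutionConstant, ← hsdef] at hμ; linarith
  obtain ⟨ν₀, hν1, hν2⟩ := exists_between hμ'
  have hν₀0 : 0 < ν₀ := (le_max_right _ _).trans_lt hν1
  set ν := ν₀ / T with hν
  have hν0 : 0 < ν := by positivity
  have hνs : ν < s := by rw [hν, div_lt_iff₀ hT0]; linarith
  have hμν : μ < ν₀ := (le_max_left _ _).trans_lt hν1
  obtain ⟨δ, hδ0, hδ1, C, hC0, hvdc⟩ := exists_norm_integral_exp_le
    (contDiff_arcAngle hs0 hs1) (ν := ν) (by rwa [deriv_arcAngle_zero hs0 hs1])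
  obtain ⟨K, hK0, hK⟩ := exists_integral_sq_arcPullback_le hT
  set D := Real.sqrt ((2 * Real.pi)⁻¹ * (K * (2 * Real.sqrt 2) ^ 2)) with hD
  set A := Real.sqrt (Real.pi - -Real.pi) * Real.sqrt K with hA
  have hA0 : 0 < A := by
    have : 0 < Real.pi - -Real.pi := by linarith
    positivity
  set M := C * (1 + D * Real.sqrt (2 * ν + 1)) with hM
  have hM0 : 0 ≤ M := by positivity
  refine ⟨δ / (2 * A), by positivity, max 1 (max (1 / (ν₀ - μ)) ((2 * M / δ) ^ 2)),
    fun ω n g hω hn hg => ?_⟩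
  have hω1 : 1 ≤ |ω| := (le_max_left _ _).trans hω
  have hω2 : 1 / (ν₀ - μ) ≤ |ω| := ((le_max_left _ _).trans (le_max_right _ _)).trans hω
  have hω3 : (2 * M / δ) ^ 2 ≤ |ω| := ((le_max_right _ _).trans (le_max_right _ _)).trans hω
  set Ω := |ω| * T with hΩ
  have hΩω : |ω| ≤ Ω := le_mul_of_one_le_right (abs_nonneg _) hT.le
  have hΩ1 : 1 ≤ Ω := hω1.trans hΩω
  have hΩ0 : 0 < Ω := by linarith
  have hnΩ : (n : ℝ) + 1 ≤ ν * Ω := by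
    have h1 : ν * Ω = ν₀ * |ω| := by rw [hν, hΩ]; field_simp
    rw [div_le_iff₀ (by linarith)] at hω2
    rw [h1]; linarith
  set f := complexOscillation ω with hf
  have hfc : Continuous f := continuous_complexOscillation ω
  have hgc : Continuous g := continuous_of_mem_trigSpace hg.1
  set e := l2Norm (f - g) with he
  -- the pairing of the error with the oscillation on the interval `[-δ, δ]`
  set w : ℝ → ℂ := fun φ => Complex.exp (((-(Ω * arcAngle s φ) : ℝ) : ℂ) * Complex.I) with hw
  have hwc : Continuous w := by
    have := continuous_arcAngle s
    fun_prop
  have hwn : ∀ φ, ‖w φ‖ = 1 := fun φ => Complex.norm_exp_ofReal_mul_I _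
  have hosc : ∀ k : ℤ, |k| ≤ n + 1 → ‖∫ φ in (-δ)..δ, expi k φ * w φ‖ ≤ C / Ω := by
    intro k hk
    have h1 : |(k : ℝ)| ≤ ν * Ω := by
      refine le_trans ?_ hnΩ
      exact_mod_cast hk
    convert hvdc Ω k hΩ0 h1 using 3
    ext φ
    rw [hw, expi, ← Complex.exp_add]
    congr 1; push_cast; ring
  have hosc2 : ∀ k : ℤ, |k| ≤ 1 → ‖∫ φ in (-δ)..δ, expi k φ * w φ ^ 2‖ ≤ C / Ω := by
    intro k hk
    have h1 : |(k : ℝ)| ≤ ν * (2 * Ω) := by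
      have h2 : |(k : ℝ)| ≤ 1 := by exact_mod_cast hk
      have h3 : (0 : ℝ) ≤ n := Nat.cast_nonneg n
      linarith
    have h2 := hvdc (2 * Ω) k (by linarith) h1
    refine le_trans (le_of_eq ?_) (h2.trans (div_le_div_of_nonneg_left hC0 hΩ0 (by linarith)))
    congr 2
    ext φ
    rw [hw, expi, ← Complex.exp_nat_mul, ← Complex.exp_add]
    congr 1; push_cast; ring
  set v := arcPullback T (evenPart g) with hv
  have hvmem : v ∈ trigPoly (n + 1) := arcPullback_evenPart_mem hT hg.1
  have hvc : Continuous v := continuous_of_mem_trigPoly hvmem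
  set F := arcPullback T (evenPart f) with hF
  have hFc : Continuous F := continuous_arcPullback T (continuous_evenPart hfc)
  have hFg : F - v = arcPullback T (evenPart (f - g)) := by
    rw [evenPart_sub, arcPullback_sub]
  -- the pairing is small if the error is
  have hupper : ‖∫ φ in (-δ)..δ, (F φ - v φ) * w φ‖ ≤ A * e := by
    have h1 : ‖∫ φ in (-δ)..δ, (F φ - v φ) * w φ‖ ≤ ∫ φ in (-δ)..δ, ‖F φ - v φ‖ := by
      refine (intervalIntegral.norm_integral_le_integral_norm (by linarith)).trans_eq ?_
      simp only [norm_mul, hwn, mul_one]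
    have h2 : ∫ φ in (-δ)..δ, ‖F φ - v φ‖ ≤ ∫ φ in (-Real.pi)..Real.pi, ‖F φ - v φ‖ :=
      intervalIntegral.integral_mono_interval (by linarith [Real.pi_gt_three]) (by linarith)
        (by linarith [Real.pi_gt_three])
        (Eventually.of_forall fun _ => norm_nonneg _)
        (Continuous.intervalIntegrable (by fun_prop) _ _)
    have h3 := integral_norm_le_sqrt_mul_sqrt (w := F - v) (hFc.sub hvc) (neg_lt_self hπ)
    have h4 : ∫ φ in (-Real.pi)..Real.pi, ‖(F - v) φ‖ ^ 2 ≤ K * e ^ 2 := by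
      rw [hFg]
      refine (hK _ (continuous_evenPart (hfc.sub hgc))).trans ?_
      refine mul_le_mul_of_nonneg_left ?_ hK0.le
      exact pow_le_pow_left₀ (l2Norm_nonneg _) (l2Norm_evenPart_le (hfc.sub hgc)) 2
    refine (h1.trans (h2.trans h3)).trans ?_
    rw [hA, mul_assoc]
    refine mul_le_mul_of_nonneg_left ?_ (Real.sqrt_nonneg _)
    refine (Real.sqrt_le_sqrt h4).trans_eq ?_
    rw [Real.sqrt_mul hK0.le, Real.sqrt_sq (l2Norm_nonneg _)]
  -- the polynomial contributes little to the pairing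
  have hpoly : ‖∫ φ in (-δ)..δ, v φ * w φ‖ ≤
      C / Ω * (D * Real.sqrt ((2 * ν + 1) * Ω)) := by
    have h1 : ∫ φ in (-δ)..δ, v φ * w φ = ∑ k ∈ Finset.Icc (-((n + 1 : ℕ) : ℤ)) (n + 1 : ℕ),
        fourierCoef v k * ∫ φ in (-δ)..δ, expi k φ * w φ := by
      simp only [← intervalIntegral.integral_const_mul]
      rw [← intervalIntegral.integral_finsetSum
        fun k _ => Continuous.intervalIntegrable (by fun_prop) _ _]
      refine intervalIntegral.integral_congr fun φ _ => ?_
      rw [eq_sum_fourierCoef_of_mem_trigPoly hvmem φ, Finset.sum_mul]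
      exact Finset.sum_congr rfl fun k _ => by ring
    set S := Finset.Icc (-((n + 1 : ℕ) : ℤ)) (n + 1 : ℕ) with hS
    have hcard : (S.card : ℝ) ≤ (2 * ν + 1) * Ω := by
      have : (S.card : ℝ) = 2 * (n + 1) + 1 := by
        rw [hS, Int.card_Icc]
        have : ((n + 1 : ℕ) + 1 - -((n + 1 : ℕ) : ℤ)).toNat = 2 * (n + 1) + 1 := by omega
        rw [this]; push_cast; ring
      rw [this]; linarith
    have hbes : ∑ k ∈ S, ‖fourierCoef v k‖ ^ 2 ≤ D ^ 2 := by
      rw [hD, Real.sq_sqrt (by positivity)]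
      refine (sum_sq_fourierCoef_le hvc S).trans ?_
      refine mul_le_mul_of_nonneg_left ?_ (by positivity)
      refine (hK _ (continuous_evenPart hgc)).trans ?_
      refine mul_le_mul_of_nonneg_left ?_ hK0.le
      refine pow_le_pow_left₀ (l2Norm_nonneg _) ((l2Norm_evenPart_le hgc).trans ?_) 2
      have h2 := hg.2 0 (zero_mem_trigSpace T n)
      rw [sub_zero] at h2
      have h3 := l2Norm_sub_le hfc (hfc.sub hgc)
      rw [sub_sub_cancel] at h3
      have h4 := l2Norm_complexOscillation_le ω
      linarith
    have hcs : ∑ k ∈ S, ‖fourierCoef v k‖ ≤ D * Real.sqrt ((2 * ν + 1) * Ω) := by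
      have h2 := Finset.sum_mul_sq_le_sq_mul_sq S (fun _ => (1 : ℝ)) (fun k => ‖fourierCoef v k‖)
      simp only [one_mul, one_pow, Finset.sum_const, nsmul_eq_mul, mul_one] at h2
      refine abs_le_of_sq_le_sq' ?_ (by positivity) |>.2
      rw [mul_pow, Real.sq_sqrt (show 0 ≤ (2 * ν + 1) * Ω by positivity)]
      calc _ ≤ (S.card : ℝ) * ∑ k ∈ S, ‖fourierCoef v k‖ ^ 2 := h2
        _ ≤ ((2 * ν + 1) * Ω) * D ^ 2 := by gcongr
        _ = _ := by ring
    rw [h1]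
    refine (norm_sum_le _ _).trans ?_
    calc _ ≤ ∑ k ∈ S, ‖fourierCoef v k‖ * (C / Ω) := by
          refine Finset.sum_le_sum fun k hk => ?_
          rw [norm_mul]
          refine mul_le_mul_of_nonneg_left (hosc k ?_) (norm_nonneg _)
          rw [hS, Finset.mem_Icc] at hk
          rw [abs_le]; push_cast at hk; constructor <;> linarith [hk.1, hk.2]
      _ = C / Ω * ∑ k ∈ S, ‖fourierCoef v k‖ := by rw [← Finset.sum_mul]; ring
      _ ≤ _ := mul_le_mul_of_nonneg_left hcs (by positivity)
  -- the oscillation itself contributes an amount of order one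
  have hmain : δ - C / Ω ≤ ‖∫ φ in (-δ)..δ, F φ * w φ‖ := by
    have h1 : ∀ φ, F φ * w φ = (((1 + Real.cos φ) / 2 : ℝ) : ℂ) +
        (1 / 2 * (expi 0 φ * w φ ^ 2) + 1 / 4 * (expi 1 φ * w φ ^ 2) +
          1 / 4 * (expi (-1) φ * w φ ^ 2)) := by
      intro φ
      have h2 : ((Real.cos (Ω * arcAngle s φ) : ℝ) : ℂ) * w φ = (1 + w φ ^ 2) / 2 := by
        have h3 : w φ * Complex.exp (((Ω * arcAngle s φ : ℝ) : ℂ) * Complex.I) = 1 := by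
          rw [hw, ← Complex.exp_add, ← Complex.exp_zero]
          congr 1; push_cast; ring
        have h4 : ((Real.cos (Ω * arcAngle s φ) : ℝ) : ℂ) =
            (Complex.exp (((Ω * arcAngle s φ : ℝ) : ℂ) * Complex.I) + w φ) / 2 := by
          rw [hw, Complex.ofReal_cos, Complex.cos]
          push_cast
          ring_nf
        rw [h4]
        linear_combination h3 / 2
      have h5 : F φ = ((1 + Real.cos φ : ℝ) : ℂ) * ((Real.cos (Ω * arcAngle s φ) : ℝ) : ℂ) := by
        rw [hF, arcPullback, hf, evenPart_complexOscillation hT]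
      have h6 := cos_eq_expi 1 φ
      rw [Int.cast_one, one_mul] at h6
      have h7 : expi 0 φ = 1 := by simp [expi]
      rw [h5, mul_assoc, h2, Complex.ofReal_div, Complex.ofReal_add, Complex.ofReal_one, h6, h7]
      push_cast
      ring
    simp only [h1]
    rw [intervalIntegral.integral_add (Continuous.intervalIntegrable (by fun_prop) _ _)
      (Continuous.intervalIntegrable (by fun_prop) _ _), intervalIntegral.integral_add
      (Continuous.intervalIntegrable (by fun_prop) _ _)
      (Continuous.intervalIntegrable (by fun_prop) _ _), intervalIntegral.integral_add
      (Continuous.intervalIntegrable (by fun_prop) _ _)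
      (Continuous.intervalIntegrable (by fun_prop) _ _), intervalIntegral.integral_const_mul,
      intervalIntegral.integral_const_mul, intervalIntegral.integral_const_mul,
      intervalIntegral.integral_ofReal]
    have h8 : δ ≤ ∫ φ in (-δ)..δ, (1 + Real.cos φ) / 2 := by
      have h9 : ∫ φ in (-δ)..δ, (1 / 2 : ℝ) ≤ ∫ φ in (-δ)..δ, (1 + Real.cos φ) / 2 := by
        refine intervalIntegral.integral_mono_on (by linarith) (by simp)
          (Continuous.intervalIntegrable (by fun_prop) _ _) fun φ hφ => ?_
        have : 0 ≤ Real.cos φ := by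
          apply Real.cos_nonneg_of_neg_pi_div_two_le_of_le <;>
            linarith [hφ.1, hφ.2, Real.pi_gt_three]
        linarith
      rw [intervalIntegral.integral_const, smul_eq_mul] at h9
      linarith
    have g1 := hosc2 0 (by simp)
    have g2 := hosc2 1 (by simp)
    have g3 := hosc2 (-1) (by simp)
    have h10 : ‖1 / 2 * (∫ φ in (-δ)..δ, expi 0 φ * w φ ^ 2) +
        1 / 4 * (∫ φ in (-δ)..δ, expi 1 φ * w φ ^ 2) +
        1 / 4 * (∫ φ in (-δ)..δ, expi (-1) φ * w φ ^ 2)‖ ≤ C / Ω := by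
      refine (norm_add₃_le).trans ?_
      rw [norm_mul, norm_mul, norm_mul]
      norm_num
      linarith
    have h11 := norm_sub_le_norm_add (((∫ φ in (-δ)..δ, (1 + Real.cos φ) / 2 : ℝ)) : ℂ)
      (1 / 2 * (∫ φ in (-δ)..δ, expi 0 φ * w φ ^ 2) +
        1 / 4 * (∫ φ in (-δ)..δ, expi 1 φ * w φ ^ 2) +
        1 / 4 * (∫ φ in (-δ)..δ, expi (-1) φ * w φ ^ 2))
    rw [Complex.norm_real, Real.norm_of_nonneg (by linarith)] at h11
    linarith
  have hsplit : ∫ φ in (-δ)..δ, (F φ - v φ) * w φ =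
      (∫ φ in (-δ)..δ, F φ * w φ) - ∫ φ in (-δ)..δ, v φ * w φ := by
    rw [← intervalIntegral.integral_sub (Continuous.intervalIntegrable (by fun_prop) _ _)
      (Continuous.intervalIntegrable (by fun_prop) _ _)]
    simp only [sub_mul]
  have htri := norm_sub_norm_le (∫ φ in (-δ)..δ, F φ * w φ) (∫ φ in (-δ)..δ, v φ * w φ)
  rw [← hsplit] at htri
  -- both error terms are of order `Ω ^ (-1/2)`
  have hroot : 0 < Real.sqrt Ω := Real.sqrt_pos.2 hΩ0
  have hroot1 : 1 ≤ Real.sqrt Ω := Real.one_le_sqrt.2 hΩ1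
  have hsmall : C / Ω + C / Ω * (D * Real.sqrt ((2 * ν + 1) * Ω)) ≤ δ / 2 := by
    have h1 : C / Ω + C / Ω * (D * Real.sqrt ((2 * ν + 1) * Ω)) ≤ M / Real.sqrt Ω := by
      rw [Real.sqrt_mul (by positivity), hM]
      have h2 : Ω = Real.sqrt Ω * Real.sqrt Ω := (Real.mul_self_sqrt hΩ0.le).symm
      have h3 : C / Ω ≤ C / Real.sqrt Ω :=
        div_le_div_of_nonneg_left hC0 hroot (by nlinarith)
      have h4 : C / Ω * (D * (Real.sqrt (2 * ν + 1) * Real.sqrt Ω)) =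
          C * (D * Real.sqrt (2 * ν + 1)) / Real.sqrt Ω := by
        nth_rewrite 1 [h2]
        field_simp
      rw [h4]
      refine (add_le_add_left h3 _).trans_eq ?_
      ring
    refine h1.trans ?_
    rw [div_le_iff₀ hroot]
    have h5 : 2 * M / δ ≤ Real.sqrt Ω := Real.le_sqrt_of_sq_le (hω3.trans hΩω)
    rw [div_le_iff₀ hδ0] at h5
    linarith
  rw [div_le_iff₀ (by positivity)]
  linarith


/-! ### Precision of the convergence rate -/

lemma norm_complex_cos_le (z : ℂ) : ‖Complex.cos z‖ ≤ Real.exp |z.im| := by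
  rw [Complex.cos, norm_div, Complex.norm_ofNat, div_le_iff₀ two_pos]
  refine (norm_add_le _ _).trans ?_
  rw [Complex.norm_exp, Complex.norm_exp]
  have h1 : Real.exp (z * Complex.I).re ≤ Real.exp |z.im| := by
    rw [Real.exp_le_exp, Complex.mul_I_re]; exact neg_le_abs _
  have h2 : Real.exp (-z * Complex.I).re ≤ Real.exp |z.im| := by
    rw [Real.exp_le_exp, Complex.mul_I_re, Complex.neg_im, neg_neg]; exact le_abs_self _
  linarith

/-- The affine function of `cos z` that equals `cos φ` under the substitution
`sin (z / 2) = s sin (φ / 2)`. -/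
noncomputable def arcCosine (s : ℝ) (z : ℂ) : ℂ :=
  ((1 - 1 / s ^ 2 : ℝ) : ℂ) + ((1 / s ^ 2 : ℝ) : ℂ) * Complex.cos z

section
variable {s : ℝ}

lemma cos_two_mul_eq_arcCosine (hs : 0 < s) {z t : ℂ} (h : Complex.sin (z / 2) = s * Complex.sin t) :
    Complex.cos (2 * t) = arcCosine s z := by
  have hs' : (s : ℂ) ≠ 0 := Complex.ofReal_ne_zero.2 hs.ne'
  have h2 : Complex.cos z = 1 - 2 * Complex.sin (z / 2) ^ 2 := by
    have := Complex.cos_two_mul (z / 2)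
    rw [mul_div_cancel₀ _ two_ne_zero] at this
    rw [this, Complex.cos_sq']; ring
  rw [arcCosine, h2, h, Complex.cos_two_mul, Complex.cos_sq']
  push_cast
  field_simp
  ring

/-- Near the real axis, the substitution `sin (z / 2) = s sin t` stays close to the closed strip
`|Im t| ≤ κ₀`, `s cosh κ₀ = 1`, which it attains for `z = π`. -/
lemma exists_strip (hs : 0 < s) {b : ℝ} (hb : 0 < b) (hsb : 1 < s * Real.cosh b) :
    ∃ r : ℝ, 0 < r ∧ ∀ z t : ℂ, |z.im| < r → Complex.sin (z / 2) = s * Complex.sin t →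
      |t.im| ≤ b := by
  have hsinh : 0 < Real.sinh b := Real.sinh_pos_iff.2 hb
  have hcosh := Real.cosh_pos b
  set H : ℝ → ℝ := fun y => Real.cosh (y / 2) ^ 2 / (s * Real.cosh b) ^ 2 +
    Real.sinh (y / 2) ^ 2 / (s * Real.sinh b) ^ 2 with hH
  have hHc : Continuous H := by
    have h1 : Continuous fun y : ℝ => Real.cosh (y / 2) := Real.continuous_cosh.comp (by fun_prop)
    have h2 : Continuous fun y : ℝ => Real.sinh (y / 2) := Real.continuous_sinh.comp (by fun_prop)
    exact ((h1.pow 2).div_const _).add ((h2.pow 2).div_const _)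
  have hH0 : H 0 < 1 := by
    simp only [hH, zero_div, Real.cosh_zero, Real.sinh_zero, one_pow]
    rw [zero_pow two_ne_zero, zero_div, add_zero, div_lt_one (by positivity)]
    exact one_lt_pow₀ hsb two_ne_zero
  obtain ⟨r, hr, hball⟩ := Metric.eventually_nhds_iff.1
    (hHc.continuousAt.eventually (gt_mem_nhds hH0))
  refine ⟨r, hr, fun z t hz h => ?_⟩
  by_contra! hlt
  have hHz : H z.im < 1 := hball (by rwa [Real.dist_eq, sub_zero])
  rw [Complex.sin_eq, Complex.sin_eq t] at h
  have him : (z / 2).im = z.im / 2 := by simp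
  have hre : (z / 2).re = z.re / 2 := by simp
  rw [him, hre] at h
  norm_cast at h
  have h1 := congrArg Complex.re h
  have h2 := congrArg Complex.im h
  simp only [Complex.mul_re, Complex.mul_im, Complex.add_re, Complex.add_im, Complex.ofReal_re,
    Complex.ofReal_im, Complex.I_re, Complex.I_im, mul_zero, mul_one, zero_mul, add_zero, zero_add,
    sub_zero] at h1 h2
  have c1 : Real.cosh b ^ 2 ≤ Real.cosh t.im ^ 2 := by
    refine pow_le_pow_left₀ hcosh.le (Real.cosh_le_cosh.2 ?_) 2
    rw [abs_of_pos hb]; exact hlt.le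
  have c2 : Real.sinh b ^ 2 ≤ Real.sinh t.im ^ 2 := by
    have := Real.cosh_sq b
    have := Real.cosh_sq t.im
    linarith
  have e1 : Real.sin t.re ^ 2 ≤ Real.cosh (z.im / 2) ^ 2 / (s * Real.cosh b) ^ 2 := by
    rw [le_div_iff₀ (by positivity)]
    calc Real.sin t.re ^ 2 * (s * Real.cosh b) ^ 2
        = (s ^ 2 * Real.sin t.re ^ 2) * Real.cosh b ^ 2 := by ring
      _ ≤ (s ^ 2 * Real.sin t.re ^ 2) * Real.cosh t.im ^ 2 :=
          mul_le_mul_of_nonneg_left c1 (by positivity)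
      _ = (Real.sin (z.re / 2) * Real.cosh (z.im / 2)) ^ 2 := by rw [h1]; ring
      _ ≤ _ := by
          rw [mul_pow]
          exact mul_le_of_le_one_left (by positivity) (Real.sin_sq_le_one _)
  have e2 : Real.cos t.re ^ 2 ≤ Real.sinh (z.im / 2) ^ 2 / (s * Real.sinh b) ^ 2 := by
    rw [le_div_iff₀ (by positivity)]
    calc Real.cos t.re ^ 2 * (s * Real.sinh b) ^ 2
        = (s ^ 2 * Real.cos t.re ^ 2) * Real.sinh b ^ 2 := by ring
      _ ≤ (s ^ 2 * Real.cos t.re ^ 2) * Real.sinh t.im ^ 2 :=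
          mul_le_mul_of_nonneg_left c2 (by positivity)
      _ = (Real.cos (z.re / 2) * Real.sinh (z.im / 2)) ^ 2 := by rw [h2]; ring
      _ ≤ _ := by
          rw [mul_pow]
          exact mul_le_of_le_one_left (by positivity) (Real.cos_sq_le_one _)
  have := Real.sin_sq_add_cos_sq t.re
  simp only [hH] at hHz
  linarith

/-- `T_k (cos (2 t)) = cos (2 k t)`, bounded by means of the width of the strip that contains `t`. -/
lemma norm_chebyshev_arcCosine_le (hs : 0 < s) {b r : ℝ}
    (h : ∀ z t : ℂ, |z.im| < r → Complex.sin (z / 2) = s * Complex.sin t → |t.im| ≤ b)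
    {z : ℂ} (hz : |z.im| < r) (k : ℤ) :
    ‖(Polynomial.Chebyshev.T ℂ k).eval (arcCosine s z)‖ ≤ Real.exp (2 * b) ^ k.natAbs := by
  obtain ⟨t, ht⟩ := Complex.sin_surjective (Complex.sin (z / 2) / s)
  have hs' : (s : ℂ) ≠ 0 := Complex.ofReal_ne_zero.2 hs.ne'
  have ht' : Complex.sin (z / 2) = s * Complex.sin t := by rw [ht]; field_simp
  rw [← cos_two_mul_eq_arcCosine hs ht', Polynomial.Chebyshev.T_complex_cos]
  refine (norm_complex_cos_le _).trans ?_
  rw [← Real.exp_nat_mul, Real.exp_le_exp]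
  have him : ((k : ℂ) * (2 * t)).im = k * (2 * t.im) := by
    rw [show (k : ℂ) = ((k : ℝ) : ℂ) by push_cast; rfl, Complex.im_ofReal_mul]; simp
  rw [him, abs_mul, abs_mul, abs_two, Nat.cast_natAbs, Int.cast_abs]
  have := h z t hz ht'
  gcongr

end

/-- The Fourier coefficients of the pullback of `cos (Ω θ)` decay at the rate of the error, since
those with index beyond `n + 1` vanish for the pullback of `G_n`. -/
lemma exists_norm_fourierCoef_le_of_isBigO {T : ℝ} (hT : 1 < T) {ω σ : ℝ} (hσ : 1 < σ)
    {g : ℕ → ℝ → ℂ} (hg : ∀ n, IsContinuousFourierExtension T n (complexOscillation ω) (g n))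
    (hO : (fun n => l2Norm (complexOscillation ω - g n)) =O[atTop] fun n : ℕ => (σ ^ n)⁻¹) :
    ∃ C : ℝ, ∀ k : ℤ, ‖fourierCoef (arcPullback T (evenPart (complexOscillation ω))) k‖ ≤
      C * σ⁻¹ ^ k.natAbs := by
  have hσ0 : 0 < σ := by linarith
  obtain ⟨A, hA⟩ := hO.bound
  obtain ⟨N, hN⟩ := eventually_atTop.1 hA
  obtain ⟨K, hK0, hK⟩ := exists_integral_sq_arcPullback_le hT
  set f := complexOscillation ω with hf
  have hfc : Continuous f := continuous_complexOscillation ω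
  set F := arcPullback T (evenPart f) with hF
  have hFc : Continuous F := continuous_arcPullback T (continuous_evenPart hfc)
  set L := Real.sqrt ((2 * Real.pi)⁻¹ * K) with hL
  have hcoef : ∀ (u : ℝ → ℂ) (k : ℤ), Continuous u →
      ‖fourierCoef (arcPullback T (evenPart u)) k‖ ≤ L * l2Norm u := by
    intro u k hu
    have h1 := sum_sq_fourierCoef_le (continuous_arcPullback T (continuous_evenPart hu)) {k}
    rw [Finset.sum_singleton] at h1
    have h2 : (2 * Real.pi)⁻¹ * ∫ φ in (-Real.pi)..Real.pi, ‖arcPullback T (evenPart u) φ‖ ^ 2 ≤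
        (2 * Real.pi)⁻¹ * (K * l2Norm u ^ 2) := by
      refine mul_le_mul_of_nonneg_left ((hK _ (continuous_evenPart hu)).trans ?_)
        (by have := Real.pi_pos; positivity)
      exact mul_le_mul_of_nonneg_left
        (pow_le_pow_left₀ (l2Norm_nonneg _) (l2Norm_evenPart_le hu) 2) hK0.le
    refine abs_le_of_sq_le_sq' ?_ (mul_nonneg (Real.sqrt_nonneg _) (l2Norm_nonneg _)) |>.2
    rw [mul_pow, Real.sq_sqrt (show 0 ≤ (2 * Real.pi)⁻¹ * K by have := Real.pi_pos; positivity)]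
    linarith
  have htail : ∀ k : ℤ, N + 2 ≤ k.natAbs →
      ‖fourierCoef F k‖ ≤ L * |A| * σ ^ 2 * σ⁻¹ ^ k.natAbs := by
    intro k hk
    obtain ⟨m, hm⟩ := Nat.exists_eq_add_of_le' (show 2 ≤ k.natAbs by omega)
    have hgc := continuous_of_mem_trigSpace (hg m).1
    have h1 : fourierCoef F k = fourierCoef (arcPullback T (evenPart (f - g m))) k := by
      rw [evenPart_sub, arcPullback_sub, fourierCoef_sub hFc
        (continuous_arcPullback T (continuous_evenPart hgc)),
        fourierCoef_eq_zero_of_mem_trigPoly (arcPullback_evenPart_mem hT (hg m).1)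
          (by omega), sub_zero]
    rw [h1]
    refine (hcoef _ k (hfc.sub hgc)).trans ?_
    have h2 := hN m (by omega)
    rw [Real.norm_of_nonneg (l2Norm_nonneg _), norm_inv, norm_pow, Real.norm_of_nonneg hσ0.le] at h2
    have h3 : A * (σ ^ m)⁻¹ ≤ |A| * (σ ^ m)⁻¹ :=
      mul_le_mul_of_nonneg_right (le_abs_self A) (by positivity)
    have h4 : σ ^ 2 * σ⁻¹ ^ k.natAbs = (σ ^ m)⁻¹ := by
      rw [hm, pow_add, inv_pow, inv_pow]; field_simp
    calc _ ≤ L * (|A| * (σ ^ m)⁻¹) :=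
          mul_le_mul_of_nonneg_left (h2.trans h3) (Real.sqrt_nonneg _)
      _ = _ := by rw [← h4]; ring
  refine ⟨L * |A| * σ ^ 2 + L * l2Norm f * σ ^ (N + 2), fun k => ?_⟩
  have hL0 : 0 ≤ L := Real.sqrt_nonneg _
  have hp : 0 < σ⁻¹ ^ k.natAbs := by positivity
  have p1 : 0 ≤ L * |A| * σ ^ 2 * σ⁻¹ ^ k.natAbs := by positivity
  have p2 : 0 ≤ L * l2Norm f * σ ^ (N + 2) * σ⁻¹ ^ k.natAbs := by
    have := l2Norm_nonneg f
    positivity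
  rw [add_mul]
  rcases le_or_gt (N + 2) k.natAbs with hk | hk
  · linarith [htail k hk]
  · have h1 := hcoef f k hfc
    have h2 : 1 ≤ σ ^ (N + 2) * σ⁻¹ ^ k.natAbs := by
      rw [inv_pow, ← div_eq_mul_inv, one_le_div (by positivity)]
      exact pow_le_pow_right₀ hσ.le hk.le
    have h3 := mul_le_mul_of_nonneg_left h2 (mul_nonneg hL0 (l2Norm_nonneg f))
    rw [mul_one, ← mul_assoc] at h3
    linarith

/-- If the error decays faster than `E(T)⁻ⁿ`, the pullback of `cos (Ω θ)` has a Chebyshev expansion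
in `cos θ` that converges in a strip around the real line. By analytic continuation it represents
`cos (Ω θ)`, up to the weight, for all real `θ`. Hence `cos (Ω θ)` is symmetric about `θ = π` and
`Ω = |ω| T` is an integer. -/
theorem exists_int_of_isBigO {T : ℝ} (hT : 1 < T) {ω σ : ℝ} (hσ : extensionRate T < σ)
    {g : ℕ → ℝ → ℂ} (hg : ∀ n, IsContinuousFourierExtension T n (complexOscillation ω) (g n))
    (hO : (fun n => l2Norm (complexOscillation ω - g n)) =O[atTop] fun n : ℕ => (σ ^ n)⁻¹) :
    ∃ m : ℤ, ω = (m : ℝ) / T := by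
  have hT0 : 0 < T := by linarith
  set s := Real.sin (Real.pi / (2 * T)) with hsdef
  have hs0 : 0 < s := sin_pi_div_pos hT
  have hs1 : s < 1 := sin_pi_div_lt_one hT
  have hs2 : s ^ 2 < 1 := pow_lt_one₀ hs0.le hs1 two_ne_zero
  have hπ := Real.pi_pos
  have hσ1 : 1 < σ := (one_lt_extensionRate hT).trans hσ
  have hσ0 : 0 < σ := by linarith
  obtain ⟨C, hC⟩ := exists_norm_fourierCoef_le_of_isBigO hT hσ1 hg hO
  -- an exponent `b` strictly between the rates
  obtain ⟨b, hb1, hb2⟩ : ∃ b, annulusWidth T < b ∧ Real.exp (2 * b) < σ := by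
    rw [extensionRate_eq hT, ← Real.lt_log_iff_exp_lt hσ0] at hσ
    obtain ⟨b, hb1, hb2⟩ := exists_between (show annulusWidth T < Real.log σ / 2 by linarith)
    exact ⟨b, hb1, (Real.lt_log_iff_exp_lt hσ0).1 (by linarith)⟩
  have hκ0 := annulusWidth_pos hT
  have hb0 : 0 < b := hκ0.trans hb1
  have hsb : 1 < s * Real.cosh b := by
    rw [← sin_mul_cosh_annulusWidth hT, ← hsdef]
    refine mul_lt_mul_of_pos_left (Real.cosh_lt_cosh.2 ?_) hs0
    rwa [abs_of_pos hκ0, abs_of_pos hb0]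
  obtain ⟨r, hr, hstrip⟩ := exists_strip hs0 hb0 hsb
  set F := arcPullback T (evenPart (complexOscillation ω)) with hF
  have hFeq : ∀ φ, F φ = ((1 + Real.cos φ : ℝ) : ℂ) *
      ((Real.cos (|ω| * T * arcAngle s φ) : ℝ) : ℂ) := fun φ => by
    rw [hF, arcPullback, evenPart_complexOscillation hT]
  have hFc : Continuous F := continuous_arcPullback T
    (continuous_evenPart (continuous_complexOscillation ω))
  have hFper : ∀ φ, F (φ + 2 * Real.pi) = F φ := fun φ => by
    rw [hFeq, hFeq, arcAngle_add_two_pi, Real.cos_add_two_pi, mul_neg, Real.cos_neg]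
  have hFneg : ∀ φ, F (-φ) = F φ := fun φ => by
    rw [hFeq, hFeq, arcAngle_neg, Real.cos_neg, mul_neg, Real.cos_neg]
  set q := Real.exp (2 * b) * σ⁻¹ with hq
  have hq0 : 0 ≤ q := by positivity
  have hq1 : q < 1 := by rw [hq, ← div_eq_mul_inv, div_lt_one hσ0]; exact hb2
  have hinv1 : σ⁻¹ < 1 := inv_lt_one_of_one_lt₀ hσ1
  have hsum := fun φ => hasSum_fourierCoef hFc hFper (Summable.of_norm_bounded
    ((summable_pow_natAbs (by positivity) hinv1).mul_left C) hC) φ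
  -- the analytic continuation of `F` to a neighbourhood of the real axis in the variable `θ`
  set term : ℤ → ℂ → ℂ := fun k z =>
    fourierCoef F k * (Polynomial.Chebyshev.T ℂ k).eval (arcCosine s z) with hterm
  set U : Set ℂ := {z | |z.im| < r} with hU
  have hUo : IsOpen U := isOpen_lt (by fun_prop) continuous_const
  have hUc : IsPreconnected U := by
    have : U = Complex.im ⁻¹' Set.Ioo (-r) r := by ext z; simp [hU, abs_lt]
    rw [this]
    exact ((convex_Ioo (-r) r).linear_preimage Complex.imLm).isPreconnected
  have harc : Differentiable ℂ (arcCosine s) := by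
    unfold arcCosine
    exact (Complex.differentiable_cos.const_mul _).const_add _
  have hBd : DifferentiableOn ℂ (fun z => ∑' k, term k z) U := by
    refine Complex.differentiableOn_tsum_of_summable_norm
      ((summable_pow_natAbs hq0 hq1).mul_left C)
      (fun k => ?_) hUo fun k z hz => ?_
    · exact (((Polynomial.differentiable _).comp harc).const_mul _).differentiableOn
    · rw [hterm, norm_mul, hq, mul_pow]
      have h1 := mul_le_mul (hC k) (norm_chebyshev_arcCosine_le hs0 hstrip hz k) (norm_nonneg _)
        ((norm_nonneg _).trans (hC k))
      exact h1.trans_eq (by ring)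
  set R : ℂ → ℂ := fun z => (1 + arcCosine s z) * Complex.cos (((|ω| * T : ℝ) : ℂ) * z) with hR
  have hRd : Differentiable ℂ R :=
    (harc.const_add _).mul (Complex.differentiable_cos.comp (differentiable_id.const_mul _))
  have hreal : ∀ x : ℝ, |Real.sin (x / 2)| ≤ s → |x / 2| ≤ Real.pi / 2 →
      ∑' k, term k x = R x := by
    intro x hx hx'
    set φ := 2 * Real.arcsin (Real.sin (x / 2) / s) with hφ
    have h1 : s * Real.sin (φ / 2) = Real.sin (x / 2) := by
      have := abs_le.1 hx
      rw [hφ, mul_div_cancel_left₀ _ two_ne_zero, Real.sin_arcsin, mul_div_cancel₀ _ hs0.ne']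
      · rw [le_div_iff₀ hs0]; linarith
      · rw [div_le_iff₀ hs0]; linarith
    have h2 : arcAngle s φ = x := by
      have := abs_le.1 hx'
      rw [arcAngle, h1, Real.arcsin_sin this.1 this.2]; ring
    have h3 : arcCosine s x = ((Real.cos φ : ℝ) : ℂ) := by
      have h4 : Complex.sin ((x : ℂ) / 2) = s * Complex.sin ((φ / 2 : ℝ) : ℂ) := by
        have := congrArg (fun y : ℝ => (y : ℂ)) h1.symm
        push_cast at this ⊢
        exact this
      rw [← cos_two_mul_eq_arcCosine hs0 h4]
      push_cast; congr 1; ring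
    have h5 := ((hsum φ).add (hsum (-φ))).mul_left (1 / 2 : ℂ)
    rw [hFneg, hFeq, h2] at h5
    have h6 : ∀ k : ℤ, term k x = 1 / 2 * (fourierCoef F k * expi k φ +
        fourierCoef F k * expi k (-φ)) := by
      intro k
      rw [hterm]
      simp only
      rw [h3, Complex.ofReal_cos, Polynomial.Chebyshev.T_complex_cos]
      have h7 := cos_eq_expi k φ
      push_cast at h7
      rw [h7, expi_neg_right]; ring
    simp only [h6]
    rw [h5.tsum_eq, hR]
    simp only
    rw [h3]
    push_cast; ring
  have hfreq : ∃ᶠ z in nhdsWithin (0 : ℂ) {0}ᶜ, ∑' k, term k z = R z := by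
    have h1 : Tendsto (fun x : ℝ => (x : ℂ)) (nhdsWithin 0 {0}ᶜ) (nhdsWithin (0 : ℂ) {0}ᶜ) := by
      refine tendsto_nhdsWithin_iff.2 ⟨?_, ?_⟩
      · exact (Complex.continuous_ofReal.tendsto' 0 0 Complex.ofReal_zero).mono_left
          nhdsWithin_le_nhds
      · filter_upwards [self_mem_nhdsWithin] with x hx
        simpa using hx
    refine h1.frequently (Eventually.frequently ?_)
    have h2 : ∀ᶠ x : ℝ in nhds 0, |Real.sin (x / 2)| < s ∧ |x / 2| < Real.pi / 2 := by
      have c1 : Continuous fun x : ℝ => |Real.sin (x / 2)| := by fun_prop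
      have c2 : Continuous fun x : ℝ => |x / 2| := by fun_prop
      exact (c1.continuousAt.eventually (gt_mem_nhds (by simpa using hs0))).and
        (c2.continuousAt.eventually (gt_mem_nhds (by simpa using hπ)))
    filter_upwards [nhdsWithin_le_nhds h2] with x hx using hreal x hx.1.le hx.2.le
  have hEq := AnalyticOnNhd.eqOn_of_preconnected_of_frequently_eq (hBd.analyticOnNhd hUo)
    (hRd.differentiableOn.analyticOnNhd hUo) hUc
    (show (0 : ℂ) ∈ U by simpa [hU] using hr) hfreq
  -- the continuation depends on `cos θ` only and is therefore symmetric about `θ = π`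
  have hsymm : ∀ t : ℝ, R ((Real.pi + t : ℝ) : ℂ) = R ((Real.pi - t : ℝ) : ℂ) := by
    intro t
    have hm : ∀ y : ℝ, (y : ℂ) ∈ U := fun y => by simpa [hU] using hr
    rw [← hEq (hm _), ← hEq (hm _)]
    have : arcCosine s ((Real.pi + t : ℝ) : ℂ) = arcCosine s ((Real.pi - t : ℝ) : ℂ) := by
      rw [arcCosine, arcCosine, ← Complex.ofReal_cos, ← Complex.ofReal_cos, Real.cos_pi_sub,
        add_comm Real.pi t, Real.cos_add_pi]
    simp only [hterm, this]
  suffices h : ∃ m : ℤ, |ω| * T = m by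
    obtain ⟨m, hm⟩ := h
    rcases abs_choice ω with h | h
    · exact ⟨m, by rw [eq_div_iff hT0.ne', ← hm, h]⟩
    · refine ⟨-m, ?_⟩
      rw [eq_div_iff hT0.ne', Int.cast_neg, ← hm, h]; ring
  rcases eq_or_ne ω 0 with rfl | hω
  · exact ⟨0, by simp⟩
  set Ω := |ω| * T with hΩ
  have hΩ0 : 0 < Ω := mul_pos (abs_pos.2 hω) hT0
  obtain ⟨t, ht1, ht2⟩ : ∃ t : ℝ, 2 * s ^ 2 - 1 < Real.cos t ∧ 0 < Real.sin (Ω * t) := by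
    have h1 : ∀ᶠ t : ℝ in nhdsWithin 0 (Set.Ioi 0), 2 * s ^ 2 - 1 < Real.cos t :=
      nhdsWithin_le_nhds (Real.continuous_cos.continuousAt.eventually
        (lt_mem_nhds (by rw [Real.cos_zero]; linarith)))
    obtain ⟨t, ht, ht'⟩ := (h1.and (Ioo_mem_nhdsGT (show 0 < Real.pi / Ω by positivity))).exists
    refine ⟨t, ht, Real.sin_pos_of_pos_of_lt_pi (mul_pos hΩ0 ht'.1) ?_⟩
    have := ht'.2
    rw [lt_div_iff₀ hΩ0] at this
    linarith
  have hw : ∀ y : ℝ, Real.cos y = -Real.cos t → 1 + arcCosine s y ≠ 0 := by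
    intro y hy h
    rw [arcCosine, ← Complex.ofReal_cos, hy] at h
    have h2 : 1 + ((1 - 1 / s ^ 2) + 1 / s ^ 2 * -Real.cos t) = 0 := by exact_mod_cast h
    field_simp at h2
    nlinarith
  have h1 := hsymm t
  have hc1 : Real.cos (Real.pi + t) = -Real.cos t := by rw [add_comm, Real.cos_add_pi]
  have hc2 : Real.cos (Real.pi - t) = -Real.cos t := Real.cos_pi_sub t
  have harceq : arcCosine s ((Real.pi + t : ℝ) : ℂ) = arcCosine s ((Real.pi - t : ℝ) : ℂ) := by
    rw [arcCosine, arcCosine, ← Complex.ofReal_cos, ← Complex.ofReal_cos, hc1, hc2]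
  simp only [hR] at h1
  rw [harceq] at h1
  have h2 := mul_left_cancel₀ (hw _ hc2) h1
  have h3 : Real.cos (Ω * (Real.pi + t)) = Real.cos (Ω * (Real.pi - t)) := by exact_mod_cast h2
  rw [mul_add, mul_sub, Real.cos_add, Real.cos_sub] at h3
  have h4 : Real.sin (Ω * Real.pi) * Real.sin (Ω * t) = 0 := by linarith
  have h5 := (mul_eq_zero.1 h4).resolve_right ht2.ne'
  obtain ⟨m, hm⟩ := Real.sin_eq_zero_iff.1 h5
  exact ⟨m, (mul_right_cancel₀ hπ.ne' hm).symm⟩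


/-! ### Resolution and convergence of continuous Fourier extensions -/

/-- For `ω = m / T` the function `f_ω` is itself a trigonometric polynomial of degree `|m|`. -/
theorem complexOscillation_int_div_mem_trigSpace {T : ℝ} (hT : T ≠ 0) {m : ℤ} {n : ℕ}
    (hn : m.natAbs ≤ n) : complexOscillation ((m : ℝ) / T) ∈ trigSpace T n := by
  refine mem_trigSpace_iff.2 ⟨expi m, expi_mem_trigPoly (by rw [Int.abs_eq_natAbs]; exact_mod_cast hn), fun x => ?_⟩
  rw [complexOscillation, expi]
  congr 1
  have : (T : ℂ) ≠ 0 := by exact_mod_cast hT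
  push_cast
  field_simp

theorem mainTheorem2 (T : ℝ) (hT : 1 < T) :
    -- the continuous Fourier extension exists and is unique
    (∀ (ω : ℝ) (n : ℕ), ∃! g : ℝ → ℂ, IsContinuousFourierExtension T n (complexOscillation ω) g) ∧
    ∀ g : ℝ → ℕ → ℝ → ℂ,
      (∀ (ω : ℝ) (n : ℕ), IsContinuousFourierExtension T n (complexOscillation ω) (g ω n)) →
      -- the error is bounded, uniformly in `ω` and `n`, for `n < ω r(T) / 2`
      (∃ C : ℝ, ∀ (ω : ℝ) (n : ℕ), (n : ℝ) < 1 / 2 * |ω| * resolutionConstant T →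
        l2Norm (complexOscillation ω - g ω n) ≤ C) ∧
      -- and it does not decay there: it is bounded below in every range `n ≤ μ ω`, `μ < r(T) / 2`
      (∀ μ : ℝ, μ < 1 / 2 * resolutionConstant T →
        ∃ c : ℝ, 0 < c ∧ ∃ ω₀ : ℝ, ∀ (ω : ℝ) (n : ℕ), ω₀ ≤ |ω| → (n : ℝ) ≤ μ * |ω| →
          c ≤ l2Norm (complexOscillation ω - g ω n)) ∧
      -- exponential decay, uniformly in `ω`, from every `n = μ ω`, `μ > r(T) / 2`, on
      (∀ μ : ℝ, 1 / 2 * resolutionConstant T < μ →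
        ∃ ρ : ℝ, 1 < ρ ∧ ∃ C : ℝ, ∀ (ω : ℝ) (n : ℕ), μ * |ω| ≤ (n : ℝ) →
          l2Norm (complexOscillation ω - g ω n) ≤ C * ρ ^ (-((n : ℝ) - μ * |ω|))) ∧
      -- decay at the rate `E(T)`, uniformly in `ω`, beyond the second threshold
      (∃ C : ℝ, ∀ (ω : ℝ) (n : ℕ), rateThreshold T * |ω| < (n : ℝ) →
        l2Norm (complexOscillation ω - g ω n) ≤
          C * extensionRate T ^ (-((n : ℝ) - rateThreshold T * |ω|))) ∧
      -- this rate is precise unless `ω = m / T`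
      (∀ ω : ℝ, (¬ ∃ m : ℤ, ω = (m : ℝ) / T) →
        ExponentialRateIsPrecisely (fun n => l2Norm (complexOscillation ω - g ω n)) (extensionRate T)) ∧
      -- in which case the convergence is superexponential
      (∀ ω : ℝ, (∃ m : ℤ, ω = (m : ℝ) / T) →
        ConvergesSuperexponentially (fun n => l2Norm (complexOscillation ω - g ω n))) := by
  refine ⟨fun ω n => existsUnique_isContinuousFourierExtension T n (continuous_complexOscillation ω),
    fun g hg => ⟨⟨Real.sqrt 2, fun ω n _ => ?_⟩, fun μ hμ => ?_, fun μ hμ => ?_, ?_,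
      fun ω hω => ⟨one_lt_extensionRate hT, ?_, fun σ hσ hO => ?_⟩, ?_⟩⟩
  · have h := (hg ω n).2 0 (zero_mem_trigSpace T n)
    rw [sub_zero] at h
    exact h.trans (l2Norm_complexOscillation_le ω)
  · obtain ⟨c, hc, ω₀, h⟩ := exists_le_l2Norm_sub hT hμ
    exact ⟨c, hc, ω₀, fun ω n hω hn => h ω n _ hω hn (hg ω n)⟩
  · obtain ⟨ρ, hρ, C, h⟩ := exists_l2Norm_sub_le_of_lt hT hμ
    exact ⟨ρ, hρ, C, fun ω n _ => h ω n _ (hg ω n)⟩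
  · obtain ⟨C, h⟩ := exists_l2Norm_sub_le_extensionRate hT
    exact ⟨C, fun ω n _ => h ω n _ (hg ω n)⟩
  · obtain ⟨C, h⟩ := exists_l2Norm_sub_le_extensionRate hT
    have hE : 0 < extensionRate T := zero_lt_one.trans (one_lt_extensionRate hT)
    refine IsBigO.of_bound (C * extensionRate T ^ (rateThreshold T * |ω|))
      (Eventually.of_forall fun n => ?_)
    rw [Real.norm_of_nonneg (l2Norm_nonneg _), Real.norm_of_nonneg (by positivity)]
    refine (h ω n _ (hg ω n)).trans (le_of_eq ?_)
    rw [neg_sub, Real.rpow_sub hE, Real.rpow_natCast, div_eq_mul_inv, mul_assoc]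
  · exact hω (exists_int_of_isBigO hT hσ (hg ω) hO)
  · rintro ω ⟨m, rfl⟩ σ -
    refine EventuallyEq.trans_isBigO (f₂ := fun _ => (0 : ℝ)) ?_ (isBigO_zero _ _)
    filter_upwards [eventually_ge_atTop m.natAbs] with n hn
    have h := (hg ((m : ℝ) / T) n).2 _
      (complexOscillation_int_div_mem_trigSpace (zero_lt_one.trans hT).ne' hn)
    refine le_antisymm (h.trans (le_of_eq ?_)) (l2Norm_nonneg _)
    simp [l2Norm]
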